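/- **Setting.** Let $d\in\{2,3\}$ and let $\Omega\subset\mathbb R^d$ be a bounded polyhedral domain: $\Omega$ is open, bounded, connected, equal to the interior of $\overline\Omega$, and $\overline\Omega$ has a triangulation $\mathcal T_0$ into finitely many nondegenerate $d$-simplices. All triangulations are conforming, i.e. any two simplices meet in the (possibly empty) face spanned by their common vertices. Let $L\ge1$ and let $e_1,\dots,e_L\subset\partial\Omega$ (the electrodes, e.g. segments or planar pieces) be measurable, of positive surface measure, with pairwise disjoint closures. Let $z_1,\dots,z_L>0$, $U^\delta\in\mathbb R^L$, $I\in\mathbb R^L_\diamond:=\{V\in\mathbb R^L:\sum_l V_l=0\}$, $0<c_0<c_1$, $\varepsilon>0$ and $\widetilde\alpha>0$. Put $\mathbb H=H^1(\Omega)\times\mathbb R^L_\diamond$ with $\|(u,U)\|_{\mathbb H}^2=\|u\|_{H^1(\Omega)}^2+\|U\|^2$, and, in the sense of traces on the electrodes, $$a(\sigma,(u,U),(v,V))=\int_\Omega\sigma\nabla u\cdot\nabla v\,dx+\sum_{l=1}^L z_l^{-1}\int_{e_l}(u-U_l)(v-V_l)\,ds,$$ $$\mathcal F_\varepsilon(\sigma)=\varepsilon\|\nabla\sigma\|_{L^2(\Omega)}^2+\tfrac1\varepsilon\int_\Omega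 W(\sigma)\,dx,\qquad W(s)=(s-c_0)^2(s-c_1)^2.$$ Let $\mathcal T_0,\mathcal T_1,\mathcal T_2,\dots$ be triangulations of $\overline\Omega$ such that each $\mathcal T_{k+1}$ arises from $\mathcal T_k$ by finitely many successive bisections of simplices at edge midpoints; in particular, this covers the meshes generated by the adaptive algorithm (solve, estimate, mark, refine by bisection), whatever elements are marked. Let $V_k\subset H^1(\Omega)$ be the space of continuous functions on $\overline\Omega$ that are affine on every simplex of $\mathcal T_k$, let $\mathbb H_k=V_k\times\mathbb R^L_\diamond$ and $\widetilde{\mathcal A}_k=\{\sigma\in V_k: c_0\le\sigma\le c_1 \text{ a.e. in }\Omega\}$, and define $$\mathbb H_\infty=\overline{\bigcup_{k\ge0}\mathbb H_k}\ \text{ in }\mathbb H,\qquad \widetilde{\mathcal A}_\infty=\overline{\bigcup_{k\ge0}\widetilde{\mathcal A}_k}\ \text{ in }H^1(\Omega).$$ For $k\in\{0,1,2,\dots\}\cup\{\infty\}$ let $(P_k)$ be the problem of minimizing $$\tfrac12\|U-U^\delta\|^2+\tfrac{\widetilde\alpha}2\mathcal F_\varepsilon(\sigma)$$ over all $\sigma\in\widetilde{\mathcal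 A}_k$, where $(u,U)\in\mathbb H_k$ is a state belonging to $\sigma$, i.e. $a(\sigma,(u,U),(v,V))=\langle I,V\rangle$ for all $(v,V)\in\mathbb H_k$. A minimizer of $(P_k)$ is a pair $(\sigma,(u,U))$ of an optimal conductivity and its state. **Theorem.** 1. For every $\sigma\in\widetilde{\mathcal A}_\infty$ there is exactly one state $(u,U)\in\mathbb H_\infty$ belonging to $\sigma$, so that the limiting problem $(P_\infty)$ is well defined. 2. The limiting problem $(P_\infty)$ has at least one minimizer. 3. A minimizer of $(P_\infty)$ is obtained as a limit of discrete minimizers: for every finite $k$ the discrete problem $(P_k)$ has a minimizer, and whenever $(\sigma_k^*,(u_k^*,U_k^*))$ is a minimizer of $(P_k)$ for every $k\ge0$, there are a subsequence $(k_j)$ and a minimizer $(\sigma^*,(u^*,U^*))$ of $(P_\infty)$ such that $\sigma_{k_j}^*\to\sigma^*$ in $H^1(\Omega)$ and a.e. in $\Omega$, and $(u_{k_j}^*,U_{k_j}^*)\to(u^*,U^*)$ in $\mathbb H$. -/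

import Mathlib

open MeasureTheory Filter Topology
open scoped ContDiff ENNReal

noncomputable section

namespace EIT

/-- The Euclidean space `ℝ^d`. -/
abbrev Sp (d : ℕ) : Type := EuclideanSpace ℝ (Fin d)

variable {d L : ℕ}

/-! ### The Sobolev space `H¹(Ω)` -/

/-- `L²(Ω)` and `L²(Ω)^d`. -/
abbrev L2 (Ω : Set (Sp d)) : Type := Lp ℝ 2 (volume.restrict Ω)

abbrev L2vec (Ω : Set (Sp d)) : Type := Lp (Sp d) 2 (volume.restrict Ω)

/-- `g` is the weak gradient of `u` on `Ω`:
`∫_Ω u ∂_v φ = - ∫_Ω (g · v) φ` for all test functions `φ ∈ C_c^∞(Ω)` and all directions `v`. -/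
def IsWeakGradient (Ω : Set (Sp d)) (u : Sp d → ℝ) (g : Sp d → Sp d) : Prop :=
  ∀ φ : Sp d → ℝ, ContDiff ℝ ∞ φ → HasCompactSupport φ → tsupport φ ⊆ Ω → ∀ v : Sp d,
    ∫ x in Ω, u x * fderiv ℝ φ x v = - ∫ x in Ω, inner ℝ (g x) v * φ x

theorem integrable_mul_test {μ : Measure (Sp d)} [IsFiniteMeasureOnCompacts μ]
    {u ψ : Sp d → ℝ} (hu : MemLp u 2 μ) (hψ : Continuous ψ) (hc : HasCompactSupport ψ) :
    Integrable (fun x => u x * ψ x) μ :=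
  hu.integrable_mul (q := 2) (hψ.memLp_of_hasCompactSupport hc)

theorem continuous_fderiv_test {φ : Sp d → ℝ} (hφ : ContDiff ℝ ∞ φ) (v : Sp d) :
    Continuous (fun x => fderiv ℝ φ x v) :=
  (hφ.continuous_fderiv (by simp)).clm_apply continuous_const

theorem hasCompactSupport_fderiv_test {φ : Sp d → ℝ} (hc : HasCompactSupport φ) (v : Sp d) :
    HasCompactSupport (fun x => fderiv ℝ φ x v) :=
  hc.fderiv_apply (𝕜 := ℝ) v

theorem memLp_inner_const {Ω : Set (Sp d)} (g : L2vec Ω) (v : Sp d) :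
    MemLp (fun x => inner ℝ (g x) v) 2 (volume.restrict Ω) :=
  (Lp.memLp g).inner_const v

/-- `H¹(Ω)`, realised as the space of pairs `(u, ∇u)` with `u ∈ L²(Ω)` and weak gradient
`∇u ∈ L²(Ω)^d`. As a subspace of the Hilbert space `L²(Ω) × L²(Ω)^d` it carries the norm
`‖u‖²_{H¹(Ω)} = ‖u‖²_{L²(Ω)} + ‖∇u‖²_{L²(Ω)}`. -/
def H1 (Ω : Set (Sp d)) : Submodule ℝ (WithLp 2 (L2 Ω × L2vec Ω)) where
  carrier := {p | IsWeakGradient Ω p.fst p.snd}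
  zero_mem' := by
    intro φ _ _ _ v
    have h1 : ∀ᵐ x ∂(volume.restrict Ω), (0 : L2 Ω) x = 0 := Lp.coeFn_zero _ _ _
    have h2 : ∀ᵐ x ∂(volume.restrict Ω), (0 : L2vec Ω) x = 0 := Lp.coeFn_zero _ _ _
    have e1 : ∫ x in Ω, (0 : L2 Ω) x * fderiv ℝ φ x v = 0 := by
      refine integral_eq_zero_of_ae ?_
      filter_upwards [h1] with x hx
      rw [hx, zero_mul, Pi.zero_apply]
    have e2 : ∫ x in Ω, inner ℝ ((0 : L2vec Ω) x) v * φ x = 0 := by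
      refine integral_eq_zero_of_ae ?_
      filter_upwards [h2] with x hx
      rw [hx, inner_zero_left, zero_mul, Pi.zero_apply]
    change ∫ x in Ω, (0 : L2 Ω) x * fderiv ℝ φ x v
      = - ∫ x in Ω, inner ℝ ((0 : L2vec Ω) x) v * φ x
    rw [e1, e2, neg_zero]
  add_mem' := by
    intro p q hp hq φ hφ hc hs v
    have h1 := Lp.coeFn_add p.fst q.fst
    have h2 := Lp.coeFn_add p.snd q.snd
    have e1 : ∫ x in Ω, (p.fst + q.fst : L2 Ω) x * fderiv ℝ φ x v
        = (∫ x in Ω, p.fst x * fderiv ℝ φ x v) + ∫ x in Ω, q.fst x * fderiv ℝ φ x v := by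
      rw [← integral_add
        (integrable_mul_test (Lp.memLp p.fst) (continuous_fderiv_test hφ v)
          (hasCompactSupport_fderiv_test hc v))
        (integrable_mul_test (Lp.memLp q.fst) (continuous_fderiv_test hφ v)
          (hasCompactSupport_fderiv_test hc v))]
      refine integral_congr_ae ?_
      filter_upwards [h1] with x hx
      simp only [hx, Pi.add_apply]
      ring
    have e2 : ∫ x in Ω, inner ℝ ((p.snd + q.snd : L2vec Ω) x) v * φ x
        = (∫ x in Ω, inner ℝ (p.snd x) v * φ x) + ∫ x in Ω, inner ℝ (q.snd x) v * φ x := by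
      rw [← integral_add
        (integrable_mul_test (memLp_inner_const p.snd v) hφ.continuous hc)
        (integrable_mul_test (memLp_inner_const q.snd v) hφ.continuous hc)]
      refine integral_congr_ae ?_
      filter_upwards [h2] with x hx
      simp only [hx, Pi.add_apply, inner_add_left]
      ring
    change ∫ x in Ω, (p.fst + q.fst : L2 Ω) x * fderiv ℝ φ x v
      = - ∫ x in Ω, inner ℝ ((p.snd + q.snd : L2vec Ω) x) v * φ x
    rw [e1, e2, hp φ hφ hc hs v, hq φ hφ hc hs v]
    ring
  smul_mem' := by
    intro c p hp φ hφ hc hs v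
    have h1 := Lp.coeFn_smul c p.fst
    have h2 := Lp.coeFn_smul c p.snd
    have e1 : ∫ x in Ω, (c • p.fst : L2 Ω) x * fderiv ℝ φ x v
        = c * ∫ x in Ω, p.fst x * fderiv ℝ φ x v := by
      rw [← integral_const_mul]
      refine integral_congr_ae ?_
      filter_upwards [h1] with x hx
      simp only [hx, Pi.smul_apply, smul_eq_mul]
      ring
    have e2 : ∫ x in Ω, inner ℝ ((c • p.snd : L2vec Ω) x) v * φ x
        = c * ∫ x in Ω, inner ℝ (p.snd x) v * φ x := by
      rw [← integral_const_mul]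
      refine integral_congr_ae ?_
      filter_upwards [h2] with x hx
      simp only [hx, Pi.smul_apply, real_inner_smul_left]
      ring
    change ∫ x in Ω, (c • p.fst : L2 Ω) x * fderiv ℝ φ x v
      = - ∫ x in Ω, inner ℝ ((c • p.snd : L2vec Ω) x) v * φ x
    rw [e1, e2, hp φ hφ hc hs v]
    ring

/-- The function underlying an element of `H¹(Ω)`. -/
def fn {Ω : Set (Sp d)} (u : H1 Ω) : L2 Ω := (u : WithLp 2 (L2 Ω × L2vec Ω)).fst

/-- The (weak) gradient of an element of `H¹(Ω)`. -/
def grad {Ω : Set (Sp d)} (u : H1 Ω) : L2vec Ω := (u : WithLp 2 (L2 Ω × L2vec Ω)).snd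

/-! ### Boundary values -/

/-- The surface measure on `∂Ω`: the `(d-1)`-dimensional Hausdorff measure, normalised to agree
with Lebesgue measure on hyperplanes. -/
def surf (Ω : Set (Sp d)) : Measure (Sp d) :=
  (Measure.euclideanHausdorffMeasure (d - 1)).restrict (frontier Ω)

/-- `g ∈ L²(∂Ω)` is the trace of `u ∈ H¹(Ω)`: there are `w_n ∈ H¹(Ω) ∩ C(closure Ω)`, with continuous
representatives `f_n`, such that `w_n → u` in `H¹(Ω)` and `f_n → g` in `L²(∂Ω)`. -/
def IsTrace {Ω : Set (Sp d)} (u : H1 Ω) (g : Lp ℝ 2 (surf Ω)) : Prop :=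
  ∃ (f : ℕ → Sp d → ℝ) (w : ℕ → H1 Ω),
    (∀ n, ContinuousOn (f n) (closure Ω)) ∧
    (∀ n, fn (w n) =ᵐ[volume.restrict Ω] f n) ∧
    Tendsto w atTop (𝓝 u) ∧
    Tendsto (fun n => eLpNorm (fun x => f n x - g x) 2 (surf Ω)) atTop (𝓝 0)

open Classical in
/-- The trace operator `H¹(Ω) → L²(∂Ω)` (with the value `0` where there is no trace, which does
not occur on the domains considered). -/
def trace {Ω : Set (Sp d)} (u : H1 Ω) : Lp ℝ 2 (surf Ω) :=
  if h : ∃ g, IsTrace u g then h.choose else 0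

/-! ### The complete electrode model -/

/-- `ℝ^L_⋄`, the vectors in `ℝ^L` with vanishing sum. -/
def RDiamond (L : ℕ) : Submodule ℝ (EuclideanSpace ℝ (Fin L)) where
  carrier := {V | ∑ l, V l = 0}
  zero_mem' := by simp
  add_mem' := by
    intro a b ha hb
    simp only [Set.mem_ofPred_eq, PiLp.add_apply, Finset.sum_add_distrib] at *
    rw [ha, hb, add_zero]
  smul_mem' := by
    intro c a ha
    simp only [Set.mem_ofPred_eq, PiLp.smul_apply, smul_eq_mul, ← Finset.mul_sum] at *
    rw [ha, mul_zero]

/-- `ℍ = H¹(Ω) ⊗ ℝ^L_⋄` with `‖(u,U)‖² = ‖u‖²_{H¹(Ω)} + ‖U‖²`. -/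
abbrev HH (Ω : Set (Sp d)) (L : ℕ) : Type := WithLp 2 (H1 Ω × RDiamond L)

/-- The electrode `l` carries the voltage `U_l`. -/
def volt {Ω : Set (Sp d)} (w : HH Ω L) : EuclideanSpace ℝ (Fin L) := w.snd

/-- The form
`a(σ,(u,U),(v,V)) = (σ∇u,∇v) + ∑_l z_l⁻¹ (u-U_l, v-V_l)_{L²(e_l)}`. -/
def aForm {Ω : Set (Sp d)} (e : Fin L → Set (Sp d)) (z : Fin L → ℝ)
    (σ : H1 Ω) (w w' : HH Ω L) : ℝ :=
  (∫ x in Ω, fn σ x * inner ℝ (grad w.fst x) (grad w'.fst x)) +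
    ∑ l, (z l)⁻¹ * ∫ x in e l, (trace w.fst x - volt w l) * (trace w'.fst x - volt w' l) ∂(surf Ω)

/-- `w = (u,U)` is the state in the subspace `S` of `ℍ` for the conductivity `σ` and current `I`:
`w ∈ S` and `a(σ,(u,U),(v,V)) = ⟨I,V⟩` for all `(v,V) ∈ S`. -/
def IsState {Ω : Set (Sp d)} (e : Fin L → Set (Sp d)) (z : Fin L → ℝ)
    (I : EuclideanSpace ℝ (Fin L)) (S : Set (HH Ω L)) (σ : H1 Ω) (w : HH Ω L) : Prop :=
  w ∈ S ∧ ∀ w' ∈ S, aForm e z σ w w' = inner ℝ I (volt w')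

/-! ### The regularized functional -/

/-- The double-well potential. -/
def W (c₀ c₁ s : ℝ) : ℝ := (s - c₀) ^ 2 * (s - c₁) ^ 2

/-- The Modica–Mortola functional on `H¹(Ω)`. -/
def modicaMortola {Ω : Set (Sp d)} (c₀ c₁ ε : ℝ) (σ : H1 Ω) : ℝ :=
  ε * ‖grad σ‖ ^ 2 + 1 / ε * ∫ x in Ω, W c₀ c₁ (fn σ x)

/-- `½‖U - U^δ‖² + (α/2) F_ε(σ)`. -/
def cost {Ω : Set (Sp d)} (c₀ c₁ ε α : ℝ) (Uδ : EuclideanSpace ℝ (Fin L))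
    (σ : H1 Ω) (U : EuclideanSpace ℝ (Fin L)) : ℝ :=
  1 / 2 * ‖U - Uδ‖ ^ 2 + α / 2 * modicaMortola c₀ c₁ ε σ

/-- `(σ,w)` solves the problem of minimizing the functional over `σ ∈ A`, where `w = (u,U)` is the
state in `S` belonging to `σ`. -/
def IsMinimizer {Ω : Set (Sp d)} (e : Fin L → Set (Sp d)) (z : Fin L → ℝ)
    (I Uδ : EuclideanSpace ℝ (Fin L)) (c₀ c₁ ε α : ℝ) (A : Set (H1 Ω)) (S : Set (HH Ω L))
    (σ : H1 Ω) (w : HH Ω L) : Prop :=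
  σ ∈ A ∧ IsState e z I S σ w ∧
    ∀ σ' ∈ A, ∀ w', IsState e z I S σ' w' →
      cost c₀ c₁ ε α Uδ σ (volt w) ≤ cost c₀ c₁ ε α Uδ σ' (volt w')

/-! ### Triangulations, bisection and finite element spaces -/

/-- A finite collection of simplices, each given by its vertices. -/
abbrev Mesh (d : ℕ) : Type := Finset (Finset (Sp d))

/-- `𝒯` is a conforming triangulation of `K` into `d`-simplices: every `T ∈ 𝒯` is a nondegenerate
simplex, any two meet in the (possibly empty) face spanned by their common vertices, and they
cover exactly `K`. -/
def IsTriangulation (K : Set (Sp d)) (𝒯 : Mesh d) : Prop :=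
  (∀ T ∈ 𝒯, T.card = d + 1 ∧ AffineIndependent ℝ (fun x : T => (x : Sp d))) ∧
  (∀ T ∈ 𝒯, ∀ T' ∈ 𝒯, convexHull ℝ (T : Set (Sp d)) ∩ convexHull ℝ (T' : Set (Sp d)) =
    convexHull ℝ ((T : Set (Sp d)) ∩ (T' : Set (Sp d)))) ∧
  (⋃ T ∈ 𝒯, convexHull ℝ (T : Set (Sp d))) = K

open Classical in
/-- One bisection: a simplex `T ∈ 𝒯` is replaced by the two simplices into which it is cut at the
midpoint of one of its edges `[a,b]`. -/
def BisectStep (𝒯 𝒯' : Mesh d) : Prop :=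
  ∃ T ∈ 𝒯, ∃ a ∈ T, ∃ b ∈ T, a ≠ b ∧
    𝒯' = insert (insert (midpoint ℝ a b) (T.erase a))
      (insert (insert (midpoint ℝ a b) (T.erase b)) (𝒯.erase T))

/-- `𝒯'` arises from `𝒯` by finitely many successive bisections. -/
def IsBisectionRefinement (𝒯 𝒯' : Mesh d) : Prop := Relation.ReflTransGen BisectStep 𝒯 𝒯'

/-- `V_𝒯`, the elements of `H¹(Ω)` represented by a function that is continuous on `closure Ω` and
affine on each simplex of `𝒯`. -/
def femSpace (Ω : Set (Sp d)) (𝒯 : Mesh d) : Set (H1 Ω) :=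
  {u | ∃ f : Sp d → ℝ, ContinuousOn f (closure Ω) ∧
    (∀ T ∈ 𝒯, ∃ p : Sp d →ᵃ[ℝ] ℝ, ∀ x ∈ convexHull ℝ (T : Set (Sp d)), f x = p x) ∧
    fn u =ᵐ[volume.restrict Ω] f}

/-- The admissible set `{σ ∈ H¹(Ω) : c₀ ≤ σ ≤ c₁ a.e.}`. -/
def admissible (Ω : Set (Sp d)) (c₀ c₁ : ℝ) : Set (H1 Ω) :=
  {σ | ∀ᵐ x ∂(volume.restrict Ω), c₀ ≤ fn σ x ∧ fn σ x ≤ c₁}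

/-- The discrete admissible set. -/
def admissibleFem (Ω : Set (Sp d)) (c₀ c₁ : ℝ) (𝒯 : Mesh d) : Set (H1 Ω) :=
  femSpace Ω 𝒯 ∩ admissible Ω c₀ c₁

/-- `ℍ_𝒯 = V_𝒯 ⊗ ℝ^L_⋄`. -/
def HHfem (Ω : Set (Sp d)) (L : ℕ) (𝒯 : Mesh d) : Set (HH Ω L) :=
  {w | w.fst ∈ femSpace Ω 𝒯}

/-- `Ã_∞`, the closure in `H¹(Ω)` of the union of the discrete admissible sets. -/
def admissibleLim (Ω : Set (Sp d)) (c₀ c₁ : ℝ) (𝒯 : ℕ → Mesh d) : Set (H1 Ω) :=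
  closure (⋃ k, admissibleFem Ω c₀ c₁ (𝒯 k))

/-- `ℍ_∞`, the closure in `ℍ` of the union of the spaces `ℍ_k`. -/
def HHlim (Ω : Set (Sp d)) (L : ℕ) (𝒯 : ℕ → Mesh d) : Set (HH Ω L) :=
  closure (⋃ k, HHfem Ω L (𝒯 k))

end EIT

end

/-!
The limiting problem has a minimizer, and discrete minimizers converge to one, by the direct method
of the calculus of variations with a recovery sequence, once the state depends continuously on the
conductivity and on the finite element space at the same time.

**State equation.** The form is bounded and coercive on the pairs `(u, U)` for which `u` has a
trace, uniformly over conductivities between `c₀` and `c₁` (`exists_isCoerciveForm`), so the state exists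
and is unique in every closed subspace of these pairs (`existsUnique_isState`). Coercivity follows
by contradiction (`not_tendsto_energy_zero`): unit vectors whose energy tends to zero subconverge,
by Rellich's theorem, to a constant potential which agrees with the voltage on each electrode; the
voltages sum to zero, so the limit vanishes. Two properties of a polyhedral domain enter here.

* Rellich's theorem (`tendsto_fn_of_weak`): each simplex is cut by a fine grid into small convex
  pieces, on which Poincaré's inequality bounds the `L²` norm by the mean value and a small multiple
  of the gradient; the finitely many mean values converge under weak convergence.
* The trace inequality (`exists_lintegral_surf_le`): the boundary is covered by faces of simplices,
  and on each face one integrates the derivative along the rays from the opposite vertex.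

Both are proved first for smooth functions and then transferred by mollification.

**Convergence of the states.** If admissible conductivities converge almost everywhere, the current
densities `σ ∇u` of a fixed potential converge in `L²` by dominated convergence (`tendsto_flux`),
and Céa's argument gives convergence of the states, even if the subspace grows along the sequence
(`tendsto_galerkin`, `tendsto_state`).

**Minimizers.** The central statement is `exists_subseq_tendsto_minimizer`, on sequences which
minimize up to an error tending to zero. The gradients are bounded, so a subsequence of the
conductivities converges weakly in `H¹` and almost everywhere; the limit is admissible since closed
convex sets are weakly closed. All parts of the functional except for the gradient norm converge.
Elements of the discrete admissible sets that converge strongly to a competitor bound the gradient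
norms from above; for an arbitrary competitor this gives minimality of the limit, and for the limit
itself it gives convergence of the gradient norms, hence strong convergence. Applied to a constant
sequence of spaces it also yields the existence of minimizers (`exists_isMinimizer`), in the
limiting problem as well as in the discrete ones, where the finite element spaces are closed because they are
finite-dimensional (`finiteDimensional_femSubmodule`). The spaces increase with refinement since
each simplex of a bisected mesh lies in a simplex of the old one (`BisectStep.exists_subset`).
-/

namespace EIT

variable {d L : ℕ}

/-! ### Mollification -/

/-- The Cauchy–Schwarz inequality against the constant function `1`. -/
theorem sq_lintegral_le {α : Type*} [MeasurableSpace α] (μ : Measure α) {f : α → ℝ≥0∞}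
    (hf : AEMeasurable f μ) : (∫⁻ x, f x ∂μ) ^ 2 ≤ μ Set.univ * ∫⁻ x, f x ^ 2 ∂μ := by
  have h := ENNReal.lintegral_mul_le_Lp_mul_Lq μ Real.HolderConjugate.two_two hf
    (aemeasurable_const (b := (1 : ℝ≥0∞)))
  simp only [Pi.mul_apply, mul_one, ENNReal.one_rpow, lintegral_const, one_mul] at h
  calc (∫⁻ x, f x ∂μ) ^ 2
      ≤ ((∫⁻ x, f x ^ (2 : ℝ) ∂μ) ^ (1 / (2 : ℝ)) * μ Set.univ ^ (1 / (2 : ℝ))) ^ 2 := by gcongr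
    _ = μ Set.univ * ∫⁻ x, f x ^ 2 ∂μ := by
      rw [mul_pow, ← ENNReal.rpow_natCast, ← ENNReal.rpow_natCast, ← ENNReal.rpow_mul,
        ← ENNReal.rpow_mul, mul_comm]
      simp

/-- The Cauchy–Schwarz inequality with respect to the measure with density `w`. -/
theorem sq_lintegral_mul_le {α : Type*} [MeasurableSpace α] (μ : Measure α) {w f : α → ℝ≥0∞}
    (hw : AEMeasurable w μ) (hf : AEMeasurable f μ) :
    (∫⁻ x, w x * f x ∂μ) ^ 2 ≤ (∫⁻ x, w x ∂μ) * ∫⁻ x, w x * f x ^ 2 ∂μ := by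
  have h := sq_lintegral_le (μ.withDensity w) (hf.mono_ac (withDensity_absolutelyContinuous μ w))
  rw [lintegral_withDensity_eq_lintegral_mul₀ hw hf,
    lintegral_withDensity_eq_lintegral_mul₀ hw (hf.pow_const 2),
    withDensity_apply _ MeasurableSet.univ, setLIntegral_univ] at h
  exact h

/-- The weight `y ↦ φ(x - y)` of a normalised bump function. -/
noncomputable def bumpWeight (φ : ContDiffBump (0 : Sp d)) (x y : Sp d) : ℝ≥0∞ :=
  ENNReal.ofReal (φ.normed volume (x - y))

theorem measurable_bumpWeight (φ : ContDiffBump (0 : Sp d)) :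
    Measurable (Function.uncurry (bumpWeight φ)) := by
  have : Continuous (fun p : Sp d × Sp d => φ.normed volume (p.1 - p.2)) :=
    φ.continuous_normed.comp (continuous_fst.sub continuous_snd)
  exact this.measurable.ennreal_ofReal

theorem lintegral_bumpWeight_right (φ : ContDiffBump (0 : Sp d)) (x : Sp d) :
    ∫⁻ y, bumpWeight φ x y = 1 := by
  unfold bumpWeight
  rw [lintegral_sub_left_eq_self (fun z => ENNReal.ofReal (φ.normed volume z)) x,
    ← ofReal_integral_eq_lintegral_ofReal φ.integrable_normed
      (Eventually.of_forall fun z => φ.nonneg_normed z), φ.integral_normed, ENNReal.ofReal_one]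

theorem lintegral_bumpWeight_left (φ : ContDiffBump (0 : Sp d)) (y : Sp d) :
    ∫⁻ x, bumpWeight φ x y = 1 := by
  unfold bumpWeight
  rw [lintegral_sub_right_eq_self (fun z => ENNReal.ofReal (φ.normed volume z)) y,
    ← ofReal_integral_eq_lintegral_ofReal φ.integrable_normed
      (Eventually.of_forall fun z => φ.nonneg_normed z), φ.integral_normed, ENNReal.ofReal_one]

theorem dist_lt_of_bumpWeight_ne_zero {φ : ContDiffBump (0 : Sp d)} {x y : Sp d}
    (h : bumpWeight φ x y ≠ 0) : dist x y < φ.rOut := by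
  by_contra hxy
  apply h
  have : x - y ∉ Function.support (φ.normed volume) := by
    rw [φ.support_normed_eq, Metric.mem_ball, dist_zero_right, ← dist_eq_norm]
    exact hxy
  simp [bumpWeight, Function.notMem_support.1 this]

/-- Averaging against a bump function does not increase the `L²` norm, up to enlarging the domain
by the radius of the bump. -/
theorem setLIntegral_sq_bump_le (φ : ContDiffBump (0 : Sp d)) {h : Sp d → ℝ≥0∞}
    (hh : AEMeasurable h) {K U : Set (Sp d)} (hU : MeasurableSet U)
    (hKU : Metric.cthickening φ.rOut K ⊆ U) :
    ∫⁻ x in K, (∫⁻ y, bumpWeight φ x y * h y) ^ 2 ≤ ∫⁻ y in U, h y ^ 2 := by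
  have hm := measurable_bumpWeight φ
  -- Jensen's inequality for the probability density `bumpWeight φ x`, then Tonelli
  have hJ : ∀ x, (∫⁻ y, bumpWeight φ x y * h y) ^ 2 ≤ ∫⁻ y, bumpWeight φ x y * h y ^ 2 := by
    intro x
    have hx : Measurable (bumpWeight φ x) := hm.of_uncurry_left
    have := sq_lintegral_mul_le volume hx.aemeasurable hh
    rwa [lintegral_bumpWeight_right, one_mul] at this
  calc ∫⁻ x in K, (∫⁻ y, bumpWeight φ x y * h y) ^ 2
      ≤ ∫⁻ x in K, ∫⁻ y, bumpWeight φ x y * h y ^ 2 := lintegral_mono fun x => hJ x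
    _ = ∫⁻ y, ∫⁻ x in K, bumpWeight φ x y * h y ^ 2 := by
      apply lintegral_lintegral_swap
      refine AEMeasurable.mul hm.aemeasurable ?_
      exact (hh.pow_const 2).comp_snd
    _ = ∫⁻ y, h y ^ 2 * ∫⁻ x in K, bumpWeight φ x y := by
      refine lintegral_congr fun y => ?_
      rw [lintegral_mul_const _ (hm.of_uncurry_right), mul_comm]
    _ ≤ ∫⁻ y, U.indicator (fun y => h y ^ 2) y := by
      refine lintegral_mono fun y => ?_
      by_cases hy : y ∈ U
      · rw [Set.indicator_of_mem hy]
        calc h y ^ 2 * ∫⁻ x in K, bumpWeight φ x y ≤ h y ^ 2 * 1 := by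
              gcongr
              exact (setLIntegral_le_lintegral _ _).trans (lintegral_bumpWeight_left φ y).le
          _ = h y ^ 2 := mul_one _
      · have : ∫⁻ x in K, bumpWeight φ x y = 0 := by
          have : ∫⁻ x in K, bumpWeight φ x y ≤ ∫⁻ x in K, 0 := by
            refine setLIntegral_mono measurable_const fun x hx => ?_
            by_contra hne
            have hlt := dist_lt_of_bumpWeight_ne_zero (fun h0 => hne h0.le)
            exact hy (hKU (Metric.mem_cthickening_of_dist_le y x _ _ hx
              (by rw [dist_comm]; exact hlt.le)))
          simpa using this
        simp [this]
    _ = ∫⁻ y in U, h y ^ 2 := lintegral_indicator hU _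

/-- The mollification of `u` (extended by zero outside `Ω`) with a normalised bump function. -/
noncomputable def moll (Ω : Set (Sp d)) (φ : ContDiffBump (0 : Sp d)) (u : Sp d → ℝ) : Sp d → ℝ :=
  convolution (φ.normed volume) (Ω.indicator u) (ContinuousLinearMap.lsmul ℝ ℝ) volume

theorem moll_apply (Ω : Set (Sp d)) (φ : ContDiffBump (0 : Sp d)) (u : Sp d → ℝ) (x : Sp d) :
    moll Ω φ u x = ∫ y, φ.normed volume (x - y) * Ω.indicator u y := by
  simp [moll, convolution_eq_swap]

section

variable {Ω : Set (Sp d)} {u : Sp d → ℝ} {g : Sp d → Sp d}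

theorem memLp_indicator_of_restrict (hΩ : MeasurableSet Ω) {F : Type*} [NormedAddCommGroup F]
    {u : Sp d → F} (hu : MemLp u 2 (volume.restrict Ω)) : MemLp (Ω.indicator u) 2 volume :=
  (memLp_indicator_iff_restrict hΩ).2 hu

theorem locallyIntegrable_indicator (hΩ : MeasurableSet Ω) {F : Type*} [NormedAddCommGroup F]
    {u : Sp d → F} (hu : MemLp u 2 (volume.restrict Ω)) :
    LocallyIntegrable (Ω.indicator u) volume :=
  (memLp_indicator_of_restrict hΩ hu).locallyIntegrable (by norm_num)

theorem contDiff_moll (hΩ : MeasurableSet Ω) (φ : ContDiffBump (0 : Sp d))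
    (hu : MemLp u 2 (volume.restrict Ω)) : ContDiff ℝ 1 (moll Ω φ u) :=
  φ.hasCompactSupport_normed.contDiff_convolution_left _ (n := 1)
    φ.contDiff_normed (locallyIntegrable_indicator hΩ hu)

/-- Where the ball of the bump lies in `Ω`, the derivative of the mollification is the mollified
weak gradient. -/
theorem fderiv_moll_apply (hΩ : IsOpen Ω) (φ : ContDiffBump (0 : Sp d))
    (hu : MemLp u 2 (volume.restrict Ω)) (hg : IsWeakGradient Ω u g) {x : Sp d}
    (hx : Metric.closedBall x φ.rOut ⊆ Ω) (w : Sp d) :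
    fderiv ℝ (moll Ω φ u) x w =
      ∫ y in Ω, inner ℝ (g y) w * φ.normed volume (x - y) := by
  have hli := locallyIntegrable_indicator hΩ.measurableSet hu
  have hc1 : ContDiff ℝ 1 (φ.normed (volume : Measure (Sp d))) := φ.contDiff_normed
  have hcs := φ.hasCompactSupport_normed (μ := (volume : Measure (Sp d)))
  have hd := hcs.hasFDerivAt_convolution_left (ContinuousLinearMap.lsmul ℝ ℝ) hc1 hli x
  rw [moll, hd.fderiv]
  have hex : ConvolutionExistsAt (fderiv ℝ (φ.normed (volume : Measure (Sp d)))) (Ω.indicator u) x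
      (ContinuousLinearMap.precompL (Sp d) (ContinuousLinearMap.lsmul ℝ ℝ)) volume :=
    (hcs.fderiv (𝕜 := ℝ)).convolutionExists_left _ (hc1.continuous_fderiv one_ne_zero) hli x
  -- the test function `y ↦ φ(x - y)`
  set ψ : Sp d → ℝ := fun y => φ.normed volume (x - y) with hψ
  have hψs : ContDiff ℝ ∞ ψ := φ.contDiff_normed.comp (contDiff_const.sub contDiff_id)
  have hts : tsupport ψ ⊆ Metric.closedBall x φ.rOut := by
    refine closure_minimal ?_ Metric.isClosed_closedBall
    intro y hy
    have : x - y ∈ Function.support (φ.normed (volume : Measure (Sp d))) := hy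
    rw [φ.support_normed_eq, Metric.mem_ball, dist_zero_right, ← dist_eq_norm] at this
    rw [Metric.mem_closedBall, dist_comm]
    exact this.le
  have hψc : HasCompactSupport ψ :=
    (isCompact_closedBall x φ.rOut).of_isClosed_subset (isClosed_tsupport _) hts
  have hfd : ∀ y, fderiv ℝ ψ y w = - fderiv ℝ (φ.normed volume) (x - y) w := by
    intro y
    have h1 : HasFDerivAt (fun y : Sp d => x - y) (-ContinuousLinearMap.id ℝ (Sp d)) y := by
      simpa using (hasFDerivAt_id y).const_sub x
    have h2 := ((hc1.differentiable (by simp)).differentiableAt (x := x - y)).hasFDerivAt.comp y h1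
    rw [show ψ = φ.normed volume ∘ (fun y : Sp d => x - y) from rfl, h2.fderiv]
    simp
  have key := hg ψ hψs hψc (hts.trans hx) w
  rw [convolution_eq_swap, ContinuousLinearMap.integral_apply]
  · have : ∀ y, (ContinuousLinearMap.precompL (Sp d) (ContinuousLinearMap.lsmul ℝ ℝ)
        (fderiv ℝ (φ.normed volume) (x - y)) (Ω.indicator u y)) w
        = Ω.indicator (fun y => - (u y * fderiv ℝ ψ y w)) y := by
      intro y
      by_cases hy : y ∈ Ω <;> simp [ContinuousLinearMap.precompL, hfd, hy, mul_comm]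
    simp_rw [this]
    rw [integral_indicator hΩ.measurableSet, integral_neg, key, neg_neg]
  · rw [convolutionExistsAt_iff_integrable_swap] at hex
    exact hex

theorem enorm_fderiv_moll_le (hΩ : IsOpen Ω) (φ : ContDiffBump (0 : Sp d))
    (hu : MemLp u 2 (volume.restrict Ω)) (hgL : MemLp g 2 (volume.restrict Ω))
    (hg : IsWeakGradient Ω u g) {x : Sp d}
    (hx : Metric.closedBall x φ.rOut ⊆ Ω) :
    ‖fderiv ℝ (moll Ω φ u) x‖ₑ ≤ ∫⁻ y, bumpWeight φ x y * ‖Ω.indicator g y‖ₑ := by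
  have hint : Integrable (fun y => φ.normed volume (x - y) * ‖Ω.indicator g y‖) volume := by
    have hc : HasCompactSupport (fun y : Sp d => φ.normed volume (x - y)) :=
      φ.hasCompactSupport_normed.comp_homeomorph (Homeomorph.subLeft x)
    have hcont : Continuous (fun y : Sp d => φ.normed volume (x - y)) :=
      φ.continuous_normed.comp (continuous_const.sub continuous_id)
    exact (hcont.memLp_of_hasCompactSupport hc (p := 2)).integrable_mul (q := 2)
      (memLp_indicator_of_restrict hΩ.measurableSet hgL).norm
  have hnn : ∀ y, 0 ≤ φ.normed volume (x - y) := fun y => φ.nonneg_normed _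
  have hle : ‖fderiv ℝ (moll Ω φ u) x‖ ≤ ∫ y, φ.normed volume (x - y) * ‖Ω.indicator g y‖ := by
    refine ContinuousLinearMap.opNorm_le_bound _
      (integral_nonneg fun y => mul_nonneg (hnn y) (norm_nonneg _)) fun w => ?_
    rw [fderiv_moll_apply hΩ φ hu hg hx w, ← integral_indicator hΩ.measurableSet,
      ← integral_mul_const]
    refine norm_integral_le_of_norm_le (hint.mul_const _) (Eventually.of_forall fun y => ?_)
    by_cases hy : y ∈ Ω
    · simp only [hy, Set.indicator_of_mem, norm_mul]
      rw [Real.norm_of_nonneg (hnn y)]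
      calc ‖inner ℝ (g y) w‖ * φ.normed volume (x - y) ≤ (‖g y‖ * ‖w‖) * φ.normed volume (x - y) :=
            mul_le_mul_of_nonneg_right (norm_inner_le_norm _ _) (hnn y)
        _ = _ := by ring
    · simp [hy]
  calc ‖fderiv ℝ (moll Ω φ u) x‖ₑ = ENNReal.ofReal ‖fderiv ℝ (moll Ω φ u) x‖ :=
        (ofReal_norm _).symm
    _ ≤ ENNReal.ofReal (∫ y, φ.normed volume (x - y) * ‖Ω.indicator g y‖) :=
        ENNReal.ofReal_le_ofReal hle
    _ = ∫⁻ y, bumpWeight φ x y * ‖Ω.indicator g y‖ₑ := by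
        rw [ofReal_integral_eq_lintegral_ofReal hint
          (Eventually.of_forall fun y => mul_nonneg (hnn y) (norm_nonneg _))]
        refine lintegral_congr fun y => ?_
        rw [ENNReal.ofReal_mul (hnn y), ofReal_norm]
        rfl

theorem enorm_moll_le (φ : ContDiffBump (0 : Sp d)) (x : Sp d) :
    ‖moll Ω φ u x‖ₑ ≤ ∫⁻ y, bumpWeight φ x y * ‖Ω.indicator u y‖ₑ := by
  rw [moll_apply]
  refine (enorm_integral_le_lintegral_enorm _).trans (lintegral_mono fun y => ?_)
  rw [enorm_mul, bumpWeight, Real.enorm_of_nonneg (φ.nonneg_normed _)]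

/-- Bump functions shrinking to the origin. -/
noncomputable def bumpSeq (d : ℕ) (n : ℕ) : ContDiffBump (0 : Sp d) where
  rIn := 1 / (n + 1) / 2
  rOut := 1 / (n + 1)
  rIn_pos := by positivity
  rIn_lt_rOut := by
    have : (0 : ℝ) < 1 / (n + 1) := by positivity
    linarith

theorem tendsto_bumpSeq_rOut : Tendsto (fun n => (bumpSeq d n).rOut) atTop (𝓝 0) :=
  tendsto_one_div_add_atTop_nhds_zero_nat

theorem ae_tendsto_moll (hΩ : MeasurableSet Ω) (hu : MemLp u 2 (volume.restrict Ω)) :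
    ∀ᵐ x ∂(volume.restrict Ω),
      Tendsto (fun n => moll Ω (bumpSeq d n) u x) atTop (𝓝 (u x)) := by
  have h := ContDiffBump.ae_convolution_tendsto_right_of_locallyIntegrable (K := 2)
    (φ := bumpSeq d) (tendsto_bumpSeq_rOut (d := d))
    (Eventually.of_forall fun n => by simp only [bumpSeq]; linarith)
    (locallyIntegrable_indicator hΩ hu)
  rw [ae_restrict_iff' hΩ]
  filter_upwards [h] with x hx hxΩ
  rw [Set.indicator_of_mem hxΩ] at hx
  exact hx

theorem tendsto_moll_of_continuousOn (hΩ : IsOpen Ω) (hu : MemLp u 2 (volume.restrict Ω))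
    (hc : ContinuousOn u Ω) {x : Sp d} (hx : x ∈ Ω) :
    Tendsto (fun n => moll Ω (bumpSeq d n) u x) atTop (𝓝 (u x)) := by
  refine ContDiffBump.convolution_tendsto_right (g := fun _ => Ω.indicator u) (k := fun _ => x)
    (tendsto_bumpSeq_rOut (d := d))
    (Eventually.of_forall fun _ => (memLp_indicator_of_restrict hΩ.measurableSet hu).1) ?_
    tendsto_const_nhds
  have h1 : Tendsto (Ω.indicator u) (𝓝 x) (𝓝 (u x)) := by
    refine (hc.continuousAt (hΩ.mem_nhds hx)).tendsto.congr' ?_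
    filter_upwards [hΩ.mem_nhds hx] with y hy
    rw [Set.indicator_of_mem hy]
  exact h1.comp tendsto_snd

theorem setLIntegral_indicator_sq_le {F : Type*} [NormedAddCommGroup F] {U : Set (Sp d)}
    (f : Sp d → F) :
    ∫⁻ y in U, ‖Ω.indicator f y‖ₑ ^ 2 ≤ ∫⁻ y in U, ‖f y‖ₑ ^ 2 := by
  refine lintegral_mono fun y => ?_
  by_cases hy : y ∈ Ω <;> simp [hy]

theorem eventually_cthickening_subset {K U : Set (Sp d)} (hK : IsCompact K) (hU : IsOpen U)
    (hKU : K ⊆ U) : ∀ᶠ n in atTop, Metric.cthickening (bumpSeq d n).rOut K ⊆ U := by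
  obtain ⟨δ, hδ, hsub⟩ := hK.exists_cthickening_subset_open hU hKU
  filter_upwards [(tendsto_bumpSeq_rOut (d := d)).eventually_le_const hδ] with n hn
  exact (Metric.cthickening_mono hn K).trans hsub

/-- On compact subsets, the derivatives of the mollifications are eventually bounded in `L²` by the
weak gradient. -/
theorem eventually_setLIntegral_fderiv_moll_le (hΩ : IsOpen Ω)
    (hu : MemLp u 2 (volume.restrict Ω)) (hgL : MemLp g 2 (volume.restrict Ω))
    (hg : IsWeakGradient Ω u g) {K U : Set (Sp d)} (hK : IsCompact K) (hU : IsOpen U)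
    (hKU : K ⊆ U) (hUΩ : U ⊆ Ω) :
    ∀ᶠ n in atTop, ∫⁻ x in K, ‖fderiv ℝ (moll Ω (bumpSeq d n) u) x‖ₑ ^ 2 ≤
      ∫⁻ x in U, ‖g x‖ₑ ^ 2 := by
  filter_upwards [eventually_cthickening_subset hK hU hKU] with n hn
  calc ∫⁻ x in K, ‖fderiv ℝ (moll Ω (bumpSeq d n) u) x‖ₑ ^ 2
      ≤ ∫⁻ x in K, (∫⁻ y, bumpWeight (bumpSeq d n) x y * ‖Ω.indicator g y‖ₑ) ^ 2 := by
        refine setLIntegral_mono' hK.measurableSet fun x hx => ?_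
        gcongr
        refine enorm_fderiv_moll_le hΩ _ hu hgL hg ?_
        intro y hy
        exact hUΩ (hn (Metric.mem_cthickening_of_dist_le y x _ _ hx hy))
    _ ≤ ∫⁻ y in U, ‖Ω.indicator g y‖ₑ ^ 2 :=
        setLIntegral_sq_bump_le _
          (memLp_indicator_of_restrict hΩ.measurableSet hgL).1.enorm hU.measurableSet hn
    _ ≤ _ := setLIntegral_indicator_sq_le _

theorem eventually_setLIntegral_moll_le (hΩ : MeasurableSet Ω)
    (hu : MemLp u 2 (volume.restrict Ω)) {K U : Set (Sp d)} (hK : IsCompact K) (hU : IsOpen U)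
    (hKU : K ⊆ U) :
    ∀ᶠ n in atTop, ∫⁻ x in K, ‖moll Ω (bumpSeq d n) u x‖ₑ ^ 2 ≤ ∫⁻ x in U, ‖u x‖ₑ ^ 2 := by
  filter_upwards [eventually_cthickening_subset hK hU hKU] with n hn
  calc ∫⁻ x in K, ‖moll Ω (bumpSeq d n) u x‖ₑ ^ 2
      ≤ ∫⁻ x in K, (∫⁻ y, bumpWeight (bumpSeq d n) x y * ‖Ω.indicator u y‖ₑ) ^ 2 := by
        refine lintegral_mono fun x => ?_
        gcongr
        exact enorm_moll_le _ _
    _ ≤ ∫⁻ y in U, ‖Ω.indicator u y‖ₑ ^ 2 :=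
        setLIntegral_sq_bump_le _
          (memLp_indicator_of_restrict hΩ hu).1.enorm hU.measurableSet hn
    _ ≤ _ := setLIntegral_indicator_sq_le _

end

/-! ### Poincaré's inequality on convex sets -/

theorem hasDerivAt_segment {v : Sp d → ℝ} (hv : ContDiff ℝ 1 v) (p w : Sp d) (r : ℝ) :
    HasDerivAt (fun r : ℝ => v (p + r • w)) (fderiv ℝ v (p + r • w) w) r := by
  have h1 : HasDerivAt (fun r : ℝ => p + r • w) w r := by
    simpa using ((hasDerivAt_id r).smul_const w).const_add p
  exact ((hv.differentiable one_ne_zero).differentiableAt.hasFDerivAt).comp_hasDerivAt r h1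

/-- The fundamental theorem of calculus along a segment, with the Cauchy–Schwarz inequality on a
parameter interval of length at most one. -/
theorem enorm_sq_sub_le_segment {v : Sp d → ℝ} (hv : ContDiff ℝ 1 v) (p w : Sp d) {s t : ℝ}
    (hst : s ≤ t) (hts : t ≤ s + 1) :
    ‖v (p + t • w) - v (p + s • w)‖ₑ ^ 2 ≤
      ‖w‖ₑ ^ 2 * ∫⁻ r in Set.Icc s t, ‖fderiv ℝ v (p + r • w)‖ₑ ^ 2 := by
  have hc : Continuous (fun r : ℝ => fderiv ℝ v (p + r • w)) :=
    (hv.continuous_fderiv one_ne_zero).comp (by fun_prop)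
  have hc' : Continuous (fun r : ℝ => fderiv ℝ v (p + r • w) w) := hc.clm_apply continuous_const
  have h0 := intervalIntegral.integral_eq_sub_of_hasDerivAt
    (fun r _ => hasDerivAt_segment hv p w r) (hc'.intervalIntegrable s t)
  have hm : Measurable (fun r : ℝ => ‖fderiv ℝ v (p + r • w)‖ₑ) := hc.enorm.measurable
  have h1 : ‖v (p + t • w) - v (p + s • w)‖ₑ ≤
      ∫⁻ r in Set.Icc s t, ‖fderiv ℝ v (p + r • w)‖ₑ * ‖w‖ₑ := by
    rw [← h0, intervalIntegral.integral_of_le hst]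
    refine (enorm_integral_le_lintegral_enorm _).trans ?_
    refine (lintegral_mono_set Set.Ioc_subset_Icc_self).trans (lintegral_mono fun r => ?_)
    exact ContinuousLinearMap.le_opENorm _ _
  calc ‖v (p + t • w) - v (p + s • w)‖ₑ ^ 2
      ≤ (∫⁻ r in Set.Icc s t, ‖fderiv ℝ v (p + r • w)‖ₑ * ‖w‖ₑ) ^ 2 := by gcongr
    _ ≤ (volume.restrict (Set.Icc s t)) Set.univ *
        ∫⁻ r in Set.Icc s t, (‖fderiv ℝ v (p + r • w)‖ₑ * ‖w‖ₑ) ^ 2 :=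
        sq_lintegral_le _ (hm.mul_const _).aemeasurable
    _ ≤ 1 * ∫⁻ r in Set.Icc s t, (‖fderiv ℝ v (p + r • w)‖ₑ * ‖w‖ₑ) ^ 2 := by
        gcongr
        rw [Measure.restrict_apply_univ, Real.volume_Icc]
        exact ENNReal.ofReal_le_one.2 (by linarith)
    _ = _ := by
        simp_rw [mul_pow]
        rw [one_mul, lintegral_mul_const _ (hm.pow_const 2), mul_comm]

/-- Change of variables for a dilation by a factor that is not small. -/
theorem lintegral_comp_add_smul_le {G : Sp d → ℝ≥0∞} (hG : Measurable G) (p : Sp d) {t : ℝ}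
    (ht : 1 / 2 ≤ t) : ∫⁻ y, G (p + t • y) ≤ 2 ^ d * ∫⁻ y, G y := by
  have ht0 : 0 < t := by linarith
  have h1 : ∫⁻ y, G (p + t • y) = ∫⁻ z, G (p + z) ∂(Measure.map (t • ·) volume) := by
    exact (lintegral_map (hG.comp (measurable_const_add p)) (measurable_const_smul t)).symm
  rw [h1, Measure.map_addHaar_smul _ ht0.ne', lintegral_smul_measure,
    lintegral_add_left_eq_self G p, finrank_euclideanSpace_fin, smul_eq_mul]
  gcongr
  rw [abs_of_pos (by positivity), ← ENNReal.ofReal_ofNat 2, ← ENNReal.ofReal_pow (by norm_num)]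
  apply ENNReal.ofReal_le_ofReal
  rw [← inv_pow]
  gcongr
  rw [inv_le_comm₀ ht0 (by norm_num)]
  linarith

/-- Poincaré's inequality for continuously differentiable functions on a convex set, in the form of
a double integral. The constant depends on the set through its volume and diameter only.

The difference `v y - v x` is the integral of the derivative along the segment from `x` to `y`; at
the parameter `t` the point `x + t (y - x)` is a dilation of `y` by `t` and of `x` by `1 - t`, and
one of the two factors is at least `1 / 2`. -/
theorem poincare_convex_of_contDiff {v : Sp d → ℝ} (hv : ContDiff ℝ 1 v) {K : Set (Sp d)}
    (hK : Convex ℝ K) (hKm : MeasurableSet K) {D : ℝ}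
    (hD : ∀ x ∈ K, ∀ y ∈ K, ‖y - x‖ ^ 2 ≤ D) :
    ∫⁻ p in K ×ˢ K, ‖v p.2 - v p.1‖ₑ ^ 2 ∂(volume.prod volume) ≤
      ENNReal.ofReal D * 2 ^ d * volume K * ∫⁻ x in K, ‖fderiv ℝ v x‖ₑ ^ 2 := by
  set G : Sp d → ℝ≥0∞ := K.indicator fun x => ‖fderiv ℝ v x‖ₑ ^ 2 with hG
  have hGm : Measurable G :=
    ((hv.continuous_fderiv one_ne_zero).enorm.measurable.pow_const 2).indicator hKm
  have hGi : ∫⁻ x, G x = ∫⁻ x in K, ‖fderiv ℝ v x‖ₑ ^ 2 := lintegral_indicator hKm _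
  have hpt : ∀ x ∈ K, ∀ y ∈ K, ‖v y - v x‖ₑ ^ 2 ≤
      ENNReal.ofReal D * ∫⁻ t in Set.Icc (0 : ℝ) 1, G (x + t • (y - x)) := by
    intro x hx y hy
    have h := enorm_sq_sub_le_segment hv x (y - x) zero_le_one (by norm_num)
    simp only [one_smul, add_sub_cancel, zero_smul, add_zero] at h
    refine h.trans ?_
    gcongr ?_ * ?_
    · rw [← ofReal_norm, ← ENNReal.ofReal_pow (norm_nonneg _)]
      exact ENNReal.ofReal_le_ofReal (hD x hx y hy)
    · refine setLIntegral_mono' measurableSet_Icc fun t ht => ?_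
      have : x + t • (y - x) ∈ K := hK.add_smul_sub_mem hx hy ht
      simp [hG, this]
  have hvc := hv.continuous
  have hm3 : Measurable fun q : (Sp d × Sp d) × ℝ => G (q.1.1 + q.2 • (q.1.2 - q.1.1)) :=
    hGm.comp (by fun_prop)
  have hm3t : ∀ t : ℝ, Measurable (Function.uncurry fun x y : Sp d => G (x + t • (y - x))) :=
    fun t => hGm.comp (g := G) (f := fun q : Sp d × Sp d => q.1 + t • (q.2 - q.1)) (by fun_prop)
  have hT : ∀ t ∈ Set.Icc (0 : ℝ) 1, ∫⁻ x in K, ∫⁻ y in K, G (x + t • (y - x)) ≤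
      2 ^ d * volume K * ∫⁻ x, G x := by
    have key : ∀ t : ℝ, 1 / 2 ≤ t → ∫⁻ x in K, ∫⁻ y in K, G (x + t • (y - x)) ≤
        2 ^ d * volume K * ∫⁻ x, G x := by
      intro t ht
      calc ∫⁻ x in K, ∫⁻ y in K, G (x + t • (y - x))
          ≤ ∫⁻ x in K, 2 ^ d * ∫⁻ y, G y := by
            refine lintegral_mono fun x => ?_
            refine (setLIntegral_le_lintegral _ _).trans ?_
            have e : ∀ y, x + t • (y - x) = (x - t • x) + t • y := fun y => by module
            simp_rw [e]
            exact lintegral_comp_add_smul_le hGm (x - t • x) ht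
        _ = 2 ^ d * volume K * ∫⁻ x, G x := by
            rw [setLIntegral_const]; ring
    intro t ht
    rcases le_total (1 / 2) t with h | h
    · exact key t h
    · -- exchange the roles of the two end points
      rw [lintegral_lintegral_swap (f := fun x y => G (x + t • (y - x)))
        (hm3t t).aemeasurable]
      have e : ∀ y x : Sp d, x + t • (y - x) = y + (1 - t) • (x - y) := fun y x => by module
      simp_rw [e]
      exact key (1 - t) (by linarith)
  have hm2 : Measurable fun q : Sp d × Sp d =>
      ∫⁻ t in Set.Icc (0 : ℝ) 1, G (q.1 + t • (q.2 - q.1)) := hm3.lintegral_prod_right'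
  calc ∫⁻ p in K ×ˢ K, ‖v p.2 - v p.1‖ₑ ^ 2 ∂(volume.prod volume)
      ≤ ∫⁻ p in K ×ˢ K, ENNReal.ofReal D *
          (∫⁻ t in Set.Icc (0 : ℝ) 1, G (p.1 + t • (p.2 - p.1))) ∂(volume.prod volume) :=
        setLIntegral_mono' (hKm.prod hKm) fun p hp => hpt _ hp.1 _ hp.2
    _ = ENNReal.ofReal D * ∫⁻ p in K ×ˢ K,
          (∫⁻ t in Set.Icc (0 : ℝ) 1, G (p.1 + t • (p.2 - p.1))) ∂(volume.prod volume) :=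
        lintegral_const_mul _ hm2
    _ = ENNReal.ofReal D * ∫⁻ t in Set.Icc (0 : ℝ) 1, ∫⁻ p in K ×ˢ K,
          G (p.1 + t • (p.2 - p.1)) ∂(volume.prod volume) := by
        rw [lintegral_lintegral_swap hm3.aemeasurable]
    _ ≤ ENNReal.ofReal D * ∫⁻ t in Set.Icc (0 : ℝ) 1, 2 ^ d * volume K * ∫⁻ x, G x := by
        gcongr 1
        refine setLIntegral_mono' measurableSet_Icc fun t ht => ?_
        rw [← Measure.prod_restrict]
        exact (lintegral_prod _ (hm3t t).aemeasurable).trans_le (hT t ht)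
    _ = _ := by
        rw [setLIntegral_const, Real.volume_Icc, hGi]
        simp
        ring

section

variable {Ω : Set (Sp d)} {u : Sp d → ℝ} {g : Sp d → Sp d}

/-- Poincaré's inequality for functions with a weak gradient on a compact convex set `K'` inside of
an open set `K`, by mollification and Fatou's lemma. -/
theorem poincare_convex_compact (hΩ : IsOpen Ω)
    (hu : MemLp u 2 (volume.restrict Ω)) (hgL : MemLp g 2 (volume.restrict Ω))
    (hg : IsWeakGradient Ω u g) {K K' : Set (Sp d)}
    (hK' : Convex ℝ K') (hK'c : IsCompact K') (hKo : IsOpen K) (hK'K : K' ⊆ K) (hKΩ : K ⊆ Ω)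
    {D : ℝ} (hD : ∀ x ∈ K', ∀ y ∈ K', ‖y - x‖ ^ 2 ≤ D) :
    ∫⁻ p in K' ×ˢ K', ‖u p.2 - u p.1‖ₑ ^ 2 ∂(volume.prod volume) ≤
      ENNReal.ofReal D * 2 ^ d * volume K * ∫⁻ x in K, ‖g x‖ₑ ^ 2 := by
  set v : ℕ → Sp d → ℝ := fun n => moll Ω (bumpSeq d n) u with hv
  have hvc : ∀ n, ContDiff ℝ 1 (v n) := fun n => contDiff_moll hΩ.measurableSet _ hu
  have hae : ∀ᵐ x ∂(volume.restrict K'), Tendsto (fun n => v n x) atTop (𝓝 (u x)) :=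
    ae_restrict_of_ae_restrict_of_subset (hK'K.trans hKΩ) (ae_tendsto_moll hΩ.measurableSet hu)
  have hae2 : ∀ᵐ p ∂((volume.restrict K').prod (volume.restrict K')),
      Tendsto (fun n => ‖v n p.2 - v n p.1‖ₑ ^ 2) atTop (𝓝 (‖u p.2 - u p.1‖ₑ ^ 2)) := by
    filter_upwards [Measure.quasiMeasurePreserving_fst.ae hae,
      Measure.quasiMeasurePreserving_snd.ae hae] with p h1 h2
    exact ENNReal.Tendsto.pow (h2.sub h1).enorm
  rw [← Measure.prod_restrict]
  calc ∫⁻ p, ‖u p.2 - u p.1‖ₑ ^ 2 ∂((volume.restrict K').prod (volume.restrict K'))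
      = ∫⁻ p, liminf (fun n => ‖v n p.2 - v n p.1‖ₑ ^ 2) atTop
          ∂((volume.restrict K').prod (volume.restrict K')) :=
        lintegral_congr_ae (hae2.mono fun p hp => hp.liminf_eq.symm)
    _ ≤ liminf (fun n => ∫⁻ p, ‖v n p.2 - v n p.1‖ₑ ^ 2
          ∂((volume.restrict K').prod (volume.restrict K'))) atTop := by
        refine lintegral_liminf_le fun n => ?_
        have := (hvc n).continuous
        exact (by fun_prop : Continuous fun p : Sp d × Sp d =>
          v n p.2 - v n p.1).enorm.measurable.pow_const 2
    _ ≤ _ := by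
        refine liminf_le_of_frequently_le' (Eventually.frequently ?_)
        filter_upwards [eventually_setLIntegral_fderiv_moll_le hΩ hu hgL hg hK'c hKo hK'K hKΩ]
          with n hn
        rw [Measure.prod_restrict]
        refine (poincare_convex_of_contDiff (hvc n) hK' hK'c.measurableSet hD).trans ?_
        gcongr

theorem closure_convexHull_subset_of_isCompact {K F : Set (Sp d)} (hK : Convex ℝ K)
    (hKo : IsOpen K) (hF : IsCompact F) (hFK : F ⊆ K) : closure (convexHull ℝ F) ⊆ K := by
  obtain ⟨δ, hδ, hsub⟩ := hF.exists_thickening_subset_open hKo hFK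
  refine (Metric.closure_subset_thickening hδ _).trans fun x hx => ?_
  obtain ⟨z, hz, hxz⟩ := Metric.mem_thickening_iff.1 hx
  have : convexHull ℝ F ⊆ (fun y => y + (x - z)) ⁻¹' K := by
    refine convexHull_min (fun y hy => hsub (Metric.mem_thickening_iff.2 ⟨y, hy, ?_⟩))
      (hK.translate_preimage_left _)
    simpa [dist_eq_norm] using hxz
  simpa using this hz

/-- Poincaré's inequality for functions with a weak gradient on a convex open set. -/
theorem poincare_convex_open (hΩ : IsOpen Ω)
    (hu : MemLp u 2 (volume.restrict Ω)) (hgL : MemLp g 2 (volume.restrict Ω))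
    (hg : IsWeakGradient Ω u g) {K : Set (Sp d)} (hK : Convex ℝ K) (hKo : IsOpen K)
    (hKb : Bornology.IsBounded K) (hKΩ : K ⊆ Ω)
    {D : ℝ} (hD : ∀ x ∈ K, ∀ y ∈ K, ‖y - x‖ ^ 2 ≤ D) :
    ∫⁻ p in K ×ˢ K, ‖u p.2 - u p.1‖ₑ ^ 2 ∂(volume.prod volume) ≤
      ENNReal.ofReal D * 2 ^ d * volume K * ∫⁻ x in K, ‖g x‖ₑ ^ 2 := by
  -- exhaust `K` by the compact convex sets `closure (convexHull ℝ (F n))`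
  obtain ⟨F, hFc, hFK, hFU, hFm⟩ := hKo.exists_iUnion_isClosed
  have hFcpt : ∀ n, IsCompact (F n) := fun n =>
    Metric.isCompact_of_isClosed_isBounded (hFc n) (hKb.subset (hFK n))
  have hsub : ∀ n, closure (convexHull ℝ (F n)) ⊆ K := fun n =>
    closure_convexHull_subset_of_isCompact hK hKo (hFcpt n) (hFK n)
  have hmono : Monotone fun n => closure (convexHull ℝ (F n)) :=
    fun m n h => closure_mono (convexHull_mono (hFm h))
  have hFs : ∀ n, F n ⊆ closure (convexHull ℝ (F n)) :=
    fun n => (subset_convexHull ℝ _).trans subset_closure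
  have hU : K ×ˢ K = ⋃ n, (closure (convexHull ℝ (F n))) ×ˢ (closure (convexHull ℝ (F n))) := by
    apply Set.Subset.antisymm
    · rintro ⟨x, y⟩ ⟨hx, hy⟩
      rw [← hFU] at hx hy
      obtain ⟨i, hi⟩ := Set.mem_iUnion.1 hx
      obtain ⟨j, hj⟩ := Set.mem_iUnion.1 hy
      exact Set.mem_iUnion.2 ⟨max i j, hmono (le_max_left i j) (hFs i hi),
        hmono (le_max_right i j) (hFs j hj)⟩
    · exact Set.iUnion_subset fun n => Set.prod_mono (hsub n) (hsub n)
  rw [hU, setLIntegral_iUnion_of_directed]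
  · refine iSup_le fun n => ?_
    exact poincare_convex_compact hΩ hu hgL hg (convex_convexHull ℝ _).closure
      (Metric.isCompact_of_isClosed_isBounded isClosed_closure (hKb.subset (hsub n)))
      hKo (hsub n) hKΩ fun x hx y hy => hD x (hsub n hx) y (hsub n hy)
  · exact (monotone_nat_of_le_succ fun n => Set.prod_mono (hmono n.le_succ)
      (hmono n.le_succ)).directed_le

theorem setLIntegral_prod_sub_sq {K : Set (Sp d)} (hKf : volume K ≠ ⊤)
    (hu : MemLp u 2 (volume.restrict K)) :
    ∫⁻ p in K ×ˢ K, ‖u p.2 - u p.1‖ₑ ^ 2 ∂(volume.prod volume) =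
      ENNReal.ofReal (2 * volume.real K * (∫ x in K, u x ^ 2) - 2 * (∫ x in K, u x) ^ 2) := by
  have : IsFiniteMeasure (volume.restrict K) := ⟨by simpa using hKf.lt_top⟩
  have hui : Integrable u (volume.restrict K) := hu.integrable (by norm_num)
  have hsq : Integrable (fun x => u x ^ 2) (volume.restrict K) := hu.integrable_sq
  have h1 : Integrable (fun _ : Sp d => (1 : ℝ)) (volume.restrict K) := integrable_const _
  have i1 := h1.mul_prod hsq
  have i2 := hui.mul_prod hui
  have i3 := hsq.mul_prod h1
  have i13 := i1.add i3
  simp only [Pi.add_def] at i13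
  rw [← Measure.prod_restrict]
  have hint : Integrable (fun p : Sp d × Sp d => (u p.2 - u p.1) ^ 2)
      ((volume.restrict K).prod (volume.restrict K)) := by
    refine (i13.sub (i2.const_mul 2)).congr (Eventually.of_forall fun p => ?_)
    simp only [Pi.sub_apply]; ring
  have hval : ∫ p, (u p.2 - u p.1) ^ 2 ∂((volume.restrict K).prod (volume.restrict K)) =
      2 * volume.real K * (∫ x in K, u x ^ 2) - 2 * (∫ x in K, u x) ^ 2 := by
    have e : (fun p : Sp d × Sp d => (u p.2 - u p.1) ^ 2) =
        fun p => (1 * u p.2 ^ 2 + u p.1 ^ 2 * 1) - 2 * (u p.1 * u p.2) := by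
      funext p; ring
    rw [e, integral_sub i13 (i2.const_mul 2), integral_add i1 i3,
      integral_prod_mul (fun _ => (1 : ℝ)) (fun y => u y ^ 2),
      integral_prod_mul (fun y => u y ^ 2) (fun _ => (1 : ℝ)), integral_const_mul,
      integral_prod_mul u u]
    simp only [integral_const, smul_eq_mul, mul_one, measureReal_restrict_apply_univ]
    ring
  rw [← hval, ofReal_integral_eq_lintegral_ofReal hint (Eventually.of_forall fun p => sq_nonneg _)]
  refine lintegral_congr fun p => ?_
  rw [← ofReal_norm, ← ENNReal.ofReal_pow (norm_nonneg _), Real.norm_eq_abs, sq_abs]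

/-- The squared `L²` norm on a convex set is controlled by the mean value and, with a factor of the
order of the squared diameter, by the weak gradient. -/
theorem setIntegral_sq_le_of_convex (hΩ : IsOpen Ω)
    (hu : MemLp u 2 (volume.restrict Ω)) (hgL : MemLp g 2 (volume.restrict Ω))
    (hg : IsWeakGradient Ω u g) {K : Set (Sp d)} (hK : Convex ℝ K)
    (hKb : Bornology.IsBounded K) (hKΩ : K ⊆ Ω)
    {D : ℝ} (hD0 : 0 ≤ D) (hD : ∀ x ∈ K, ∀ y ∈ K, ‖y - x‖ ^ 2 ≤ D) :
    ∫ x in K, u x ^ 2 ≤ (volume.real K)⁻¹ * (∫ x in K, u x) ^ 2 +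
      D * 2 ^ d * ∫ x in K, ‖g x‖ ^ 2 := by
  -- the boundary of a convex set is a null set, so that `K` may be replaced by its interior
  have hae : (interior K : Set (Sp d)) =ᵐ[volume] K := interior_ae_eq_of_null_frontier
    (hK.addHaar_frontier volume)
  have hKf : volume K ≠ ⊤ := hKb.measure_lt_top.ne
  set Ki := interior K with hKi
  have hKiΩ : Ki ⊆ Ω := interior_subset.trans hKΩ
  rw [← setIntegral_congr_set hae, ← setIntegral_congr_set hae, ← setIntegral_congr_set hae,
    ← measureReal_congr hae]
  have hKif : volume Ki ≠ ⊤ := (measure_mono interior_subset).trans_lt hKf.lt_top |>.ne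
  have huK : MemLp u 2 (volume.restrict Ki) := hu.mono_measure (Measure.restrict_mono_set _ hKiΩ)
  have hgK : MemLp g 2 (volume.restrict Ki) := hgL.mono_measure (Measure.restrict_mono_set _ hKiΩ)
  have hP := poincare_convex_open hΩ hu hgL hg hK.interior isOpen_interior
    (hKb.subset interior_subset) hKiΩ
    fun x hx y hy => hD x (interior_subset hx) y (interior_subset hy)
  rw [setLIntegral_prod_sub_sq hKif huK] at hP
  have hg2 : ∫⁻ x in Ki, ‖g x‖ₑ ^ 2 = ENNReal.ofReal (∫ x in Ki, ‖g x‖ ^ 2) := by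
    rw [ofReal_integral_eq_lintegral_ofReal hgK.norm.integrable_sq
      (Eventually.of_forall fun x => sq_nonneg _)]
    refine lintegral_congr fun x => ?_
    rw [ENNReal.ofReal_pow (norm_nonneg _), ofReal_norm]
  have hgnn : 0 ≤ ∫ x in Ki, ‖g x‖ ^ 2 := integral_nonneg fun x => sq_nonneg _
  have h2d : (2 : ENNReal) ^ d = ENNReal.ofReal (2 ^ d) := by
    rw [ENNReal.ofReal_pow (by norm_num), ENNReal.ofReal_ofNat]
  rw [hg2, ← ENNReal.ofReal_toReal hKif, h2d, ← ENNReal.ofReal_mul hD0,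
    ← ENNReal.ofReal_mul (by positivity), ← ENNReal.ofReal_mul (by positivity),
    ENNReal.ofReal_le_ofReal_iff (by positivity)] at hP
  change 2 * volume.real Ki * _ - _ ≤ D * 2 ^ d * volume.real Ki * _ at hP
  rcases (measureReal_nonneg (μ := volume) (s := Ki)).eq_or_lt with h0 | h0
  · have hz : volume Ki = 0 := by
      rwa [eq_comm, measureReal_eq_zero_iff hKif] at h0
    rw [Measure.restrict_zero_set hz]
    simp
  · set V := volume.real Ki
    set A := ∫ x in Ki, u x ^ 2
    set B := ∫ x in Ki, u x
    set C := ∫ x in Ki, ‖g x‖ ^ 2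
    have hC : 0 ≤ D * 2 ^ d * C := by positivity
    have h2 : V * A ≤ B ^ 2 + V * (D * 2 ^ d * C) := by nlinarith
    calc A = V⁻¹ * (V * A) := by field_simp
      _ ≤ V⁻¹ * (B ^ 2 + V * (D * 2 ^ d * C)) := by gcongr
      _ = _ := by field_simp

end

/-! ### The space `H¹(Ω)` -/

section

variable {Ω : Set (Sp d)}

/-- `u ↦ u` as a bounded operator `H¹(Ω) → L²(Ω)`. -/
noncomputable def fnL (Ω : Set (Sp d)) : H1 Ω →L[ℝ] L2 Ω :=
  (WithLp.fstL 2 ℝ (L2 Ω) (L2vec Ω)).comp (H1 Ω).subtypeL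

/-- `u ↦ ∇u` as a bounded operator `H¹(Ω) → L²(Ω)^d`. -/
noncomputable def gradL (Ω : Set (Sp d)) : H1 Ω →L[ℝ] L2vec Ω :=
  (WithLp.sndL 2 ℝ (L2 Ω) (L2vec Ω)).comp (H1 Ω).subtypeL

@[simp] theorem fnL_apply (u : H1 Ω) : fnL Ω u = fn u := rfl

theorem fn_add (u v : H1 Ω) : fn (u + v) = fn u + fn v := map_add (fnL Ω) u v
theorem fn_sub (u v : H1 Ω) : fn (u - v) = fn u - fn v := map_sub (fnL Ω) u v
theorem fn_smul (c : ℝ) (u : H1 Ω) : fn (c • u) = c • fn u := map_smul (fnL Ω) c u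
theorem grad_add (u v : H1 Ω) : grad (u + v) = grad u + grad v := map_add (gradL Ω) u v
theorem grad_sub (u v : H1 Ω) : grad (u - v) = grad u - grad v := map_sub (gradL Ω) u v
theorem grad_smul (c : ℝ) (u : H1 Ω) : grad (c • u) = c • grad u := map_smul (gradL Ω) c u

theorem norm_sq_H1 (u : H1 Ω) : ‖u‖ ^ 2 = ‖fn u‖ ^ 2 + ‖grad u‖ ^ 2 :=
  WithLp.prod_norm_sq_eq_of_L2 (u : WithLp 2 (L2 Ω × L2vec Ω))

theorem norm_grad_le (u : H1 Ω) : ‖grad u‖ ≤ ‖u‖ := by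
  have := norm_sq_H1 u
  exact abs_le_of_sq_le_sq' (by nlinarith [sq_nonneg ‖fn u‖]) (norm_nonneg _) |>.2

theorem isWeakGradient_H1 (u : H1 Ω) : IsWeakGradient Ω (fn u) (grad u) := u.2

theorem norm_sq_Lp_two {F : Type*} [NormedAddCommGroup F] {α : Type*}
    [MeasurableSpace α] {μ : Measure α} (f : Lp F 2 μ) : ‖f‖ ^ 2 = ∫ x, ‖f x‖ ^ 2 ∂μ := by
  have h := (Lp.memLp f).eLpNorm_eq_integral_rpow_norm (by norm_num) (by norm_num)
  rw [Lp.norm_def, h, ENNReal.toReal_ofReal (by positivity)]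
  simp only [ENNReal.toReal_ofNat, Real.rpow_two]
  rw [← one_div, ← Real.sqrt_eq_rpow, Real.sq_sqrt (integral_nonneg fun x => sq_nonneg _)]

end

/-! ### Decomposition of a polyhedral domain into small convex cells -/

section

variable {Ω : Set (Sp d)} {𝒯 : Mesh d}

theorem interior_convexHull_subset (hreg : interior (closure Ω) = Ω)
    (h𝒯 : IsTriangulation (closure Ω) 𝒯) {T : Finset (Sp d)} (hT : T ∈ 𝒯) :
    interior (convexHull ℝ (T : Set (Sp d))) ⊆ Ω := by
  have h : convexHull ℝ (T : Set (Sp d)) ⊆ closure Ω := by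
    rw [← h𝒯.2.2]
    exact Set.subset_biUnion_of_mem (u := fun T : Finset (Sp d) => convexHull ℝ (T : Set (Sp d))) hT
  exact (interior_mono h).trans hreg.le

/-- A half-open cube of the grid with mesh width `δ`. -/
def gridCube (δ : ℝ) (j : Fin d → ℤ) : Set (Sp d) := {x | ∀ i, ⌊x i / δ⌋ = j i}

theorem measurableSet_gridCube (δ : ℝ) (j : Fin d → ℤ) :
    MeasurableSet (gridCube δ j : Set (Sp d)) := by
  have : (gridCube δ j : Set (Sp d)) = ⋂ i, {x | ⌊x i / δ⌋ = j i} := by ext; simp [gridCube]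
  rw [this]
  refine MeasurableSet.iInter fun i => ?_
  have hm : Measurable fun x : Sp d => ⌊x i / δ⌋ :=
    Int.measurable_floor.comp ((by fun_prop : Continuous fun x : Sp d => x i / δ).measurable)
  exact hm (measurableSet_singleton _)

theorem convex_gridCube (δ : ℝ) (j : Fin d → ℤ) : Convex ℝ (gridCube δ j : Set (Sp d)) := by
  have : (gridCube δ j : Set (Sp d)) =
      ⋂ i, (fun x : Sp d => x i / δ) ⁻¹' Set.Ico (j i : ℝ) (j i + 1) := by
    ext; simp [gridCube, Int.floor_eq_iff]
  rw [this]
  refine convex_iInter fun i => ?_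
  refine (convex_Ico _ _).is_linear_preimage ⟨fun x y => ?_, fun c x => ?_⟩
  · simp [add_div]
  · simp [mul_div_assoc]

theorem norm_sub_sq_le_of_gridCube {δ : ℝ} (hδ : 0 < δ) {j : Fin d → ℤ} {x y : Sp d}
    (hx : x ∈ gridCube δ j) (hy : y ∈ gridCube δ j) : ‖y - x‖ ^ 2 ≤ d * δ ^ 2 := by
  rw [EuclideanSpace.norm_sq_eq]
  calc ∑ i, ‖(y - x) i‖ ^ 2 ≤ ∑ _i : Fin d, δ ^ 2 := by
        refine Finset.sum_le_sum fun i _ => ?_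
        have h1 := Int.floor_eq_iff.1 (hx i)
        have h2 := Int.floor_eq_iff.1 (hy i)
        rw [le_div_iff₀ hδ, div_lt_iff₀ hδ] at h1 h2
        rw [PiLp.sub_apply, Real.norm_eq_abs]
        have : |y i - x i| ≤ δ := by rw [abs_le]; constructor <;> nlinarith
        gcongr
    _ = d * δ ^ 2 := by simp

theorem exists_finset_gridCube (hb : Bornology.IsBounded Ω) {δ : ℝ} (hδ : 0 < δ) :
    ∃ J : Finset (Fin d → ℤ), Ω ⊆ ⋃ j ∈ J, gridCube δ j := by
  obtain ⟨R, hR⟩ := hb.exists_norm_le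
  refine ⟨Fintype.piFinset fun _ => Finset.Icc ⌊-R / δ⌋ ⌊R / δ⌋, fun x hx => ?_⟩
  refine Set.mem_biUnion (x := fun i => ⌊x i / δ⌋) ?_ (fun i => rfl)
  simp only [Finset.mem_coe, Fintype.mem_piFinset, Finset.mem_Icc]
  intro i
  have : |x i| ≤ R := (PiLp.norm_apply_le x i).trans (hR x hx)
  rw [abs_le] at this
  exact ⟨Int.floor_le_floor (by gcongr; exact this.1), Int.floor_le_floor (by gcongr; exact this.2)⟩

theorem volume_diff_iUnion_interior (h𝒯 : IsTriangulation (closure Ω) 𝒯) :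
    volume (Ω \ ⋃ T : 𝒯, interior (convexHull ℝ ((T : Finset (Sp d)) : Set (Sp d)))) = 0 := by
  refine measure_mono_null
    (t := ⋃ T : 𝒯, frontier (convexHull ℝ ((T : Finset (Sp d)) : Set (Sp d))))
    (fun x hx => ?_) (measure_iUnion_null fun T => (convex_convexHull ℝ _).addHaar_frontier volume)
  have hx1 : x ∈ closure Ω := subset_closure hx.1
  rw [← h𝒯.2.2] at hx1
  obtain ⟨T, hT, hxT⟩ := Set.mem_iUnion₂.1 hx1
  refine Set.mem_iUnion.2 ⟨⟨T, hT⟩, subset_closure hxT,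
    fun hi => hx.2 (Set.mem_iUnion.2 ⟨⟨T, hT⟩, hi⟩)⟩

theorem setIntegral_le_sum_interior (h𝒯 : IsTriangulation (closure Ω) 𝒯)
    (hreg : interior (closure Ω) = Ω) {f : Sp d → ℝ} (hf0 : ∀ x, 0 ≤ f x)
    (hf : Integrable f (volume.restrict Ω)) :
    ∫ x in Ω, f x ≤
      ∑ T : 𝒯, ∫ x in interior (convexHull ℝ ((T : Finset (Sp d)) : Set (Sp d))), f x := by
  have hsub : ∀ T : 𝒯, interior (convexHull ℝ ((T : Finset (Sp d)) : Set (Sp d))) ⊆ Ω :=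
    fun T => interior_convexHull_subset hreg h𝒯 T.2
  have hi : ∀ T : 𝒯, Integrable f
      (volume.restrict (interior (convexHull ℝ ((T : Finset (Sp d)) : Set (Sp d))))) :=
    fun T => hf.mono_measure (Measure.restrict_mono_set _ (hsub T))
  have hle : volume.restrict Ω ≤ ∑ T : 𝒯,
      volume.restrict (interior (convexHull ℝ ((T : Finset (Sp d)) : Set (Sp d)))) := by
    rw [← Measure.sum_fintype]
    refine le_trans ?_ Measure.restrict_iUnion_le
    refine Measure.restrict_mono_ae ?_
    rw [ae_le_set]
    exact volume_diff_iUnion_interior h𝒯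
  calc ∫ x in Ω, f x ≤ ∫ x, f x ∂(∑ T : 𝒯,
      volume.restrict (interior (convexHull ℝ ((T : Finset (Sp d)) : Set (Sp d))))) :=
        integral_mono_measure hle (Eventually.of_forall hf0)
          (integrable_finsetSum_measure.2 fun T _ => hi T)
    _ = _ := integral_finsetSum_measure fun T _ => hi T

/-- Up to an arbitrarily small multiple of the gradient, the `L²` norm of an `H¹` function on a
polyhedral domain is controlled by finitely many mean values. This makes the embedding of `H¹` into
`L²` compact. -/
theorem exists_norm_fn_sq_le (hΩ : IsOpen Ω) (hb : Bornology.IsBounded Ω)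
    (hreg : interior (closure Ω) = Ω) (h𝒯 : IsTriangulation (closure Ω) 𝒯) {η : ℝ} (hη : 0 < η) :
    ∃ (ι : Type) (_ : Fintype ι) (K : ι → Set (Sp d)) (c : ι → ℝ),
      (∀ i, MeasurableSet (K i) ∧ K i ⊆ Ω) ∧
      ∀ u : H1 Ω, ‖fn u‖ ^ 2 ≤ ∑ i, c i * (∫ x in K i, fn u x) ^ 2 + η * ‖grad u‖ ^ 2 := by
  set N : ℝ := (𝒯.card : ℝ) with hN
  set C : ℝ := N * (d * 2 ^ d) with hC
  have hC0 : 0 ≤ C := by positivity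
  obtain ⟨δ, hδ, hδC⟩ : ∃ δ : ℝ, 0 < δ ∧ C * δ ^ 2 ≤ η := by
    refine ⟨Real.sqrt (η / (C + 1)), Real.sqrt_pos.2 (by positivity), ?_⟩
    rw [Real.sq_sqrt (by positivity), mul_div_assoc', div_le_iff₀ (by positivity)]
    nlinarith
  -- cut every simplex with a grid of mesh width `δ`; the pieces are convex and small
  obtain ⟨J, hJ⟩ := exists_finset_gridCube hb hδ
  set S : 𝒯 → Set (Sp d) := fun T => interior (convexHull ℝ ((T : Finset (Sp d)) : Set (Sp d)))
    with hS
  set K : 𝒯 × J → Set (Sp d) := fun p => S p.1 ∩ gridCube δ (p.2 : Fin d → ℤ) with hK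
  have hSsub : ∀ T, S T ⊆ Ω := fun T => interior_convexHull_subset hreg h𝒯 T.2
  have hSm : ∀ T, MeasurableSet (S T) := fun T => isOpen_interior.measurableSet
  have hKm : ∀ p, MeasurableSet (K p) := fun p => (hSm _).inter (measurableSet_gridCube _ _)
  have hKsub : ∀ p, K p ⊆ Ω := fun p => Set.inter_subset_left.trans (hSsub _)
  refine ⟨𝒯 × J, inferInstance, K, fun p => (volume.real (K p))⁻¹, fun p => ⟨hKm p, hKsub p⟩,
    fun u => ?_⟩
  have hsum : ∀ (f : Sp d → ℝ), Integrable f (volume.restrict Ω) → ∀ T,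
      ∫ x in S T, f x = ∑ j : J, ∫ x in K (T, j), f x := by
    intro f hf T
    rw [← integral_iUnion_fintype (fun j => hKm (T, j))]
    · congr 2
      refine Set.Subset.antisymm (fun x hx => ?_) (Set.iUnion_subset fun j => Set.inter_subset_left)
      obtain ⟨j, hj, hxj⟩ := Set.mem_iUnion₂.1 (hJ (hSsub T hx))
      exact Set.mem_iUnion.2 ⟨⟨j, hj⟩, hx, hxj⟩
    · intro i j hij
      rw [Function.onFun, Set.disjoint_left]
      intro x hxi hxj
      refine hij (Subtype.ext (funext fun k => ?_))
      rw [← hxi.2 k, ← hxj.2 k]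
    · exact fun j => hf.mono_measure (Measure.restrict_mono_set _ (hKsub _))
  have hu := Lp.memLp (fn u)
  have hg := Lp.memLp (grad u)
  have hu2 : Integrable (fun x => fn u x ^ 2) (volume.restrict Ω) := hu.integrable_sq
  have hg2 : Integrable (fun x => ‖grad u x‖ ^ 2) (volume.restrict Ω) := hg.norm.integrable_sq
  have hcell : ∀ p, ∫ x in K p, fn u x ^ 2 ≤ (volume.real (K p))⁻¹ * (∫ x in K p, fn u x) ^ 2 +
      (d * δ ^ 2) * 2 ^ d * ∫ x in K p, ‖grad u x‖ ^ 2 := fun p =>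
    setIntegral_sq_le_of_convex hΩ hu hg (isWeakGradient_H1 u)
      ((convex_convexHull ℝ _).interior.inter (convex_gridCube _ _)) (hb.subset (hKsub p))
      (hKsub p) (by positivity) fun x hx y hy => norm_sub_sq_le_of_gridCube hδ hx.2 hy.2
  have hn1 : ‖fn u‖ ^ 2 = ∫ x in Ω, fn u x ^ 2 := by
    rw [norm_sq_Lp_two]
    simp
  rw [hn1, norm_sq_Lp_two (grad u)]
  set G := ∫ x in Ω, ‖grad u x‖ ^ 2 with hG
  have hG0 : 0 ≤ G := integral_nonneg fun x => sq_nonneg _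
  calc ∫ x in Ω, fn u x ^ 2 ≤ ∑ T, ∫ x in S T, fn u x ^ 2 :=
        setIntegral_le_sum_interior h𝒯 hreg (fun x => sq_nonneg _) hu2
    _ = ∑ T, ∑ j : J, ∫ x in K (T, j), fn u x ^ 2 := Finset.sum_congr rfl fun T _ => hsum _ hu2 T
    _ ≤ ∑ T, ∑ j : J, ((volume.real (K (T, j)))⁻¹ * (∫ x in K (T, j), fn u x) ^ 2 +
          (d * δ ^ 2) * 2 ^ d * ∫ x in K (T, j), ‖grad u x‖ ^ 2) :=
        Finset.sum_le_sum fun T _ => Finset.sum_le_sum fun j _ => hcell (T, j)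
    _ = ∑ p, (volume.real (K p))⁻¹ * (∫ x in K p, fn u x) ^ 2 +
          (d * δ ^ 2) * 2 ^ d * ∑ T, ∫ x in S T, ‖grad u x‖ ^ 2 := by
        simp_rw [Finset.sum_add_distrib, ← Finset.mul_sum, hsum _ hg2, Fintype.sum_prod_type]
    _ ≤ ∑ p, (volume.real (K p))⁻¹ * (∫ x in K p, fn u x) ^ 2 +
          (d * δ ^ 2) * 2 ^ d * ∑ _T : 𝒯, G := by
        gcongr with T _
        exact setIntegral_mono_set hg2 (Eventually.of_forall fun x => sq_nonneg _)
          (hSsub T).eventuallyLE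
    _ = ∑ p, (volume.real (K p))⁻¹ * (∫ x in K p, fn u x) ^ 2 + (C * δ ^ 2) * G := by
        simp only [Finset.sum_const, Finset.card_univ, Fintype.card_coe, nsmul_eq_mul, hC, hN]
        ring
    _ ≤ _ := by gcongr

theorem volume_ne_top_of_isBounded (hb : Bornology.IsBounded Ω) {K : Set (Sp d)} (hK : K ⊆ Ω) :
    volume.restrict Ω K ≠ ⊤ :=
  ((Measure.restrict_apply_le _ _).trans_lt (hb.subset hK).measure_lt_top).ne

/-- The Rellich embedding theorem: weak convergence in `H¹` implies convergence in `L²`. -/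
theorem tendsto_fn_of_weak (hΩ : IsOpen Ω) (hb : Bornology.IsBounded Ω)
    (hreg : interior (closure Ω) = Ω) (h𝒯 : IsTriangulation (closure Ω) 𝒯)
    {u : ℕ → H1 Ω} {v : H1 Ω} {M : ℝ} (hM : ∀ n, ‖u n‖ ≤ M)
    (hw : ∀ φ : H1 Ω →L[ℝ] ℝ, Tendsto (fun n => φ (u n)) atTop (𝓝 (φ v))) :
    Tendsto (fun n => fn (u n)) atTop (𝓝 (fn v)) := by
  rw [tendsto_iff_norm_sub_tendsto_zero]
  have hsq : Tendsto (fun n => ‖fn (u n) - fn v‖ ^ 2) atTop (𝓝 0) := by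
    rw [Metric.tendsto_atTop]
    intro ε hε
    set B : ℝ := (M + ‖v‖) ^ 2 + 1 with hB
    have hBpos : 0 < B := by positivity
    obtain ⟨ι, _, K, c, hK, hle⟩ := exists_norm_fn_sq_le hΩ hb hreg h𝒯
      (η := ε / 2 / B) (by positivity)
    have hlim : Tendsto (fun n => ∑ i, c i * (∫ x in K i, fn (u n - v) x) ^ 2) atTop (𝓝 0) := by
      have : Tendsto (fun n => ∑ i, c i * (∫ x in K i, fn (u n - v) x) ^ 2) atTop
          (𝓝 (∑ i, c i * (0 : ℝ) ^ 2)) := by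
        refine tendsto_finsetSum _ fun i _ => (Tendsto.pow ?_ 2).const_mul _
        have hne := volume_ne_top_of_isBounded hb (hK i).2
        -- the mean values are bounded linear functionals on `H¹`
        have h1 := hw ((innerSL ℝ (indicatorConstLp 2 (hK i).1 hne (1 : ℝ))).comp (fnL Ω))
        have h2 : ∀ n, ∫ x in K i, fn (u n - v) x =
            ((innerSL ℝ (indicatorConstLp 2 (hK i).1 hne (1 : ℝ))).comp (fnL Ω)) (u n) -
            ((innerSL ℝ (indicatorConstLp 2 (hK i).1 hne (1 : ℝ))).comp (fnL Ω)) v := by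
          intro n
          rw [← map_sub, ContinuousLinearMap.comp_apply, innerSL_apply_apply,
            L2.inner_indicatorConstLp_one (hK i).1 hne, Measure.restrict_restrict (hK i).1,
            Set.inter_eq_left.2 (hK i).2, fnL_apply]
        simp_rw [h2]
        exact (sub_self (((innerSL ℝ (indicatorConstLp 2 (hK i).1 hne (1 : ℝ))).comp (fnL Ω)) v)) ▸
          h1.sub_const _
      simpa using this
    obtain ⟨n₀, hn₀⟩ := Metric.tendsto_atTop.1 hlim (ε / 2) (by positivity)
    refine ⟨n₀, fun n hn => ?_⟩
    have h1 := hn₀ n hn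
    rw [Real.dist_eq, sub_zero] at h1 ⊢
    rw [abs_of_nonneg (sq_nonneg _), ← fn_sub]
    have h2 := hle (u n - v)
    have h3 : ‖grad (u n - v)‖ ^ 2 ≤ B := by
      have h4 : ‖grad (u n - v)‖ ≤ M + ‖v‖ :=
        (norm_grad_le _).trans ((norm_sub_le _ _).trans (by gcongr; exact hM n))
      nlinarith [norm_nonneg (grad (u n - v))]
    have h5 : ε / 2 / B * ‖grad (u n - v)‖ ^ 2 ≤ ε / 2 := by
      calc ε / 2 / B * ‖grad (u n - v)‖ ^ 2 ≤ ε / 2 / B * B := by gcongr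
        _ = ε / 2 := by field_simp
    linarith [le_abs_self (∑ i, c i * (∫ x in K i, fn (u n - v) x) ^ 2)]
  have := hsq.sqrt
  simpa [Real.sqrt_sq (norm_nonneg _)] using this

end

/-! ### Functions with vanishing gradient -/

section

variable {Ω : Set (Sp d)} {u : Sp d → ℝ} {g : Sp d → Sp d}

theorem ae_const_on_ball (hΩ : IsOpen Ω)
    (hu : MemLp u 2 (volume.restrict Ω)) (hgL : MemLp g 2 (volume.restrict Ω))
    (hg : IsWeakGradient Ω u g) (hg0 : g =ᵐ[volume.restrict Ω] 0) {x : Sp d} {r : ℝ} (hr : 0 < r)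
    (hx : Metric.ball x r ⊆ Ω) :
    ∃ c : ℝ, ∀ᵐ y ∂(volume.restrict (Metric.ball x r)), u y = c := by
  set B := Metric.ball x r with hB
  have hP := poincare_convex_open hΩ hu hgL hg (convex_ball x r) Metric.isOpen_ball
    Metric.isBounded_ball hx (D := (2 * r) ^ 2) (fun y hy z hz => by
      have h1 : dist z y ≤ 2 * r := by
        have := dist_triangle_right z y x
        have h2 := Metric.mem_ball.1 hy
        have h3 := Metric.mem_ball.1 hz
        linarith
      rw [← dist_eq_norm]
      gcongr)
  have hz : ∫⁻ y in B, ‖g y‖ₑ ^ 2 = 0 := by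
    rw [lintegral_eq_zero_iff']
    · filter_upwards [ae_restrict_of_ae_restrict_of_subset hx hg0] with y hy
      simp [hy]
    · exact ((hgL.1.mono_measure (Measure.restrict_mono_set _ hx)).enorm.pow_const 2)
  rw [hz, mul_zero, nonpos_iff_eq_zero, ← Measure.prod_restrict, lintegral_eq_zero_iff'] at hP
  · have h1 := Measure.ae_ae_of_ae_prod hP
    have hne : (volume.restrict B) ≠ 0 := by
      rw [Ne, Measure.restrict_eq_zero]
      exact (Metric.measure_ball_pos volume x hr).ne'
    have : NeZero (volume.restrict B) := ⟨hne⟩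
    obtain ⟨z, hz⟩ := h1.exists
    refine ⟨u z, hz.mono fun y hy => ?_⟩
    simpa [sub_eq_zero] using hy
  · have hm : AEStronglyMeasurable u (volume.restrict B) :=
      hu.1.mono_measure (Measure.restrict_mono_set _ hx)
    exact ((hm.comp_snd).sub (hm.comp_fst)).enorm.pow_const 2

/-- On a connected open set, a function with vanishing weak gradient is constant. -/
theorem ae_const_of_grad_eq_zero (hΩ : IsOpen Ω) (hconn : IsConnected Ω)
    (hu : MemLp u 2 (volume.restrict Ω)) (hgL : MemLp g 2 (volume.restrict Ω))
    (hg : IsWeakGradient Ω u g) (hg0 : g =ᵐ[volume.restrict Ω] 0) :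
    ∃ c : ℝ, ∀ᵐ y ∂(volume.restrict Ω), u y = c := by
  -- the open sets on which `u` is locally equal to the constant `c`
  set N : ℝ → Set (Sp d) := fun c => {x | ∃ r > 0, Metric.ball x r ⊆ Ω ∧
    ∀ᵐ y ∂(volume.restrict (Metric.ball x r)), u y = c} with hN
  have hNopen : ∀ c, IsOpen (N c) := by
    intro c
    rw [Metric.isOpen_iff]
    rintro x ⟨r, hr, hsub, hae⟩
    refine ⟨r, hr, fun y hy => ?_⟩
    have hs : Metric.ball y (r - dist y x) ⊆ Metric.ball x r :=
      Metric.ball_subset_ball' (by linarith)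
    exact ⟨r - dist y x, sub_pos.2 hy, hs.trans hsub,
      ae_restrict_of_ae_restrict_of_subset hs hae⟩
  have hNdisj : ∀ c c' x, x ∈ N c → x ∈ N c' → c = c' := by
    rintro c c' x ⟨r, hr, -, h⟩ ⟨r', hr', -, h'⟩
    have hne : NeZero (volume.restrict (Metric.ball x (min r r'))) := ⟨by
      rw [Ne, Measure.restrict_eq_zero]
      exact (Metric.measure_ball_pos volume x (lt_min hr hr')).ne'⟩
    obtain ⟨y, hy, hy'⟩ := ((ae_restrict_of_ae_restrict_of_subset
      (Metric.ball_subset_ball (min_le_left r r')) h).and (ae_restrict_of_ae_restrict_of_subset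
      (Metric.ball_subset_ball (min_le_right r r')) h')).exists
    rw [← hy, hy']
  have hcov : ∀ x ∈ Ω, ∃ c, x ∈ N c := by
    intro x hx
    obtain ⟨r, hr, hsub⟩ := Metric.isOpen_iff.1 hΩ x hx
    obtain ⟨c, hc⟩ := ae_const_on_ball hΩ hu hgL hg hg0 hr hsub
    exact ⟨c, r, hr, hsub, hc⟩
  obtain ⟨x₀, hx₀⟩ := hconn.nonempty
  obtain ⟨c₀, hc₀⟩ := hcov x₀ hx₀
  have hall : Ω ⊆ N c₀ := by
    refine hconn.isPreconnected.subset_left_of_subset_union (hNopen c₀)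
      (isOpen_biUnion fun c (_ : c ∈ {c | c ≠ c₀}) => hNopen c) ?_ ?_ ⟨x₀, hx₀, hc₀⟩
    · rw [Set.disjoint_left]
      intro x hx hx'
      obtain ⟨c, hc, hxc⟩ := Set.mem_iUnion₂.1 hx'
      exact hc (hNdisj _ _ x hxc hx)
    · intro x hx
      obtain ⟨c, hc⟩ := hcov x hx
      by_cases h : c = c₀
      · exact Or.inl (h ▸ hc)
      · exact Or.inr (Set.mem_biUnion h hc)
  refine ⟨c₀, ?_⟩
  rw [ae_restrict_iff' hΩ.measurableSet, ae_iff]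
  refine measure_null_of_locally_null _ fun x hx => ?_
  simp only [Set.mem_ofPred_eq, Classical.not_imp] at hx
  obtain ⟨r, hr, hsub, hae⟩ := hall hx.1
  rw [ae_restrict_iff' Metric.isOpen_ball.measurableSet, ae_iff] at hae
  refine ⟨{y | ¬(y ∈ Metric.ball x r → u y = c₀)}, ?_, hae⟩
  filter_upwards [mem_nhdsWithin_of_mem_nhds (Metric.ball_mem_nhds x hr), self_mem_nhdsWithin]
    with y hy hy'
  simp only [Classical.not_imp] at hy' ⊢
  exact ⟨hy, hy'.2⟩

end

/-! ### The trace inequality -/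

section Cone

variable {n : ℕ}

/-- Integration over a truncated cone in the coordinates `(t, y) ↦ a + A (t, t y)` is dominated by
integration over the whole space. -/
theorem exists_lintegral_cone_le (A : (ℝ × Sp n) ≃L[ℝ] Sp (n + 1)) (a : Sp (n + 1)) :
    ∃ C : ℝ≥0∞, C ≠ ⊤ ∧ ∀ (D : Set (Sp n)) (G : Sp (n + 1) → ℝ≥0∞), Measurable G →
      ∫⁻ t in Set.Icc (1 / 2 : ℝ) 1, ∫⁻ y in D, G (a + t • A (1, y)) ≤ C * ∫⁻ x, G x := by
  have hAm : Measurable A := A.continuous.measurable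
  have hvol : (volume : Measure (ℝ × Sp n)).IsAddHaarMeasure :=
    inferInstanceAs ((volume : Measure ℝ).prod (volume : Measure (Sp n))).IsAddHaarMeasure
  have hHaar : (Measure.map A (volume : Measure (ℝ × Sp n))).IsAddHaarMeasure :=
    A.isAddHaarMeasure_map volume
  set c := Measure.addHaarScalarFactor (Measure.map A (volume : Measure (ℝ × Sp n))) volume with hc
  have hmap : Measure.map A (volume : Measure (ℝ × Sp n)) = c • volume :=
    Measure.isAddLeftInvariant_eq_smul _ _
  refine ⟨2 ^ n * c, ENNReal.mul_ne_top (by finiteness) (by finiteness), fun D G hG => ?_⟩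
  have hGA : Measurable fun p : ℝ × Sp n => G (a + A p) :=
    hG.comp ((by fun_prop : Continuous fun p : ℝ × Sp n => a + A p).measurable)
  calc ∫⁻ t in Set.Icc (1 / 2 : ℝ) 1, ∫⁻ y in D, G (a + t • A (1, y))
      ≤ ∫⁻ t in Set.Icc (1 / 2 : ℝ) 1, 2 ^ n * ∫⁻ y, G (a + A (t, y)) := by
        refine setLIntegral_mono' measurableSet_Icc fun t ht => ?_
        refine (setLIntegral_le_lintegral _ _).trans ?_
        have e : ∀ y : Sp n, t • A (1, y) = A (t, 0 + t • y) := fun y => by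
          rw [← map_smul]
          simp
        simp_rw [e]
        exact lintegral_comp_add_smul_le (G := fun y => G (a + A (t, y)))
          (hGA.comp measurable_prodMk_left) 0 ht.1
    _ ≤ ∫⁻ t, 2 ^ n * ∫⁻ y, G (a + A (t, y)) := setLIntegral_le_lintegral _ _
    _ = 2 ^ n * ∫⁻ p : ℝ × Sp n, G (a + A p) := by
        rw [lintegral_const_mul _ hGA.lintegral_prod_right', Measure.volume_eq_prod,
          lintegral_prod _ hGA.aemeasurable]
    _ = 2 ^ n * ∫⁻ x, G (a + x) ∂(Measure.map A (volume : Measure (ℝ × Sp n))) := by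
        congr 1
        exact (lintegral_map (hG.comp (measurable_const_add a)) hAm).symm
    _ = 2 ^ n * c * ∫⁻ x, G x := by
        rw [hmap, lintegral_smul_measure, lintegral_add_left_eq_self G a, mul_assoc]
        rfl

/-- The trace inequality on the base of a cone with apex `a`, for continuously differentiable
functions: integrate the fundamental theorem of calculus along the rays through the apex. -/
theorem exists_trace_cone_le (A : (ℝ × Sp n) ≃L[ℝ] Sp (n + 1)) (a : Sp (n + 1)) {D : Set (Sp n)}
    (hD : IsCompact D) :
    ∃ C : ℝ≥0∞, C ≠ ⊤ ∧ ∀ (v : Sp (n + 1) → ℝ), ContDiff ℝ 1 v → ∀ K : Set (Sp (n + 1)),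
      MeasurableSet K → (∀ y ∈ D, ∀ t ∈ Set.Icc (1 / 2 : ℝ) 1, a + t • A (1, y) ∈ K) →
      ∫⁻ y in D, ‖v (a + A (1, y))‖ₑ ^ 2 ≤
        C * ((∫⁻ x in K, ‖v x‖ₑ ^ 2) + ∫⁻ x in K, ‖fderiv ℝ v x‖ₑ ^ 2) := by
  obtain ⟨C, hC, hle⟩ := exists_lintegral_cone_le A a
  have hcA : Continuous fun y : Sp n => A (1, y) := by fun_prop
  obtain ⟨R, hR⟩ := (hD.image hcA).isBounded.exists_norm_le
  set R' : ℝ≥0∞ := ENNReal.ofReal R with hR'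
  refine ⟨4 * C + 2 * R' ^ 2 * C, by finiteness, fun v hv K hK hmem => ?_⟩
  set G : Sp (n + 1) → ℝ≥0∞ := K.indicator fun x => ‖v x‖ₑ ^ 2 with hG
  set H : Sp (n + 1) → ℝ≥0∞ := K.indicator fun x => ‖fderiv ℝ v x‖ₑ ^ 2 with hH
  have hGm : Measurable G := (hv.continuous.enorm.measurable.pow_const 2).indicator hK
  have hHm : Measurable H :=
    ((hv.continuous_fderiv one_ne_zero).enorm.measurable.pow_const 2).indicator hK
  have hGi : ∫⁻ x, G x = ∫⁻ x in K, ‖v x‖ₑ ^ 2 := lintegral_indicator hK _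
  have hHi : ∫⁻ x, H x = ∫⁻ x in K, ‖fderiv ℝ v x‖ₑ ^ 2 := lintegral_indicator hK _
  have hDm := hD.measurableSet
  have hcont2 : Continuous fun q : ℝ × Sp n => a + q.1 • A (1, q.2) := by fun_prop
  have hG2 : Measurable fun q : ℝ × Sp n => G (a + q.1 • A (1, q.2)) := hGm.comp hcont2.measurable
  have hH2 : Measurable fun q : ℝ × Sp n => H (a + q.1 • A (1, q.2)) := hHm.comp hcont2.measurable
  set h : Sp n → ℝ≥0∞ := fun y => ∫⁻ r in Set.Icc (1 / 2 : ℝ) 1, H (a + r • A (1, y)) with hh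
  have hhm : Measurable h := hH2.lintegral_prod_left'
  -- compare the value at the base with the value at parameter `t`, and average over `t` below
  have hpt : ∀ t ∈ Set.Icc (1 / 2 : ℝ) 1, ∀ y ∈ D,
      ‖v (a + A (1, y))‖ₑ ^ 2 ≤ 2 * G (a + t • A (1, y)) + 2 * R' ^ 2 * h y := by
    intro t ht y hy
    have h1 := enorm_sq_sub_le_segment hv a (A (1, y)) ht.2 (by linarith [ht.1])
    rw [one_smul] at h1
    have h2 : ‖A (1, y)‖ₑ ≤ R' := by
      rw [← ofReal_norm]
      exact ENNReal.ofReal_le_ofReal (hR _ ⟨y, hy, rfl⟩)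
    have h3 : ∫⁻ r in Set.Icc t 1, ‖fderiv ℝ v (a + r • A (1, y))‖ₑ ^ 2 ≤ h y := by
      refine (lintegral_mono_set (Set.Icc_subset_Icc_left ht.1)).trans ?_
      refine setLIntegral_mono' measurableSet_Icc fun r hr => ?_
      simp [hH, hmem y hy r hr]
    have h4 : G (a + t • A (1, y)) = ‖v (a + t • A (1, y))‖ₑ ^ 2 := by
      simp [hG, hmem y hy t ht]
    have h5 : ‖v (a + A (1, y))‖ₑ ≤
        ‖v (a + t • A (1, y))‖ₑ + ‖v (a + A (1, y)) - v (a + t • A (1, y))‖ₑ := by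
      have := enorm_add_le (v (a + t • A (1, y))) (v (a + A (1, y)) - v (a + t • A (1, y)))
      simpa using this
    calc ‖v (a + A (1, y))‖ₑ ^ 2
        ≤ (‖v (a + t • A (1, y))‖ₑ + ‖v (a + A (1, y)) - v (a + t • A (1, y))‖ₑ) ^ 2 := by gcongr
      _ ≤ 2 * (‖v (a + t • A (1, y))‖ₑ ^ 2 + ‖v (a + A (1, y)) - v (a + t • A (1, y))‖ₑ ^ 2) := by
          have := ENNReal.rpow_add_le_mul_rpow_add_rpow ‖v (a + t • A (1, y))‖ₑ
            ‖v (a + A (1, y)) - v (a + t • A (1, y))‖ₑ one_le_two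
          norm_num at this
          exact this
      _ ≤ 2 * (G (a + t • A (1, y)) + R' ^ 2 * h y) := by
          rw [h4]
          gcongr
          exact h1.trans (by gcongr)
      _ = _ := by ring
  have hhalf : volume (Set.Icc (1 / 2 : ℝ) 1) = 2⁻¹ := by
    rw [Real.volume_Icc, show (1 : ℝ) - 1 / 2 = 2⁻¹ by norm_num,
      ENNReal.ofReal_inv_of_pos two_pos, ENNReal.ofReal_ofNat]
  have hmain : 2⁻¹ * ∫⁻ y in D, ‖v (a + A (1, y))‖ₑ ^ 2 ≤
      2 * (C * ∫⁻ x, G x) + 2⁻¹ * (2 * R' ^ 2 * (C * ∫⁻ x, H x)) := by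
    calc 2⁻¹ * ∫⁻ y in D, ‖v (a + A (1, y))‖ₑ ^ 2
        = ∫⁻ t in Set.Icc (1 / 2 : ℝ) 1, ∫⁻ y in D, ‖v (a + A (1, y))‖ₑ ^ 2 := by
          rw [setLIntegral_const, hhalf, mul_comm]
      _ ≤ ∫⁻ t in Set.Icc (1 / 2 : ℝ) 1, ∫⁻ y in D,
            (2 * G (a + t • A (1, y)) + 2 * R' ^ 2 * h y) :=
          setLIntegral_mono' measurableSet_Icc fun t ht =>
            setLIntegral_mono' hDm fun y hy => hpt t ht y hy
      _ = ∫⁻ t in Set.Icc (1 / 2 : ℝ) 1, (2 * (∫⁻ y in D, G (a + t • A (1, y))) +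
            2 * R' ^ 2 * ∫⁻ y in D, h y) := by
          refine lintegral_congr fun t => ?_
          have hGt : Measurable fun y => G (a + t • A (1, y)) := hG2.comp measurable_prodMk_left
          rw [lintegral_add_left (hGt.const_mul 2), lintegral_const_mul _ hGt,
            lintegral_const_mul _ hhm]
      _ = 2 * (∫⁻ t in Set.Icc (1 / 2 : ℝ) 1, ∫⁻ y in D, G (a + t • A (1, y))) +
            2⁻¹ * (2 * R' ^ 2 * ∫⁻ y in D, h y) := by
          have hGt : Measurable fun t : ℝ => ∫⁻ y in D, G (a + t • A (1, y)) :=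
            hG2.lintegral_prod_right'
          rw [lintegral_add_left (hGt.const_mul 2), lintegral_const_mul _ hGt,
            setLIntegral_const, hhalf, mul_comm 2⁻¹]
      _ ≤ _ := by
          gcongr
          · exact hle D G hGm
          · rw [hh, lintegral_lintegral_swap]
            · exact hle D H hHm
            · exact (hH2.comp measurable_swap).aemeasurable
  calc ∫⁻ y in D, ‖v (a + A (1, y))‖ₑ ^ 2
      = 2 * (2⁻¹ * ∫⁻ y in D, ‖v (a + A (1, y))‖ₑ ^ 2) := by
        rw [← mul_assoc, ENNReal.mul_inv_cancel (by norm_num) (by norm_num), one_mul]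
    _ ≤ 2 * (2 * (C * ∫⁻ x, G x) + 2⁻¹ * (2 * R' ^ 2 * (C * ∫⁻ x, H x))) := by gcongr
    _ = 4 * C * (∫⁻ x, G x) + 2 * 2⁻¹ * (2 * R' ^ 2 * C * (∫⁻ x, H x)) := by ring
    _ = 4 * C * (∫⁻ x, G x) + 2 * R' ^ 2 * C * ∫⁻ x, H x := by
        rw [ENNReal.mul_inv_cancel (by norm_num) (by norm_num), one_mul]
    _ ≤ (4 * C + 2 * R' ^ 2 * C) * (∫⁻ x, G x) + (4 * C + 2 * R' ^ 2 * C) * ∫⁻ x, H x := by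
        gcongr
        · exact le_self_add
        · exact le_add_self
    _ = _ := by rw [hGi, hHi, mul_add]

/-- The trace inequality on the base of a cone, for functions that are continuous up to the
boundary. It follows from the smooth case by contracting the cone into its interior and
mollifying. -/
theorem exists_trace_cone_le_of_continuousOn {Ω : Set (Sp (n + 1))} (hΩ : IsOpen Ω)
    (A : (ℝ × Sp n) ≃L[ℝ] Sp (n + 1)) (a : Sp (n + 1)) {D : Set (Sp n)}
    (hD : IsCompact D) {K : Set (Sp (n + 1))} (hK : Convex ℝ K) (hKc : IsCompact K)
    (hKi : (interior K).Nonempty) (hKΩ : interior K ⊆ Ω)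
    (hmem : ∀ y ∈ D, ∀ t ∈ Set.Icc (1 / 2 : ℝ) 1, a + t • A (1, y) ∈ K) :
    ∃ C : ℝ≥0∞, C ≠ ⊤ ∧ ∀ (f : Sp (n + 1) → ℝ) (g : Sp (n + 1) → Sp (n + 1)),
      ContinuousOn f (closure Ω) → MemLp f 2 (volume.restrict Ω) →
      MemLp g 2 (volume.restrict Ω) → IsWeakGradient Ω f g →
      ∫⁻ y in D, ‖f (a + A (1, y))‖ₑ ^ 2 ≤
        C * ((∫⁻ x in Ω, ‖f x‖ₑ ^ 2) + ∫⁻ x in Ω, ‖g x‖ₑ ^ 2) := by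
  obtain ⟨C, hC, hle⟩ := exists_trace_cone_le A a hD
  refine ⟨C * 2 ^ (n + 1), by finiteness, fun f g hf hfL hgL hg => ?_⟩
  obtain ⟨c, hc⟩ := hKi
  set B := (∫⁻ x in Ω, ‖f x‖ₑ ^ 2) + ∫⁻ x in Ω, ‖g x‖ₑ ^ 2 with hB
  have hKsub : K ⊆ closure Ω := by
    calc K ⊆ closure K := subset_closure
      _ = closure (interior K) := (hK.closure_interior_eq_closure_of_nonempty_interior ⟨c, hc⟩).symm
      _ ⊆ closure Ω := closure_mono hKΩ
  -- contraction towards the interior point `c`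
  set δ : ℝ → Sp (n + 1) → Sp (n + 1) := fun s x => (c - s • c) + s • x with hδ
  have hδc : ∀ s, Continuous (δ s) := fun s => by fun_prop
  have hδi : ∀ s, 0 ≤ s → s < 1 → ∀ x ∈ K, δ s x ∈ interior K := by
    intro s hs0 hs1 x hx
    have := hK.combo_interior_closure_mem_interior hc (subset_closure hx) (sub_pos.2 hs1) hs0
      (by ring)
    rwa [sub_smul, one_smul] at this
  have hψK : ∀ y ∈ D, a + A (1, y) ∈ K := fun y hy => by
    simpa using hmem y hy 1 ⟨by norm_num, le_rfl⟩
  have hψc : Continuous fun y : Sp n => a + A (1, y) := by fun_prop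
  have hstep : ∀ s : ℝ, 1 / 2 ≤ s → s < 1 →
      ∫⁻ y in D, ‖f (δ s (a + A (1, y)))‖ₑ ^ 2 ≤ C * 2 ^ (n + 1) * B := by
    intro s hs hs1
    have hs0 : 0 ≤ s := by linarith
    set K' := δ s '' K with hK'
    have hK'c : IsCompact K' := hKc.image (hδc s)
    have hK'Ω : K' ⊆ Ω := by
      rintro _ ⟨x, hx, rfl⟩
      exact hKΩ (hδi s hs0 hs1 x hx)
    set v : ℕ → Sp (n + 1) → ℝ := fun m => moll Ω (bumpSeq (n + 1) m) f with hv
    have hvc : ∀ m, ContDiff ℝ 1 (v m) := fun m => contDiff_moll hΩ.measurableSet _ hfL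
    -- `δ s` dilates by a factor of at least `1 / 2`
    have hscale : ∀ h : Sp (n + 1) → ℝ≥0∞, Measurable h →
        ∫⁻ x in K, h (δ s x) ≤ 2 ^ (n + 1) * ∫⁻ x in K', h x := by
      intro h hh
      calc ∫⁻ x in K, h (δ s x) ≤ ∫⁻ x in K, K'.indicator h (δ s x) := by
            refine setLIntegral_mono' hKc.measurableSet fun x hx => ?_
            rw [Set.indicator_of_mem (Set.mem_image_of_mem _ hx)]
        _ ≤ ∫⁻ x, K'.indicator h (δ s x) := setLIntegral_le_lintegral _ _
        _ ≤ 2 ^ (n + 1) * ∫⁻ x, K'.indicator h x :=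
            lintegral_comp_add_smul_le (hh.indicator hK'c.measurableSet) _ hs
        _ = _ := by rw [lintegral_indicator hK'c.measurableSet]
    have hbound : ∀ᶠ m in atTop, ∫⁻ y in D, ‖v m (δ s (a + A (1, y)))‖ₑ ^ 2 ≤
        C * 2 ^ (n + 1) * B := by
      filter_upwards [eventually_setLIntegral_fderiv_moll_le hΩ hfL hgL hg hK'c hΩ hK'Ω subset_rfl,
        eventually_setLIntegral_moll_le hΩ.measurableSet hfL hK'c hΩ hK'Ω] with m hm1 hm2
      have hδd : ContDiff ℝ 1 (δ s) := by fun_prop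
      have h1 := hle (v m ∘ δ s) ((hvc m).comp hδd) K hKc.measurableSet hmem
      have hfd : ∀ x, ‖fderiv ℝ (v m ∘ δ s) x‖ₑ ≤ ‖fderiv ℝ (v m) (δ s x)‖ₑ := by
        intro x
        have hδx : HasFDerivAt (δ s) (s • ContinuousLinearMap.id ℝ (Sp (n + 1))) x :=
          ((hasFDerivAt_id x).const_smul s).const_add _
        have hc := (((hvc m).differentiable one_ne_zero).differentiableAt
          (x := δ s x)).hasFDerivAt.comp x hδx
        rw [hc.fderiv, ContinuousLinearMap.comp_smul, ContinuousLinearMap.comp_id, enorm_smul]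
        calc ‖s‖ₑ * ‖fderiv ℝ (v m) (δ s x)‖ₑ ≤ 1 * ‖fderiv ℝ (v m) (δ s x)‖ₑ := by
              gcongr
              rw [Real.enorm_of_nonneg hs0]
              exact ENNReal.ofReal_le_one.2 hs1.le
          _ = _ := one_mul _
      calc ∫⁻ y in D, ‖v m (δ s (a + A (1, y)))‖ₑ ^ 2
          ≤ C * ((∫⁻ x in K, ‖v m (δ s x)‖ₑ ^ 2) + ∫⁻ x in K, ‖fderiv ℝ (v m ∘ δ s) x‖ₑ ^ 2) := h1
        _ ≤ C * ((∫⁻ x in K, ‖v m (δ s x)‖ₑ ^ 2) + ∫⁻ x in K, ‖fderiv ℝ (v m) (δ s x)‖ₑ ^ 2) := by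
            gcongr with x
            exact hfd x
        _ ≤ C * (2 ^ (n + 1) * (∫⁻ x in K', ‖v m x‖ₑ ^ 2) +
              2 ^ (n + 1) * ∫⁻ x in K', ‖fderiv ℝ (v m) x‖ₑ ^ 2) := by
            gcongr
            · exact hscale (fun x => ‖v m x‖ₑ ^ 2) ((hvc m).continuous.enorm.measurable.pow_const 2)
            · exact hscale (fun x => ‖fderiv ℝ (v m) x‖ₑ ^ 2)
                (((hvc m).continuous_fderiv one_ne_zero).enorm.measurable.pow_const 2)
        _ ≤ C * (2 ^ (n + 1) * (∫⁻ x in Ω, ‖f x‖ₑ ^ 2) + 2 ^ (n + 1) * ∫⁻ x in Ω, ‖g x‖ₑ ^ 2) := by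
            gcongr
        _ = _ := by rw [hB]; ring
    -- Fatou's lemma, removing the mollification
    calc ∫⁻ y in D, ‖f (δ s (a + A (1, y)))‖ₑ ^ 2
        = ∫⁻ y in D, liminf (fun m => ‖v m (δ s (a + A (1, y)))‖ₑ ^ 2) atTop := by
          refine setLIntegral_congr_fun hD.measurableSet fun y hy => ?_
          exact (ENNReal.Tendsto.pow (tendsto_moll_of_continuousOn hΩ hfL
            (hf.mono subset_closure) (hKΩ (hδi s hs0 hs1 _ (hψK y hy)))).enorm).liminf_eq.symm
      _ ≤ liminf (fun m => ∫⁻ y in D, ‖v m (δ s (a + A (1, y)))‖ₑ ^ 2) atTop := by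
          refine lintegral_liminf_le fun m => ?_
          exact (((hvc m).continuous.comp ((hδc s).comp hψc)).enorm.measurable).pow_const 2
      _ ≤ _ := liminf_le_of_frequently_le' hbound.frequently
  -- Fatou's lemma again, letting the contraction tend to the identity
  set s : ℕ → ℝ := fun j => 1 - 1 / ((j : ℝ) + 2) with hs
  have hs2 : ∀ j, 1 / 2 ≤ s j := by
    intro j
    have : 1 / ((j : ℝ) + 2) ≤ 1 / 2 := by
      apply one_div_le_one_div_of_le (by norm_num)
      linarith [(Nat.cast_nonneg j : (0 : ℝ) ≤ j)]
    simp only [hs]; linarith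
  have hs1 : ∀ j, s j < 1 := by
    intro j
    have : 0 < 1 / ((j : ℝ) + 2) := by positivity
    simp only [hs]; linarith
  have hslim : Tendsto s atTop (𝓝 1) := by
    have h := (tendsto_one_div_add_atTop_nhds_zero_nat (𝕜 := ℝ)).comp (tendsto_add_atTop_nat 1)
    have h' : Tendsto (fun j : ℕ => 1 / ((j : ℝ) + 2)) atTop (𝓝 0) := by
      refine h.congr fun j => ?_
      simp only [Function.comp_apply]; push_cast; ring
    have h1 := h'.const_sub 1
    rwa [sub_zero] at h1
  have hlim : ∀ y ∈ D, Tendsto (fun j => ‖f (δ (s j) (a + A (1, y)))‖ₑ ^ 2) atTop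
      (𝓝 (‖f (a + A (1, y))‖ₑ ^ 2)) := by
    intro y hy
    have hin := hψK y hy
    have h1 : Tendsto (fun j => δ (s j) (a + A (1, y))) atTop (𝓝 (a + A (1, y))) := by
      have : Tendsto (fun j => (c - s j • c) + s j • (a + A (1, y))) atTop
          (𝓝 ((c - (1 : ℝ) • c) + (1 : ℝ) • (a + A (1, y)))) :=
        (tendsto_const_nhds.sub (hslim.smul_const c)).add (hslim.smul_const _)
      rwa [one_smul, one_smul, sub_self, zero_add] at this
    have h2 : Tendsto (fun j => δ (s j) (a + A (1, y))) atTop (𝓝[closure Ω] (a + A (1, y))) :=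
      tendsto_nhdsWithin_iff.2 ⟨h1, Eventually.of_forall fun j =>
        subset_closure (hKΩ (hδi (s j) (by linarith [hs2 j]) (hs1 j) _ hin))⟩
    exact ENNReal.Tendsto.pow ((hf _ (hKsub hin)).tendsto.comp h2).enorm
  calc ∫⁻ y in D, ‖f (a + A (1, y))‖ₑ ^ 2
      = ∫⁻ y in D, liminf (fun j => ‖f (δ (s j) (a + A (1, y)))‖ₑ ^ 2) atTop :=
        setLIntegral_congr_fun hD.measurableSet fun y hy => (hlim y hy).liminf_eq.symm
    _ ≤ liminf (fun j => ∫⁻ y in D, ‖f (δ (s j) (a + A (1, y)))‖ₑ ^ 2) atTop := by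
        refine lintegral_liminf_le' fun j => ?_
        have hco : ContinuousOn (fun y => f (δ (s j) (a + A (1, y)))) D :=
          hf.comp ((hδc _).comp hψc).continuousOn fun y hy =>
            subset_closure (hKΩ (hδi (s j) (by linarith [hs2 j]) (hs1 j) _ (hψK y hy)))
        exact (hco.aestronglyMeasurable hD.measurableSet).enorm.pow_const 2
    _ ≤ _ := liminf_le_of_frequently_le'
        (Frequently.of_forall fun j => hstep (s j) (hs2 j) (hs1 j))

end Cone

/-! ### Faces of simplices and the surface measure -/

section Faces

variable {n : ℕ}

/-- The face of a simplex opposite to a vertex `a`, as the section `t = 1` of the cone coordinates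
`(t, y) ↦ a + A (t, t y)`. -/
theorem exists_cone_coordinates {T : Finset (Sp (n + 1))} (hcard : T.card = n + 2)
    (hT : AffineIndependent ℝ (fun x : T => (x : Sp (n + 1)))) {a : Sp (n + 1)} (ha : a ∈ T) :
    ∃ (A : (ℝ × Sp n) ≃L[ℝ] Sp (n + 1)) (D : Set (Sp n)), IsCompact D ∧
      (fun y => a + A (1, y)) '' D = convexHull ℝ ((T : Set (Sp (n + 1))) \ {a}) := by
  classical
  set S : Set (Sp (n + 1)) := (T : Set (Sp (n + 1))) \ {a} with hS
  -- `A (t, y) = t (p - a) + B y`, where `p` lies on the face and `B` parametrizes its direction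
  set V := vectorSpan ℝ S with hV
  have hSimg : S = (fun x : T => (x : Sp (n + 1))) ''
      ((Finset.univ.erase ⟨a, ha⟩ : Finset T) : Set T) := by
    ext x
    simp only [hS, Set.mem_sdiff, Finset.mem_coe, Set.mem_singleton_iff, Set.mem_image,
      Finset.mem_erase, Finset.mem_univ, and_true, Subtype.exists, exists_and_right, ne_eq,
      Subtype.mk.injEq, exists_eq_right]
    tauto
  have hfin : Module.finrank ℝ V = n := by
    rw [hV, hSimg]
    have := hT.finrank_vectorSpan_image_finset (s := Finset.univ.erase ⟨a, ha⟩) (n := n)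
      (by rw [Finset.card_erase_of_mem (Finset.mem_univ _), Finset.card_univ, Fintype.card_coe,
        hcard]; rfl)
    rwa [Finset.coe_image] at this
  have hne : S.Nonempty := by
    have h2 : 1 < T.card := by omega
    obtain ⟨b, hb, hba⟩ := Finset.exists_mem_ne h2 a
    exact ⟨b, hb, hba⟩
  obtain ⟨p, hp⟩ := hne
  have hanot : a ∉ affineSpan ℝ S := by
    rw [hSimg]
    intro h
    have := (hT.mem_affineSpan_iff ⟨a, ha⟩
      ((Finset.univ.erase ⟨a, ha⟩ : Finset T) : Set T)).1 h
    simp at this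
  let B : Sp n ≃L[ℝ] V := (LinearEquiv.ofFinrankEq (Sp n) V (by
    rw [finrank_euclideanSpace_fin, hfin])).toContinuousLinearEquiv
  let A₀ : (ℝ × Sp n) →ₗ[ℝ] Sp (n + 1) :=
    ((LinearMap.toSpanSingleton ℝ _ (p - a)).comp (LinearMap.fst ℝ ℝ (Sp n))) +
      (V.subtype.comp (B : Sp n →ₗ[ℝ] V)).comp (LinearMap.snd ℝ ℝ (Sp n))
  have hA₀ : ∀ t y, A₀ (t, y) = t • (p - a) + (B y : Sp (n + 1)) := fun t y => by simp [A₀]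
  have hinj : Function.Injective A₀ := by
    rw [← LinearMap.ker_eq_bot, LinearMap.ker_eq_bot']
    rintro ⟨t, y⟩ h
    rw [hA₀] at h
    have ht : t = 0 := by
      by_contra ht
      apply hanot
      have h1 : a - p ∈ V := by
        have : a - p = t⁻¹ • (B y : Sp (n + 1)) := by
          have h2 : (B y : Sp (n + 1)) = t • (a - p) := by
            rw [← sub_eq_zero, ← h]; module
          rw [h2, inv_smul_smul₀ ht]
        rw [this]
        exact V.smul_mem _ (B y).2
      have h2 : (a - p) +ᵥ p ∈ affineSpan ℝ S :=
        AffineSubspace.vadd_mem_of_mem_direction (by rwa [direction_affineSpan])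
          (subset_affineSpan ℝ S hp)
      simpa using h2
    rw [ht, zero_smul, zero_add] at h
    have : y = 0 := by
      have : B y = 0 := by exact_mod_cast h
      simpa using this
    simp [ht, this]
  let A : (ℝ × Sp n) ≃L[ℝ] Sp (n + 1) := (LinearMap.linearEquivOfInjective A₀ hinj (by
    rw [Module.finrank_prod, finrank_euclideanSpace_fin, finrank_euclideanSpace_fin,
      Module.finrank_self, add_comm])).toContinuousLinearEquiv
  have hA : ∀ t y, A (t, y) = t • (p - a) + (B y : Sp (n + 1)) := fun t y => hA₀ t y
  have hF : IsCompact (convexHull ℝ S) :=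
    (T.finite_toSet.subset Set.sdiff_subset).isCompact_convexHull ℝ
  have hcoord : ∀ x ∈ convexHull ℝ S, ∃ y, a + A (1, y) = x := by
    intro x hx
    have h1 : x - p ∈ V := by
      rw [hV, ← direction_affineSpan]
      exact AffineSubspace.vsub_mem_direction (convexHull_subset_affineSpan S hx)
        (subset_affineSpan ℝ S hp)
    refine ⟨B.symm ⟨x - p, h1⟩, ?_⟩
    rw [hA, ContinuousLinearEquiv.apply_symm_apply]
    module
  refine ⟨A, (fun x => (A.symm (x - a)).2) '' convexHull ℝ S, hF.image (by fun_prop), ?_⟩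
  have key : ∀ x ∈ convexHull ℝ S, a + A (1, (A.symm (x - a)).2) = x := by
    intro x hx
    obtain ⟨y, hy⟩ := hcoord x hx
    rw [← hy]
    simp
  rw [Set.image_image]
  ext x
  constructor
  · rintro ⟨z, hz, rfl⟩
    dsimp only
    rwa [key z hz]
  · exact fun hx => ⟨x, hx, key x hx⟩

/-- The surface measure on a face is dominated by a multiple of Lebesgue measure in coordinates. -/
theorem exists_restrict_euclideanHausdorffMeasure_le (A : (ℝ × Sp n) ≃L[ℝ] Sp (n + 1))
    (a : Sp (n + 1)) (D : Set (Sp n)) :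
    ∃ C : NNReal, (Measure.euclideanHausdorffMeasure n : Measure (Sp (n + 1))).restrict
        ((fun y => a + A (1, y)) '' D) ≤
      C • Measure.map (fun y => a + A (1, y)) (volume.restrict D) := by
  set ψ : Sp n → Sp (n + 1) := fun y => a + A (1, y) with hψ
  have hψc : Continuous ψ := by fun_prop
  have hlip : LipschitzWith ‖(A : (ℝ × Sp n) →L[ℝ] Sp (n + 1))‖₊ ψ := by
    refine LipschitzWith.of_dist_le_mul fun y z => ?_
    have h1 : ψ y - ψ z = (A : (ℝ × Sp n) →L[ℝ] Sp (n + 1)) (0, y - z) := by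
      have : ((0 : ℝ), y - z) = (1, y) - (1, z) := by simp
      rw [this, map_sub]
      simp [hψ]
    rw [dist_eq_norm, h1, dist_eq_norm]
    refine (ContinuousLinearMap.le_opNorm _ _).trans ?_
    simp [Prod.norm_def]
  set k := ‖(A : (ℝ × Sp n) →L[ℝ] Sp (n + 1))‖₊ with hk
  refine ⟨k ^ n, Measure.le_iff.2 fun s hs => ?_⟩
  have hsub : s ∩ ψ '' D ⊆ ψ '' (ψ ⁻¹' s ∩ D) := by
    rintro _ ⟨hx, y, hy, rfl⟩
    exact ⟨y, ⟨hx, hy⟩, rfl⟩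
  rw [Measure.restrict_apply hs, Measure.smul_apply, Measure.map_apply hψc.measurable hs,
    Measure.restrict_apply (hψc.measurable hs)]
  calc Measure.euclideanHausdorffMeasure n (s ∩ ψ '' D)
      ≤ Measure.euclideanHausdorffMeasure n (ψ '' (ψ ⁻¹' s ∩ D)) := measure_mono hsub
    _ ≤ (k : ℝ≥0∞) ^ n * Measure.euclideanHausdorffMeasure n (ψ ⁻¹' s ∩ D) := by
        simp only [Measure.euclideanHausdorffMeasure_def, Measure.smul_apply]
        have := hlip.hausdorffMeasure_image_le (d := n) (Nat.cast_nonneg n) (ψ ⁻¹' s ∩ D)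
        rw [ENNReal.rpow_natCast] at this
        simp only [ENNReal.smul_def, smul_eq_mul]
        calc _ ≤ _ := mul_le_mul_right this _
          _ = _ := by ring
    _ = _ := by
        rw [EuclideanSpace.euclideanHausdorffMeasure_eq_volume, ENNReal.smul_def, smul_eq_mul,
          ENNReal.coe_pow]

/-- A point of a simplex outside of the interior lies in a face. -/
theorem exists_mem_face_of_notMem_interior {T : Finset (Sp (n + 1))} (hcard : T.card = n + 2)
    (hT : AffineIndependent ℝ (fun x : T => (x : Sp (n + 1)))) {x : Sp (n + 1)}
    (hx : x ∈ convexHull ℝ (T : Set (Sp (n + 1))))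
    (hxi : x ∉ interior (convexHull ℝ (T : Set (Sp (n + 1))))) :
    ∃ a ∈ T, x ∈ convexHull ℝ ((T : Set (Sp (n + 1))) \ {a}) := by
  classical
  have htop : affineSpan ℝ (Set.range fun x : T => (x : Sp (n + 1))) = ⊤ := by
    rw [hT.affineSpan_eq_top_iff_card_eq_finrank_add_one, finrank_euclideanSpace_fin,
      Fintype.card_coe, hcard]
  let b : AffineBasis T ℝ (Sp (n + 1)) := ⟨fun x : T => (x : Sp (n + 1)), hT, htop⟩
  have hb : ∀ i : T, b i = (i : Sp (n + 1)) := fun i => rfl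
  have hrange : Set.range b = (T : Set (Sp (n + 1))) := by
    ext y
    simp [hb]
  rw [← hrange] at hx hxi
  rw [b.interior_convexHull] at hxi
  rw [b.convexHull_eq_nonneg_coord] at hx
  simp only [Set.mem_ofPred_eq, not_forall, not_lt] at hx hxi
  obtain ⟨i, hi⟩ := hxi
  have hi0 : b.coord i x = 0 := le_antisymm hi (hx i)
  refine ⟨i, i.2, ?_⟩
  have hsum : ∑ j ∈ Finset.univ.erase i, b.coord j x = 1 := by
    have := b.sum_coord_apply_eq_one x
    rwa [← Finset.add_sum_erase _ _ (Finset.mem_univ i), hi0, zero_add] at this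
  have hcomb : ∑ j ∈ Finset.univ.erase i, b.coord j x • b j = x := by
    have := b.linear_combination_coord_eq_self x
    rwa [← Finset.add_sum_erase _ _ (Finset.mem_univ i), hi0, zero_smul, zero_add] at this
  rw [← hcomb]
  refine (convex_convexHull ℝ _).sum_mem (fun j _ => hx j) hsum fun j hj => ?_
  refine subset_convexHull ℝ _ ⟨?_, ?_⟩
  · rw [hb]; exact j.2
  · rw [hb, Set.mem_singleton_iff, ← Subtype.ext_iff]
    exact Finset.ne_of_mem_erase hj

variable {Ω : Set (Sp (n + 1))} {𝒯 : Mesh (n + 1)}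

/-- Since the interiors of the simplices lie in `Ω`, the boundary is covered by the faces. -/
theorem frontier_subset_iUnion_faces (hΩ : IsOpen Ω) (hreg : interior (closure Ω) = Ω)
    (h𝒯 : IsTriangulation (closure Ω) 𝒯) :
    frontier Ω ⊆ ⋃ T : 𝒯, ⋃ a : (T : Finset (Sp (n + 1))),
      convexHull ℝ (((T : Finset (Sp (n + 1))) : Set (Sp (n + 1))) \ {(a : Sp (n + 1))}) := by
  intro x hx
  have hx1 : x ∈ closure Ω := hx.1
  have hx2 : x ∉ Ω := by
    have := hx.2
    rwa [hΩ.interior_eq] at this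
  rw [← h𝒯.2.2] at hx1
  obtain ⟨T, hT, hxT⟩ := Set.mem_iUnion₂.1 hx1
  obtain ⟨a, ha, hxa⟩ := exists_mem_face_of_notMem_interior (h𝒯.1 T hT).1 (h𝒯.1 T hT).2 hxT
    fun hi => hx2 (interior_convexHull_subset hreg h𝒯 hT hi)
  exact Set.mem_iUnion.2 ⟨⟨T, hT⟩, Set.mem_iUnion.2 ⟨⟨a, ha⟩, hxa⟩⟩

theorem nonempty_interior_simplex {T : Finset (Sp (n + 1))} (hcard : T.card = n + 2)
    (hT : AffineIndependent ℝ (fun x : T => (x : Sp (n + 1)))) :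
    (interior (convexHull ℝ (T : Set (Sp (n + 1))))).Nonempty := by
  have htop : affineSpan ℝ (Set.range fun x : T => (x : Sp (n + 1))) = ⊤ := by
    rw [hT.affineSpan_eq_top_iff_card_eq_finrank_add_one, finrank_euclideanSpace_fin,
      Fintype.card_coe, hcard]
  rw [interior_convexHull_nonempty_iff_affineSpan_eq_top]
  simpa using htop

theorem isFiniteMeasure_restrict_face {T : Finset (Sp (n + 1))} (hcard : T.card = n + 2)
    (hT : AffineIndependent ℝ (fun x : T => (x : Sp (n + 1)))) {a : Sp (n + 1)} (ha : a ∈ T) :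
    (Measure.euclideanHausdorffMeasure n : Measure (Sp (n + 1)))
      (convexHull ℝ ((T : Set (Sp (n + 1))) \ {a})) < ⊤ := by
  obtain ⟨A, D, hD, hAD⟩ := exists_cone_coordinates hcard hT ha
  obtain ⟨C, hC⟩ := exists_restrict_euclideanHausdorffMeasure_le A a D
  rw [← hAD]
  have h1 := hC Set.univ
  rw [Measure.restrict_apply_univ] at h1
  refine h1.trans_lt ?_
  have hψc : Continuous fun y : Sp n => a + A (1, y) := by fun_prop
  rw [Measure.smul_apply, Measure.map_apply hψc.measurable MeasurableSet.univ, Set.preimage_univ,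
    Measure.restrict_apply_univ, ENNReal.smul_def, smul_eq_mul]
  exact ENNReal.mul_lt_top ENNReal.coe_lt_top hD.measure_lt_top

theorem isFiniteMeasure_surf (hΩ : IsOpen Ω) (hreg : interior (closure Ω) = Ω)
    (h𝒯 : IsTriangulation (closure Ω) 𝒯) : IsFiniteMeasure (surf Ω) := by
  refine ⟨?_⟩
  rw [surf, Measure.restrict_apply_univ, Nat.add_sub_cancel]
  refine (measure_mono (frontier_subset_iUnion_faces hΩ hreg h𝒯)).trans_lt ?_
  refine (measure_iUnion_le _).trans_lt ?_
  rw [tsum_fintype]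
  refine ENNReal.sum_lt_top.2 fun T _ => (measure_iUnion_le _).trans_lt ?_
  rw [tsum_fintype]
  exact ENNReal.sum_lt_top.2 fun a _ =>
    isFiniteMeasure_restrict_face (h𝒯.1 T T.2).1 (h𝒯.1 T T.2).2 a.2

/-- The trace inequality on a face of a simplex of the triangulation: the simplex is a cone over the
face, with apex the opposite vertex. -/
theorem exists_setLIntegral_face_le (hΩ : IsOpen Ω) (hreg : interior (closure Ω) = Ω)
    (h𝒯 : IsTriangulation (closure Ω) 𝒯) {T : Finset (Sp (n + 1))} (hT : T ∈ 𝒯)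
    {a : Sp (n + 1)} (ha : a ∈ T) :
    ∃ C : ℝ≥0∞, C ≠ ⊤ ∧ ∀ (f : Sp (n + 1) → ℝ) (g : Sp (n + 1) → Sp (n + 1)),
      ContinuousOn f (closure Ω) → MemLp f 2 (volume.restrict Ω) →
      MemLp g 2 (volume.restrict Ω) → IsWeakGradient Ω f g →
      ∫⁻ x in convexHull ℝ ((T : Set (Sp (n + 1))) \ {a}), ‖f x‖ₑ ^ 2
          ∂(Measure.euclideanHausdorffMeasure n) ≤
        C * ((∫⁻ x in Ω, ‖f x‖ₑ ^ 2) + ∫⁻ x in Ω, ‖g x‖ₑ ^ 2) := by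
  obtain ⟨A, D, hD, hAD⟩ := exists_cone_coordinates (h𝒯.1 T hT).1 (h𝒯.1 T hT).2 ha
  obtain ⟨C, hC⟩ := exists_restrict_euclideanHausdorffMeasure_le A a D
  have hψc : Continuous fun y : Sp n => a + A (1, y) := by fun_prop
  have hψi : Function.Injective fun y : Sp n => a + A (1, y) := by
    intro y z h
    have := A.injective (add_left_cancel h)
    exact (Prod.mk.inj this).2
  have hconv := convex_convexHull ℝ (T : Set (Sp (n + 1)))
  obtain ⟨C', hC', hle⟩ := exists_trace_cone_le_of_continuousOn hΩ A a hD hconv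
    (T.finite_toSet.isCompact_convexHull ℝ) (nonempty_interior_simplex (h𝒯.1 T hT).1 (h𝒯.1 T hT).2)
    (interior_convexHull_subset hreg h𝒯 hT) (fun y hy t ht => by
      have h1 : a + A (1, y) ∈ convexHull ℝ (T : Set (Sp (n + 1))) := by
        have : a + A (1, y) ∈ convexHull ℝ ((T : Set (Sp (n + 1))) \ {a}) := by
          rw [← hAD]; exact ⟨y, hy, rfl⟩
        exact convexHull_mono Set.sdiff_subset this
      have h2 := hconv.add_smul_sub_mem (subset_convexHull ℝ _ ha) h1
        (t := t) ⟨by linarith [ht.1], ht.2⟩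
      simpa using h2)
  refine ⟨C * C', by finiteness, fun f g hf hfL hgL hg => ?_⟩
  rw [← hAD]
  calc ∫⁻ x in (fun y => a + A (1, y)) '' D, ‖f x‖ₑ ^ 2 ∂(Measure.euclideanHausdorffMeasure n)
      ≤ ∫⁻ x, ‖f x‖ₑ ^ 2 ∂(C • Measure.map (fun y => a + A (1, y)) (volume.restrict D)) :=
        lintegral_mono' hC le_rfl
    _ = C * ∫⁻ y in D, ‖f (a + A (1, y))‖ₑ ^ 2 := by
        rw [lintegral_smul_measure, (hψc.measurableEmbedding hψi).lintegral_map]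
        rfl
    _ ≤ C * (C' * ((∫⁻ x in Ω, ‖f x‖ₑ ^ 2) + ∫⁻ x in Ω, ‖g x‖ₑ ^ 2)) := by
        gcongr
        exact hle f g hf hfL hgL hg
    _ = _ := by rw [mul_assoc]

/-- The trace inequality on a polyhedral domain. -/
theorem exists_lintegral_surf_le (hΩ : IsOpen Ω) (hreg : interior (closure Ω) = Ω)
    (h𝒯 : IsTriangulation (closure Ω) 𝒯) :
    ∃ C : ℝ≥0∞, C ≠ ⊤ ∧ ∀ (f : Sp (n + 1) → ℝ) (g : Sp (n + 1) → Sp (n + 1)),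
      ContinuousOn f (closure Ω) → MemLp f 2 (volume.restrict Ω) →
      MemLp g 2 (volume.restrict Ω) → IsWeakGradient Ω f g →
      ∫⁻ x, ‖f x‖ₑ ^ 2 ∂(surf Ω) ≤
        C * ((∫⁻ x in Ω, ‖f x‖ₑ ^ 2) + ∫⁻ x in Ω, ‖g x‖ₑ ^ 2) := by
  choose C hC hle using fun (T : 𝒯) (a : (T : Finset (Sp (n + 1)))) =>
    exists_setLIntegral_face_le hΩ hreg h𝒯 T.2 a.2
  refine ⟨∑ T, ∑ a, C T a, ?_, fun f g hf hfL hgL hg => ?_⟩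
  · exact ENNReal.sum_ne_top.2 fun T _ => ENNReal.sum_ne_top.2 fun a _ => hC T a
  · rw [surf, Nat.add_sub_cancel]
    refine (lintegral_mono_set (frontier_subset_iUnion_faces hΩ hreg h𝒯)).trans ?_
    refine (lintegral_iUnion_le _ _).trans ?_
    rw [tsum_fintype, Finset.sum_mul]
    refine Finset.sum_le_sum fun T _ => (lintegral_iUnion_le _ _).trans ?_
    rw [tsum_fintype, Finset.sum_mul]
    exact Finset.sum_le_sum fun a _ => hle T a f g hf hfL hgL hg

end Faces

/-! ### Completeness of `H¹(Ω)` and weak compactness -/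

section

variable {Ω : Set (Sp d)}

/-- The weak gradient is a closed operator: each test function gives a closed linear condition. -/
theorem isClosed_H1 (Ω : Set (Sp d)) : IsClosed (H1 Ω : Set (WithLp 2 (L2 Ω × L2vec Ω))) := by
  have h : (H1 Ω : Set (WithLp 2 (L2 Ω × L2vec Ω))) =
      {p | ∀ φ : Sp d → ℝ, ContDiff ℝ ∞ φ → HasCompactSupport φ → tsupport φ ⊆ Ω → ∀ v : Sp d,
        ∫ x in Ω, p.fst x * fderiv ℝ φ x v = - ∫ x in Ω, inner ℝ (p.snd x) v * φ x} := rfl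
  rw [h]
  simp only [Set.ofPred_forall]
  refine isClosed_iInter fun φ => isClosed_iInter fun hφ => isClosed_iInter fun hc =>
    isClosed_iInter fun _ => isClosed_iInter fun v => ?_
  have m1 : MemLp (fun x => fderiv ℝ φ x v) 2 (volume.restrict Ω) :=
    (continuous_fderiv_test hφ v).memLp_of_hasCompactSupport (hasCompactSupport_fderiv_test hc v)
  have m2 : MemLp (fun x => φ x • v) 2 (volume.restrict Ω) :=
    (hφ.continuous.smul continuous_const).memLp_of_hasCompactSupport hc.smul_right
  have e1 : ∀ p : WithLp 2 (L2 Ω × L2vec Ω),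
      ∫ x in Ω, p.fst x * fderiv ℝ φ x v = inner ℝ (m1.toLp _) p.fst := by
    intro p
    rw [L2.inner_def]
    refine integral_congr_ae ?_
    filter_upwards [m1.coeFn_toLp] with x hx
    simp [hx]
  have e2 : ∀ p : WithLp 2 (L2 Ω × L2vec Ω),
      ∫ x in Ω, inner ℝ (p.snd x) v * φ x = inner ℝ (m2.toLp _) p.snd := by
    intro p
    rw [L2.inner_def]
    refine integral_congr_ae ?_
    filter_upwards [m2.coeFn_toLp] with x hx
    rw [hx, real_inner_smul_left, real_inner_comm]
    ring
  simp_rw [e1, e2]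
  exact isClosed_eq
    (continuous_const.inner (WithLp.fstL 2 ℝ (L2 Ω) (L2vec Ω)).continuous)
    (continuous_const.inner (WithLp.sndL 2 ℝ (L2 Ω) (L2vec Ω)).continuous).neg

instance instCompleteSpaceH1 : CompleteSpace (H1 Ω) :=
  (isClosed_H1 Ω).completeSpace_coe

end

/-- A bounded sequence in a Hilbert space has a weakly convergent subsequence. -/
theorem exists_weak_subseq {H : Type*} [NormedAddCommGroup H] [InnerProductSpace ℝ H]
    [CompleteSpace H] (u : ℕ → H) {M : ℝ} (hM : ∀ n, ‖u n‖ ≤ M) :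
    ∃ (φ : ℕ → ℕ) (v : H), StrictMono φ ∧
      ∀ ℓ : H →L[ℝ] ℝ, Tendsto (fun n => ℓ (u (φ n))) atTop (𝓝 (ℓ v)) := by
  -- restrict to the separable subspace generated by the sequence
  set K : Submodule ℝ H := (Submodule.span ℝ (Set.range u)).topologicalClosure with hK
  have hKsep : TopologicalSpace.SeparableSpace K := by
    have : TopologicalSpace.IsSeparable (K : Set H) := by
      rw [hK, Submodule.topologicalClosure_coe]
      exact ((Set.countable_range u).isSeparable.span (R := ℝ)).closure
    exact this.separableSpace
  have hKc : IsClosed (K : Set H) := Submodule.isClosed_topologicalClosure _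
  have : CompleteSpace K := hKc.completeSpace_coe
  have huK : ∀ n, u n ∈ K := fun n =>
    Submodule.le_topologicalClosure _ (Submodule.subset_span ⟨n, rfl⟩)
  let w : ℕ → K := fun n => ⟨u n, huK n⟩
  -- sequential Banach–Alaoglu, transported through the Riesz isomorphism
  obtain ⟨f, -, φ, hφ, hlim⟩ := WeakDual.isSeqCompact_closedBall ℝ K (0 : StrongDual ℝ K) M
    (x := fun n => StrongDual.toWeakDual (InnerProductSpace.toDual ℝ K (w n))) (fun n => by
      simp only [Set.mem_preimage, mem_closedBall_zero_iff]
      change ‖InnerProductSpace.toDual ℝ K (w n)‖ ≤ M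
      rw [LinearIsometryEquiv.norm_map]
      exact hM n)
  set v : K := (InnerProductSpace.toDual ℝ K).symm (WeakDual.toStrongDual f) with hv
  refine ⟨φ, v, hφ, fun ℓ => ?_⟩
  set z : K := (InnerProductSpace.toDual ℝ K).symm (ℓ.comp K.subtypeL) with hz
  have hℓ : ∀ x : K, ℓ x = inner ℝ z x := by
    intro x
    rw [hz, InnerProductSpace.toDual_symm_apply]
    rfl
  have h1 : Tendsto (fun n => inner ℝ (w (φ n)) z) atTop (𝓝 (f z)) :=
    (WeakBilin.eval_continuous (topDualPairing ℝ K) z).continuousAt.tendsto.comp hlim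
  have h2 : f z = inner ℝ v z := by
    rw [hv, InnerProductSpace.toDual_symm_apply]
    rfl
  rw [hℓ v, real_inner_comm, ← h2]
  refine h1.congr fun n => ?_
  rw [real_inner_comm, ← hℓ]

section

variable {Ω : Set (Sp d)}

/-- The weak gradient is unique, by the fundamental lemma of the calculus of variations. -/
theorem grad_ae_eq_of_fn_eq (hΩ : IsOpen Ω) {u v : H1 Ω} (h : fn u = fn v) :
    grad u = grad v := by
  have hw : fn (u - v) = 0 := by rw [fn_sub, h, sub_self]
  have hwg := isWeakGradient_H1 (u - v)
  have hloc : LocallyIntegrableOn (grad (u - v)) Ω volume := by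
    intro x hx
    obtain ⟨r, hr, hsub⟩ := Metric.isOpen_iff.1 hΩ x hx
    refine ⟨Metric.ball x r, mem_nhdsWithin_of_mem_nhds (Metric.ball_mem_nhds x hr), ?_⟩
    have hm : MemLp (grad (u - v)) 2 (volume.restrict (Metric.ball x r)) :=
      (Lp.memLp (grad (u - v))).mono_measure (Measure.restrict_mono_set _ hsub)
    have : IsFiniteMeasure (volume.restrict (Metric.ball x r)) :=
      ⟨by simpa using measure_ball_lt_top⟩
    exact hm.integrable (by norm_num)
  have h0 := hΩ.ae_eq_zero_of_integral_contDiff_smul_eq_zero hloc fun φ hφ hc hs => by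
    have hts : ∀ x ∉ Ω, φ x = 0 := fun x hx => image_eq_zero_of_notMem_tsupport fun h => hx (hs h)
    have hint : Integrable (fun x => φ x • grad (u - v) x) (volume.restrict Ω) :=
      memLp_one_iff_integrable.1 ((Lp.memLp (grad (u - v))).smul (r := 1)
        (hφ.continuous.memLp_of_hasCompactSupport hc (p := 2)))
    have hset : ∫ x, φ x • grad (u - v) x = ∫ x in Ω, φ x • grad (u - v) x := by
      rw [setIntegral_eq_integral_of_forall_compl_eq_zero]
      intro x hx
      rw [hts x hx, zero_smul]
    rw [hset]
    refine ext_inner_left ℝ fun w => ?_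
    rw [← integral_inner hint, inner_zero_right]
    have := hwg φ hφ hc hs w
    have hz : ∫ x in Ω, fn (u - v) x * fderiv ℝ φ x w = 0 := by
      refine integral_eq_zero_of_ae ?_
      rw [hw]
      filter_upwards [Lp.coeFn_zero ℝ 2 (volume.restrict Ω)] with x hx
      rw [hx, Pi.zero_apply, zero_mul]
    rw [hz] at this
    calc ∫ x in Ω, inner ℝ w (φ x • grad (u - v) x)
        = ∫ x in Ω, inner ℝ (grad (u - v) x) w * φ x := by
          refine integral_congr_ae (Eventually.of_forall fun x => ?_)
          simp only [real_inner_smul_right, real_inner_comm w]; ring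
      _ = 0 := by linarith
  have hg : grad (u - v) = 0 := by
    rw [Lp.eq_zero_iff_ae_eq_zero, EventuallyEq, ae_restrict_iff' hΩ.measurableSet]
    exact h0
  rw [grad_sub] at hg
  exact sub_eq_zero.1 hg

theorem H1_ext (hΩ : IsOpen Ω) {u v : H1 Ω} (h : fn u = fn v) : u = v := by
  have hg := grad_ae_eq_of_fn_eq hΩ h
  have h0 : ‖u - v‖ ^ 2 = 0 := by
    rw [norm_sq_H1, fn_sub, grad_sub, h, hg]
    simp
  exact sub_eq_zero.1 (norm_eq_zero.1 (pow_eq_zero_iff two_ne_zero |>.1 h0))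

/-- The constant functions belong to `H¹(Ω)`, with gradient zero. -/
theorem exists_const_H1 (hb : Bornology.IsBounded Ω) (c : ℝ) :
    ∃ u : H1 Ω, fn u =ᵐ[volume.restrict Ω] (fun _ => c) ∧ grad u = 0 := by
  have : IsFiniteMeasure (volume.restrict Ω) := ⟨by simpa using hb.measure_lt_top⟩
  have hm : MemLp (fun _ : Sp d => c) 2 (volume.restrict Ω) := memLp_const c
  have hw : IsWeakGradient Ω (hm.toLp _) (0 : L2vec Ω) := by
    intro φ hφ hc hs v
    have e1 : ∫ x in Ω, inner ℝ ((0 : L2vec Ω) x) v * φ x = 0 := by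
      refine integral_eq_zero_of_ae ?_
      filter_upwards [Lp.coeFn_zero (Sp d) 2 (volume.restrict Ω)] with x hx
      rw [hx, Pi.zero_apply, inner_zero_left, zero_mul, Pi.zero_apply]
    have e2 : ∫ x in Ω, (hm.toLp _ : L2 Ω) x * fderiv ℝ φ x v = ∫ x in Ω, c * fderiv ℝ φ x v := by
      refine integral_congr_ae ?_
      filter_upwards [hm.coeFn_toLp] with x hx
      rw [hx]
    have e3 : ∫ x in Ω, c * fderiv ℝ φ x v = ∫ x, c * fderiv ℝ φ x v := by
      rw [setIntegral_eq_integral_of_forall_compl_eq_zero]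
      intro x hx
      have : fderiv ℝ φ x = 0 := by
        refine image_eq_zero_of_notMem_tsupport fun h => hx (hs (tsupport_fderiv_subset ℝ h))
      simp [this]
    have hint : Integrable (fun x => c * fderiv ℝ φ x v) :=
      ((continuous_fderiv_test hφ v).integrable_of_hasCompactSupport
        (hasCompactSupport_fderiv_test hc v)).const_mul c
    have e4 := integral_mul_fderiv_eq_neg_fderiv_mul_of_integrable (μ := (volume : Measure (Sp d)))
      (f := fun _ : Sp d => c) (g := φ) (v := v) (by simp) hint
      ((hφ.continuous.integrable_of_hasCompactSupport hc).const_mul c)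
      (fun x _ => differentiableAt_const c)
      (fun x _ => hφ.differentiable (by simp) x)
    rw [e1, e2, e3, e4]
    simp
  exact ⟨⟨WithLp.toLp 2 (hm.toLp _, 0), hw⟩, hm.coeFn_toLp, rfl⟩

theorem ae_const_H1 (hΩ : IsOpen Ω) (hconn : IsConnected Ω) {u : H1 Ω} (hu : grad u = 0) :
    ∃ c : ℝ, ∀ᵐ x ∂(volume.restrict Ω), fn u x = c := by
  refine ae_const_of_grad_eq_zero hΩ hconn (Lp.memLp (fn u)) (Lp.memLp (grad u))
    (isWeakGradient_H1 u) ?_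
  rw [hu]
  exact Lp.coeFn_zero _ _ _

end

/-! ### The trace operator -/

theorem eLpNorm_two_sq {α F : Type*} [MeasurableSpace α] {μ : Measure α} [NormedAddCommGroup F]
    (f : α → F) : eLpNorm f 2 μ ^ 2 = ∫⁻ x, ‖f x‖ₑ ^ 2 ∂μ := by
  rw [eLpNorm_eq_lintegral_rpow_enorm_toReal (by norm_num) (by norm_num), ← ENNReal.rpow_natCast,
    ← ENNReal.rpow_mul]
  simp

/-- The trace inequality with constant `C` for functions that are continuous up to the boundary. -/
def TraceBound (Ω : Set (Sp d)) (C : ℝ) : Prop :=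
  ∀ (w : H1 Ω) (f : Sp d → ℝ), ContinuousOn f (closure Ω) → fn w =ᵐ[volume.restrict Ω] f →
    eLpNorm f 2 (surf Ω) ≤ ENNReal.ofReal (C * ‖w‖)

theorem exists_traceBound {n : ℕ} {Ω : Set (Sp (n + 1))} {𝒯 : Mesh (n + 1)} (hΩ : IsOpen Ω)
    (hreg : interior (closure Ω) = Ω) (h𝒯 : IsTriangulation (closure Ω) 𝒯) :
    ∃ C, 0 ≤ C ∧ TraceBound Ω C := by
  obtain ⟨C, hC, hle⟩ := exists_lintegral_surf_le hΩ hreg h𝒯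
  refine ⟨Real.sqrt C.toReal, Real.sqrt_nonneg _, fun w f hf hwf => ?_⟩
  have hfL : MemLp f 2 (volume.restrict Ω) := (Lp.memLp (fn w)).ae_eq hwf
  have hfg : IsWeakGradient Ω f (grad w) := by
    intro φ hφ hc hs v
    rw [← isWeakGradient_H1 w φ hφ hc hs v]
    refine integral_congr_ae ?_
    filter_upwards [hwf] with x hx
    rw [hx]
  have h1 := hle f (grad w) hf hfL (Lp.memLp (grad w)) hfg
  have e1 : ∫⁻ x in Ω, ‖f x‖ₑ ^ 2 = ENNReal.ofReal (‖fn w‖ ^ 2) := by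
    rw [← eLpNorm_two_sq, ← eLpNorm_congr_ae hwf, ENNReal.ofReal_pow (norm_nonneg _),
      ofReal_norm, Lp.enorm_def]
  have e2 : ∫⁻ x in Ω, ‖grad w x‖ₑ ^ 2 = ENNReal.ofReal (‖grad w‖ ^ 2) := by
    rw [← eLpNorm_two_sq, ENNReal.ofReal_pow (norm_nonneg _), ofReal_norm, Lp.enorm_def]
  rw [e1, e2, ← ENNReal.ofReal_add (sq_nonneg _) (sq_nonneg _), ← norm_sq_H1,
    ← eLpNorm_two_sq, ← ENNReal.ofReal_toReal hC, ← ENNReal.ofReal_mul ENNReal.toReal_nonneg] at h1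
  have h2 : ENNReal.ofReal (C.toReal * ‖w‖ ^ 2) =
      ENNReal.ofReal (Real.sqrt C.toReal * ‖w‖) ^ 2 := by
    rw [← ENNReal.ofReal_pow (by positivity), mul_pow, Real.sq_sqrt ENNReal.toReal_nonneg]
  rw [h2] at h1
  exact (ENNReal.pow_le_pow_left_iff two_ne_zero).1 h1

section

variable {Ω : Set (Sp d)}

theorem aestronglyMeasurable_surf {f : Sp d → ℝ} (hf : ContinuousOn f (closure Ω)) :
    AEStronglyMeasurable f (surf Ω) :=
  (hf.mono frontier_subset_closure).aestronglyMeasurable isClosed_frontier.measurableSet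

theorem memLp_surf {C : ℝ} (hC : TraceBound Ω C) {w : H1 Ω} {f : Sp d → ℝ}
    (hf : ContinuousOn f (closure Ω)) (hwf : fn w =ᵐ[volume.restrict Ω] f) :
    MemLp f 2 (surf Ω) :=
  ⟨aestronglyMeasurable_surf hf, (hC w f hf hwf).trans_lt ENNReal.ofReal_lt_top⟩

theorem isTrace_of_continuousOn {C : ℝ} (hC : TraceBound Ω C) {w : H1 Ω} {f : Sp d → ℝ}
    (hf : ContinuousOn f (closure Ω)) (hwf : fn w =ᵐ[volume.restrict Ω] f) :
    IsTrace w ((memLp_surf hC hf hwf).toLp f) := by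
  refine ⟨fun _ => f, fun _ => w, fun _ => hf, fun _ => hwf, tendsto_const_nhds, ?_⟩
  have h : eLpNorm (fun x => f x - (memLp_surf hC hf hwf).toLp f x) 2 (surf Ω) = 0 := by
    rw [eLpNorm_eq_zero_iff]
    · filter_upwards [(memLp_surf hC hf hwf).coeFn_toLp] with x hx
      simp [hx]
    · exact (aestronglyMeasurable_surf hf).sub (Lp.aestronglyMeasurable _)
    · norm_num
  simp [h]

theorem IsTrace.add {u u' : H1 Ω} {g g' : Lp ℝ 2 (surf Ω)} (h : IsTrace u g)
    (h' : IsTrace u' g') : IsTrace (u + u') (g + g') := by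
  obtain ⟨f, w, hf, hw, hl, ht⟩ := h
  obtain ⟨f', w', hf', hw', hl', ht'⟩ := h'
  refine ⟨fun n => f n + f' n, fun n => w n + w' n, fun n => (hf n).add (hf' n), fun n => ?_,
    hl.add hl', ?_⟩
  · rw [fn_add]
    filter_upwards [Lp.coeFn_add (fn (w n)) (fn (w' n)), hw n, hw' n] with x h1 h2 h3
    rw [h1, Pi.add_apply, Pi.add_apply, h2, h3]
  · have hsum : Tendsto (fun n => eLpNorm (fun x => f n x - g x) 2 (surf Ω) +
        eLpNorm (fun x => f' n x - g' x) 2 (surf Ω)) atTop (𝓝 0) := by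
      simpa using ht.add ht'
    refine tendsto_of_tendsto_of_tendsto_of_le_of_le tendsto_const_nhds hsum
      (fun n => zero_le) fun n => ?_
    calc eLpNorm (fun x => (f n + f' n) x - (g + g' : Lp ℝ 2 (surf Ω)) x) 2 (surf Ω)
        = eLpNorm ((fun x => f n x - g x) + fun x => f' n x - g' x) 2 (surf Ω) := by
          refine eLpNorm_congr_ae ?_
          filter_upwards [Lp.coeFn_add g g'] with x hx
          simp only [hx, Pi.add_apply]; ring
      _ ≤ _ := eLpNorm_add_le ((aestronglyMeasurable_surf (hf n)).sub (Lp.aestronglyMeasurable _))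
          ((aestronglyMeasurable_surf (hf' n)).sub (Lp.aestronglyMeasurable _)) (by norm_num)

theorem IsTrace.smul {u : H1 Ω} {g : Lp ℝ 2 (surf Ω)} (h : IsTrace u g) (c : ℝ) :
    IsTrace (c • u) (c • g) := by
  obtain ⟨f, w, hf, hw, hl, ht⟩ := h
  refine ⟨fun n => c • f n, fun n => c • w n, fun n => (hf n).const_smul c, fun n => ?_,
    hl.const_smul c, ?_⟩
  · rw [fn_smul]
    filter_upwards [Lp.coeFn_smul c (fn (w n)), hw n] with x h1 h2
    rw [h1, Pi.smul_apply, Pi.smul_apply, h2]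
  · have hc : Tendsto (fun n => ‖c‖ₑ * eLpNorm (fun x => f n x - g x) 2 (surf Ω)) atTop (𝓝 0) := by
      simpa using ENNReal.Tendsto.const_mul ht (Or.inr (enorm_ne_top (x := c)))
    refine hc.congr fun n => ?_
    rw [← eLpNorm_const_smul]
    refine eLpNorm_congr_ae ?_
    filter_upwards [Lp.coeFn_smul c g] with x hx
    simp only [hx, Pi.smul_apply, smul_eq_mul]; ring

theorem IsTrace.norm_le {C : ℝ} (hC0 : 0 ≤ C) (hC : TraceBound Ω C) {u : H1 Ω}
    {g : Lp ℝ 2 (surf Ω)} (h : IsTrace u g) : ‖g‖ ≤ C * ‖u‖ := by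
  obtain ⟨f, w, hf, hw, hl, ht⟩ := h
  have hb : ∀ n, ‖g‖ₑ ≤ ENNReal.ofReal (C * ‖w n‖) +
      eLpNorm (fun x => f n x - g x) 2 (surf Ω) := by
    intro n
    rw [Lp.enorm_def]
    have e : (g : Sp d → ℝ) = f n - fun x => f n x - g x := by funext x; simp
    calc eLpNorm g 2 (surf Ω) = eLpNorm (f n - fun x => f n x - g x) 2 (surf Ω) := by rw [← e]
      _ ≤ eLpNorm (f n) 2 (surf Ω) + eLpNorm (fun x => f n x - g x) 2 (surf Ω) :=
          eLpNorm_sub_le (aestronglyMeasurable_surf (hf n))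
            ((aestronglyMeasurable_surf (hf n)).sub (Lp.aestronglyMeasurable _)) (by norm_num)
      _ ≤ _ := by gcongr; exact hC _ _ (hf n) (hw n)
  have hlim : Tendsto (fun n => ENNReal.ofReal (C * ‖w n‖) +
      eLpNorm (fun x => f n x - g x) 2 (surf Ω)) atTop (𝓝 (ENNReal.ofReal (C * ‖u‖) + 0)) :=
    (ENNReal.tendsto_ofReal (hl.norm.const_mul C)).add ht
  have := ge_of_tendsto' hlim hb
  rw [add_zero, ← ofReal_norm, ENNReal.ofReal_le_ofReal_iff (by positivity)] at this
  exact this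

theorem IsTrace.unique {C : ℝ} (hC0 : 0 ≤ C) (hC : TraceBound Ω C) {u : H1 Ω}
    {g g' : Lp ℝ 2 (surf Ω)} (h : IsTrace u g) (h' : IsTrace u g') : g = g' := by
  have h1 := (h.add (h'.smul (-1))).norm_le hC0 hC
  have e1 : u + (-1 : ℝ) • u = 0 := by module
  have e2 : g + (-1 : ℝ) • g' = g - g' := by module
  rw [e1, e2, norm_zero, mul_zero] at h1
  exact sub_eq_zero.1 (norm_le_zero_iff.1 h1)

theorem isTrace_trace {u : H1 Ω} (h : ∃ g, IsTrace u g) : IsTrace u (trace u) := by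
  rw [trace, dif_pos h]
  exact h.choose_spec

theorem IsTrace.trace_eq {C : ℝ} (hC0 : 0 ≤ C) (hC : TraceBound Ω C) {u : H1 Ω}
    {g : Lp ℝ 2 (surf Ω)} (h : IsTrace u g) : trace u = g :=
  (isTrace_trace ⟨g, h⟩).unique hC0 hC h

/-- Limits in `H¹(Ω)` of functions with a trace have a trace: the traces form a Cauchy sequence, and
a diagonal choice of the approximations realizes its limit. -/
theorem exists_isTrace_of_tendsto {C : ℝ} (hC0 : 0 ≤ C) (hC : TraceBound Ω C) {u : ℕ → H1 Ω}
    {v : H1 Ω} (hu : ∀ n, ∃ g, IsTrace (u n) g) (hlim : Tendsto u atTop (𝓝 v)) :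
    ∃ g, IsTrace v g := by
  choose g hg using hu
  have hcauchy : CauchySeq g := by
    rw [Metric.cauchySeq_iff']
    intro ε hε
    obtain ⟨N, hN⟩ := Metric.cauchySeq_iff'.1 hlim.cauchySeq (ε / (C + 1)) (by positivity)
    refine ⟨N, fun n hn => ?_⟩
    have h1 := ((hg n).add ((hg N).smul (-1))).norm_le hC0 hC
    have e1 : u n + (-1 : ℝ) • u N = u n - u N := by module
    have e2 : g n + (-1 : ℝ) • g N = g n - g N := by module
    rw [e1, e2, ← dist_eq_norm, ← dist_eq_norm] at h1
    have h2 := hN n hn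
    rw [lt_div_iff₀ (by positivity)] at h2
    nlinarith [dist_nonneg (x := u n) (y := u N)]
  obtain ⟨G, hG⟩ := cauchySeq_tendsto_of_complete hcauchy
  have happ : ∀ n : ℕ, ∃ (f : Sp d → ℝ) (w : H1 Ω), ContinuousOn f (closure Ω) ∧
      fn w =ᵐ[volume.restrict Ω] f ∧ dist w (u n) < 1 / ((n : ℝ) + 1) ∧
      eLpNorm (fun x => f x - g n x) 2 (surf Ω) < ENNReal.ofReal (1 / ((n : ℝ) + 1)) := by
    intro n
    obtain ⟨f, w, hf, hw, hl, ht⟩ := hg n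
    have hpos : 0 < 1 / ((n : ℝ) + 1) := by positivity
    obtain ⟨m, hm1, hm2⟩ := ((Metric.tendsto_nhds.1 hl _ hpos).and
      (ht.eventually_lt_const (ENNReal.ofReal_pos.2 hpos))).exists
    exact ⟨f m, w m, hf m, hw m, hm1, hm2⟩
  choose f w hf hw hd hn using happ
  refine ⟨G, f, w, hf, hw, ?_, ?_⟩
  · have h0 : Tendsto (fun n => dist (w n) (u n)) atTop (𝓝 0) :=
      squeeze_zero (fun _ => dist_nonneg) (fun n => (hd n).le)
        tendsto_one_div_add_atTop_nhds_zero_nat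
    exact (tendsto_iff_of_dist h0).2 hlim
  · have h1 : Tendsto (fun n : ℕ => ENNReal.ofReal (1 / ((n : ℝ) + 1)) + ‖g n - G‖ₑ) atTop
        (𝓝 0) := by
      have h2 := ENNReal.tendsto_ofReal (tendsto_one_div_add_atTop_nhds_zero_nat (𝕜 := ℝ))
      have h3 := (hG.sub_const G).enorm
      rw [sub_self, enorm_zero] at h3
      simpa using h2.add h3
    refine tendsto_of_tendsto_of_tendsto_of_le_of_le tendsto_const_nhds h1 (fun n => zero_le)
      fun n => ?_
    calc eLpNorm (fun x => f n x - G x) 2 (surf Ω)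
        = eLpNorm ((fun x => f n x - g n x) + ⇑(g n - G)) 2 (surf Ω) := by
          refine eLpNorm_congr_ae ?_
          filter_upwards [Lp.coeFn_sub (g n) G] with x hx
          rw [Pi.add_apply, hx, Pi.sub_apply, sub_add_sub_cancel]
      _ ≤ eLpNorm (fun x => f n x - g n x) 2 (surf Ω) +
            eLpNorm (⇑(g n - G)) 2 (surf Ω) :=
          eLpNorm_add_le ((aestronglyMeasurable_surf (hf n)).sub (Lp.aestronglyMeasurable _))
            (Lp.aestronglyMeasurable _) (by norm_num)
      _ ≤ _ := by
          rw [Lp.enorm_def]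
          gcongr
          exact (hn n).le

/-- The subspace of the functions in `H¹(Ω)` which have a trace. A trace inequality makes the trace
linear and bounded on it, so it can be used without showing that it is all of `H¹(Ω)`. -/
def hasTrace (Ω : Set (Sp d)) : Submodule ℝ (H1 Ω) where
  carrier := {u | ∃ g, IsTrace u g}
  zero_mem' := by
    refine ⟨0, fun _ => 0, fun _ => 0, fun _ => continuousOn_const, fun _ => ?_,
      tendsto_const_nhds, ?_⟩
    · exact Lp.coeFn_zero _ _ _
    · have h0 : eLpNorm (fun x => 0 - (0 : Lp ℝ 2 (surf Ω)) x) 2 (surf Ω) = 0 := by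
        rw [← eLpNorm_zero (p := 2) (μ := surf Ω) (α := Sp d) (ε := ℝ)]
        refine eLpNorm_congr_ae ?_
        filter_upwards [Lp.coeFn_zero ℝ 2 (surf Ω)] with x hx
        rw [hx, Pi.zero_apply, sub_zero]
      exact (tendsto_const_nhds (x := (0 : ℝ≥0∞))).congr fun n => h0.symm
  add_mem' := fun ⟨_, h⟩ ⟨_, h'⟩ => ⟨_, h.add h'⟩
  smul_mem' := fun c _ ⟨_, h⟩ => ⟨_, h.smul c⟩

theorem isClosed_hasTrace {C : ℝ} (hC0 : 0 ≤ C) (hC : TraceBound Ω C) :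
    IsClosed (hasTrace Ω : Set (H1 Ω)) := by
  refine isSeqClosed_iff_isClosed.1 fun u v hu hlim => ?_
  exact exists_isTrace_of_tendsto hC0 hC hu hlim

theorem trace_add {C : ℝ} (hC0 : 0 ≤ C) (hC : TraceBound Ω C) {u v : H1 Ω}
    (hu : u ∈ hasTrace Ω) (hv : v ∈ hasTrace Ω) : trace (u + v) = trace u + trace v :=
  ((isTrace_trace hu).add (isTrace_trace hv)).trace_eq hC0 hC

theorem trace_smul {C : ℝ} (hC0 : 0 ≤ C) (hC : TraceBound Ω C) (c : ℝ) {u : H1 Ω}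
    (hu : u ∈ hasTrace Ω) : trace (c • u) = c • trace u :=
  ((isTrace_trace hu).smul c).trace_eq hC0 hC

theorem norm_trace_le {C : ℝ} (hC0 : 0 ≤ C) (hC : TraceBound Ω C) {u : H1 Ω}
    (hu : u ∈ hasTrace Ω) : ‖trace u‖ ≤ C * ‖u‖ :=
  (isTrace_trace hu).norm_le hC0 hC

theorem trace_const {C : ℝ} (hC0 : 0 ≤ C) (hC : TraceBound Ω C) {u : H1 Ω} {c : ℝ}
    (hu : ∀ᵐ x ∂(volume.restrict Ω), fn u x = c) : trace u =ᵐ[surf Ω] fun _ => c := by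
  have hf : ContinuousOn (fun _ : Sp d => c) (closure Ω) := continuousOn_const
  rw [(isTrace_of_continuousOn hC hf hu).trace_eq hC0 hC]
  exact (memLp_surf hC hf hu).coeFn_toLp

end

/-! ### Coercive forms and Galerkin approximation -/

section Galerkin

variable {H : Type*} [NormedAddCommGroup H] [InnerProductSpace ℝ H]

/-- `a` is a bilinear form on the subspace `Y`, bounded by `M` and coercive with constant `m`. The
values of `a` off `Y` are irrelevant. -/
structure IsCoerciveForm (a : H → H → ℝ) (Y : Submodule ℝ H) (m M : ℝ) : Prop where
  add_left : ∀ u ∈ Y, ∀ v ∈ Y, ∀ w ∈ Y, a (u + v) w = a u w + a v w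
  smul_left : ∀ (c : ℝ), ∀ u ∈ Y, ∀ w ∈ Y, a (c • u) w = c * a u w
  add_right : ∀ u ∈ Y, ∀ v ∈ Y, ∀ w ∈ Y, a u (v + w) = a u v + a u w
  smul_right : ∀ (c : ℝ), ∀ u ∈ Y, ∀ w ∈ Y, a u (c • w) = c * a u w
  bound : ∀ u ∈ Y, ∀ v ∈ Y, |a u v| ≤ M * ‖u‖ * ‖v‖
  coercive : ∀ u ∈ Y, m * ‖u‖ ^ 2 ≤ a u u

theorem IsCoerciveForm.sub_left {a : H → H → ℝ} {Y : Submodule ℝ H} {m M : ℝ}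
    (h : IsCoerciveForm a Y m M) {u v w : H} (hu : u ∈ Y) (hv : v ∈ Y) (hw : w ∈ Y) :
    a (u - v) w = a u w - a v w := by
  have e : u - v = u + (-1 : ℝ) • v := by module
  rw [e, h.add_left u hu _ (Y.smul_mem _ hv) w hw, h.smul_left _ v hv w hw]
  ring

/-- The Lax–Milgram theorem on a complete subspace. -/
theorem IsCoerciveForm.existsUnique {a : H → H → ℝ} {Y : Submodule ℝ H} {m M : ℝ}
    (h : IsCoerciveForm a Y m M) (hm : 0 < m) (S : Submodule ℝ H) [CompleteSpace S] (hS : S ≤ Y)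
    (ℓ : H →L[ℝ] ℝ) : ∃! w, w ∈ S ∧ ∀ v ∈ S, a w v = ℓ v := by
  let B₀ : S →ₗ[ℝ] S →ₗ[ℝ] ℝ := LinearMap.mk₂ ℝ (fun u v : S => a u v)
    (fun u v w => h.add_left u (hS u.2) v (hS v.2) w (hS w.2))
    (fun c u w => h.smul_left c u (hS u.2) w (hS w.2))
    (fun u v w => h.add_right u (hS u.2) v (hS v.2) w (hS w.2))
    (fun c u w => h.smul_right c u (hS u.2) w (hS w.2))
  let B : S →L[ℝ] S →L[ℝ] ℝ := B₀.mkContinuous₂ M fun u v => h.bound u (hS u.2) v (hS v.2)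
  have hB : ∀ u v : S, B u v = a u v := fun u v => rfl
  have hco : IsCoercive B := ⟨m, hm, fun u => by
    have := h.coercive u (hS u.2)
    rw [hB]
    rw [Submodule.coe_norm]
    linarith [sq (‖(u : H)‖)]⟩
  set f : S := (InnerProductSpace.toDual ℝ S).symm (ℓ.comp S.subtypeL) with hf
  have hfv : ∀ v : S, inner ℝ f v = ℓ v := fun v => by
    rw [hf, InnerProductSpace.toDual_symm_apply]; rfl
  set w : S := hco.continuousLinearEquivOfBilin.symm f with hw
  have hwv : ∀ v ∈ S, a w v = ℓ v := fun v hv => by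
    have := hco.continuousLinearEquivOfBilin_apply w ⟨v, hv⟩
    rw [hw, ContinuousLinearEquiv.apply_symm_apply, hfv, ← hw, hB] at this
    exact this.symm
  refine ⟨w, ⟨w.2, hwv⟩, ?_⟩
  · rintro w' ⟨hw'S, hw'⟩
    have hd : (w' - w) ∈ S := S.sub_mem hw'S w.2
    have h1 := h.coercive _ (hS hd)
    rw [h.sub_left (hS hw'S) (hS w.2) (hS hd), hw' _ hd] at h1
    rw [hwv _ hd, sub_self] at h1
    have h3 : ‖w' - w‖ = 0 := by
      by_contra hne
      have : 0 < ‖w' - w‖ := lt_of_le_of_ne (norm_nonneg _) (Ne.symm hne)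
      nlinarith [pow_pos this 2]
    exact sub_eq_zero.1 (norm_eq_zero.1 h3)

/-- A point in the closure of an increasing union is the limit of a sequence whose `n`-th member
lies in the `n`-th set. -/
theorem exists_seq_of_mem_closure_iUnion {X : Type*} [PseudoMetricSpace X] {S : ℕ → Set X}
    (hS : Monotone S) (hne : (S 0).Nonempty) {x : X} (hx : x ∈ closure (⋃ n, S n)) :
    ∃ v : ℕ → X, (∀ n, v n ∈ S n) ∧ Tendsto v atTop (𝓝 x) := by
  have hne' : ∀ n, (S n).Nonempty := fun n => hne.mono (hS (Nat.zero_le n))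
  have hex : ∀ n : ℕ, ∃ y ∈ S n, dist x y < Metric.infDist x (S n) + 1 / ((n : ℝ) + 1) := fun n =>
    (Metric.infDist_lt_iff (hne' n)).1 (by
      have : 0 < 1 / ((n : ℝ) + 1) := by positivity
      linarith)
  choose v hv hd using hex
  refine ⟨v, hv, ?_⟩
  rw [tendsto_iff_dist_tendsto_zero, Metric.tendsto_atTop]
  intro ε hε
  obtain ⟨y, hy, hxy⟩ := Metric.mem_closure_iff.1 hx (ε / 2) (by positivity)
  obtain ⟨N, hN⟩ := Set.mem_iUnion.1 hy
  obtain ⟨N', hN'⟩ := Metric.tendsto_atTop.1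
    (tendsto_one_div_add_atTop_nhds_zero_nat (𝕜 := ℝ)) (ε / 2) (by positivity)
  refine ⟨max N N', fun n hn => ?_⟩
  have h1 : Metric.infDist x (S n) ≤ dist x y :=
    Metric.infDist_le_dist_of_mem (hS (le_of_max_le_left hn) hN)
  have h2 := hN' n (le_of_max_le_right hn)
  rw [Real.dist_eq, sub_zero] at h2 ⊢
  rw [abs_of_nonneg dist_nonneg, dist_comm]
  linarith [hd n, le_abs_self (1 / ((n : ℝ) + 1))]

/-- Convergence of Galerkin approximations: the forms may vary along with the subspaces, as long as
they converge in the first argument `w`, uniformly in the second argument on bounded sets. -/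
theorem tendsto_galerkin {a : ℕ → H → H → ℝ} {b : H → H → ℝ} {Y : Submodule ℝ H} {m M : ℝ}
    (ha : ∀ n, IsCoerciveForm (a n) Y m M) (hm : 0 < m) (hM : 0 ≤ M) {S : ℕ → Submodule ℝ H}
    (hS : Monotone S) (hSY : ∀ n, S n ≤ Y) (hYc : IsClosed (Y : Set H)) {ℓ : H → ℝ}
    {w : ℕ → H} (hw : ∀ n, w n ∈ S n ∧ ∀ v ∈ S n, a n (w n) v = ℓ v)
    {x : H} (hx : x ∈ closure (⋃ n, (S n : Set H)))
    (hxs : ∀ n, ∀ v ∈ S n, b x v = ℓ v) {η : ℕ → ℝ} (hη0 : ∀ n, 0 ≤ η n)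
    (hη : Tendsto η atTop (𝓝 0))
    (hab : ∀ n, ∀ v ∈ Y, |b x v - a n x v| ≤ η n * ‖v‖) : Tendsto w atTop (𝓝 x) := by
  obtain ⟨v, hvS, hvx⟩ := exists_seq_of_mem_closure_iUnion (S := fun n => (S n : Set H))
    (fun i j hij => hS hij) ⟨0, (S 0).zero_mem⟩ hx
  have hxY : x ∈ Y := closure_minimal (Set.iUnion_subset fun n => hSY n) hYc hx
  -- coercivity, tested with the difference of `w n` and the approximation `v n` of `x`
  have hkey : ∀ n, ‖w n - v n‖ ≤ (η n + M * ‖x - v n‖) / m := by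
    intro n
    have hd : w n - v n ∈ S n := (S n).sub_mem (hw n).1 (hvS n)
    have hdY := hSY n hd
    have hvY := hSY n (hvS n)
    have h1 := (ha n).coercive _ hdY
    have h2 : a n (w n - v n) (w n - v n) =
        (b x (w n - v n) - a n x (w n - v n)) + a n (x - v n) (w n - v n) := by
      rw [(ha n).sub_left (hSY n (hw n).1) hvY hdY, (ha n).sub_left hxY hvY hdY, (hw n).2 _ hd,
        hxs n _ hd]
      ring
    have h3 := (le_abs_self _).trans (hab n _ hdY)
    have h4 := (le_abs_self _).trans ((ha n).bound _ (Y.sub_mem hxY hvY) _ hdY)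
    have h5 : m * ‖w n - v n‖ ^ 2 ≤ (η n + M * ‖x - v n‖) * ‖w n - v n‖ := by
      rw [h2] at h1
      linarith
    rw [le_div_iff₀ hm]
    rcases (norm_nonneg (w n - v n)).eq_or_lt with h0 | h0
    · rw [← h0, zero_mul]
      have := hη0 n
      positivity
    · nlinarith
  have hz : Tendsto (fun n => (η n + M * ‖x - v n‖) / m) atTop (𝓝 0) := by
    have h1 : Tendsto (fun n => ‖x - v n‖) atTop (𝓝 0) := by
      have := (tendsto_const_nhds (x := x)).sub hvx
      simpa using this.norm
    simpa using (hη.add (h1.const_mul M)).div_const m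
  have hwv : Tendsto (fun n => w n - v n) atTop (𝓝 0) :=
    squeeze_zero_norm hkey hz
  simpa using hwv.add hvx

end Galerkin

/-! ### The form of the complete electrode model -/

section Form

variable {Ω : Set (Sp d)}

theorem norm_sq_HH (w : HH Ω L) : ‖w‖ ^ 2 = ‖w.fst‖ ^ 2 + ‖volt w‖ ^ 2 :=
  WithLp.prod_norm_sq_eq_of_L2 w

theorem norm_fst_HH_le (w : HH Ω L) : ‖w.fst‖ ≤ ‖w‖ := by
  have := norm_sq_HH w
  exact abs_le_of_sq_le_sq' (by nlinarith [sq_nonneg ‖volt w‖]) (norm_nonneg _) |>.2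

theorem norm_volt_le (w : HH Ω L) : ‖volt w‖ ≤ ‖w‖ := by
  have := norm_sq_HH w
  exact abs_le_of_sq_le_sq' (by nlinarith [sq_nonneg ‖w.fst‖]) (norm_nonneg _) |>.2

/-- The projection `(u, U) ↦ u` as a bounded operator. -/
noncomputable def potL (Ω : Set (Sp d)) (L : ℕ) : HH Ω L →L[ℝ] H1 Ω :=
  WithLp.fstL 2 ℝ (H1 Ω) (RDiamond L)

/-- The projection `(u, U) ↦ U` as a bounded operator. -/
noncomputable def voltL (Ω : Set (Sp d)) (L : ℕ) : HH Ω L →L[ℝ] EuclideanSpace ℝ (Fin L) :=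
  (RDiamond L).subtypeL.comp (WithLp.sndL 2 ℝ (H1 Ω) (RDiamond L))

theorem volt_add (w w' : HH Ω L) : volt (w + w') = volt w + volt w' := map_add (voltL Ω L) w w'

theorem volt_smul (c : ℝ) (w : HH Ω L) : volt (c • w) = c • volt w := map_smul (voltL Ω L) c w

/-- The pairs `(u, U)` for which `u` has a trace. -/
noncomputable def hasTraceHH (Ω : Set (Sp d)) (L : ℕ) : Submodule ℝ (HH Ω L) :=
  (hasTrace Ω).comap (potL Ω L : HH Ω L →ₗ[ℝ] H1 Ω)

variable {c₀ c₁ : ℝ} {σ : H1 Ω}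

theorem norm_fn_le_of_admissible (hc₀ : 0 < c₀) (hσ : σ ∈ admissible Ω c₀ c₁) :
    ∀ᵐ x ∂(volume.restrict Ω), ‖fn σ x‖ ≤ c₁ := by
  filter_upwards [hσ] with x hx
  rw [Real.norm_eq_abs, abs_of_nonneg (hc₀.le.trans hx.1)]
  exact hx.2

theorem memLp_admissible_smul (hc₀ : 0 < c₀) (hσ : σ ∈ admissible Ω c₀ c₁) (g : L2vec Ω) :
    MemLp (fun x => fn σ x • g x) 2 (volume.restrict Ω) := by
  refine (Lp.memLp g).of_le_mul (c := c₁)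
    ((Lp.aestronglyMeasurable (fn σ)).smul (Lp.aestronglyMeasurable g)) ?_
  filter_upwards [norm_fn_le_of_admissible hc₀ hσ] with x hx
  rw [norm_smul]
  gcongr

/-- The current density `σ g`, for an admissible conductivity `σ` and a vector field `g`. -/
noncomputable def flux (hc₀ : 0 < c₀) (hσ : σ ∈ admissible Ω c₀ c₁) (g : L2vec Ω) : L2vec Ω :=
  (memLp_admissible_smul hc₀ hσ g).toLp _

theorem coeFn_flux (hc₀ : 0 < c₀) (hσ : σ ∈ admissible Ω c₀ c₁) (g : L2vec Ω) :
    flux hc₀ hσ g =ᵐ[volume.restrict Ω] fun x => fn σ x • g x :=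
  (memLp_admissible_smul hc₀ hσ g).coeFn_toLp

theorem flux_add (hc₀ : 0 < c₀) (hσ : σ ∈ admissible Ω c₀ c₁) (g h : L2vec Ω) :
    flux hc₀ hσ (g + h) = flux hc₀ hσ g + flux hc₀ hσ h := by
  refine Lp.ext ?_
  filter_upwards [coeFn_flux hc₀ hσ (g + h), coeFn_flux hc₀ hσ g, coeFn_flux hc₀ hσ h,
    Lp.coeFn_add g h, Lp.coeFn_add (flux hc₀ hσ g) (flux hc₀ hσ h)] with x h1 h2 h3 h4 h5
  rw [h1, h5, Pi.add_apply, h2, h3, h4, Pi.add_apply, smul_add]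

theorem flux_smul (hc₀ : 0 < c₀) (hσ : σ ∈ admissible Ω c₀ c₁) (c : ℝ) (g : L2vec Ω) :
    flux hc₀ hσ (c • g) = c • flux hc₀ hσ g := by
  refine Lp.ext ?_
  filter_upwards [coeFn_flux hc₀ hσ (c • g), coeFn_flux hc₀ hσ g,
    Lp.coeFn_smul c g, Lp.coeFn_smul c (flux hc₀ hσ g)] with x h1 h2 h3 h4
  rw [h1, h4, Pi.smul_apply, h2, h3, Pi.smul_apply, smul_comm]

theorem norm_flux_le (hc₀ : 0 < c₀) (hσ : σ ∈ admissible Ω c₀ c₁) (g : L2vec Ω) :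
    ‖flux hc₀ hσ g‖ ≤ c₁ * ‖g‖ := by
  refine Lp.norm_le_mul_norm_of_ae_le_mul ?_
  filter_upwards [coeFn_flux hc₀ hσ g, norm_fn_le_of_admissible hc₀ hσ] with x h1 h2
  rw [h1, norm_smul]
  gcongr

theorem integral_inner_eq_flux (hc₀ : 0 < c₀) (hσ : σ ∈ admissible Ω c₀ c₁) (g h : L2vec Ω) :
    ∫ x in Ω, fn σ x * inner ℝ (g x) (h x) = inner ℝ (flux hc₀ hσ g) h := by
  rw [L2.inner_def]
  refine integral_congr_ae ?_
  filter_upwards [coeFn_flux hc₀ hσ g] with x hx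
  rw [hx, real_inner_smul_left]

theorem le_inner_flux (hc₀ : 0 < c₀) (hσ : σ ∈ admissible Ω c₀ c₁) (g : L2vec Ω) :
    c₀ * ‖g‖ ^ 2 ≤ inner ℝ (flux hc₀ hσ g) g := by
  rw [← integral_inner_eq_flux, norm_sq_Lp_two, ← integral_const_mul]
  refine integral_mono_ae ((Lp.memLp g).norm.integrable_sq.const_mul c₀) ?_ ?_
  · refine (L2.integrable_inner (𝕜 := ℝ) (flux hc₀ hσ g) g).congr ?_
    filter_upwards [coeFn_flux hc₀ hσ g] with x hx
    rw [hx, real_inner_smul_left]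
  · filter_upwards [hσ] with x hx
    rw [real_inner_self_eq_norm_sq]
    gcongr
    exact hx.1

/-- If admissible conductivities converge almost everywhere, then so do the current densities of a
fixed vector field, in `L²`. -/
theorem tendsto_flux (hc₀ : 0 < c₀) {σk : ℕ → H1 Ω} (hσk : ∀ n, σk n ∈ admissible Ω c₀ c₁)
    (hσ : σ ∈ admissible Ω c₀ c₁)
    (hlim : ∀ᵐ x ∂(volume.restrict Ω), Tendsto (fun n => fn (σk n) x) atTop (𝓝 (fn σ x)))
    (g : L2vec Ω) : Tendsto (fun n => flux hc₀ (hσk n) g) atTop (𝓝 (flux hc₀ hσ g)) := by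
  rw [tendsto_iff_norm_sub_tendsto_zero]
  have hsq : Tendsto (fun n => ‖flux hc₀ (hσk n) g - flux hc₀ hσ g‖ ^ 2) atTop (𝓝 0) := by
    simp_rw [norm_sq_Lp_two]
    have hae : ∀ n, (fun x => ‖(flux hc₀ (hσk n) g - flux hc₀ hσ g) x‖ ^ 2)
        =ᵐ[volume.restrict Ω] fun x => (fn (σk n) x - fn σ x) ^ 2 * ‖g x‖ ^ 2 := fun n => by
      filter_upwards [coeFn_flux hc₀ hσ g, coeFn_flux hc₀ (hσk n) g,
        Lp.coeFn_sub (flux hc₀ (hσk n) g) (flux hc₀ hσ g)] with x h1 h2 h3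
      rw [h3, Pi.sub_apply, h1, h2, ← sub_smul, norm_smul, mul_pow, Real.norm_eq_abs, sq_abs]
    simp_rw [fun n => integral_congr_ae (hae n)]
    have h0 : (0 : ℝ) = ∫ _x in Ω, (0 : ℝ) := by simp
    rw [h0]
    refine tendsto_integral_of_dominated_convergence (fun x => (2 * c₁) ^ 2 * ‖g x‖ ^ 2)
      (fun n => ?_) ((Lp.memLp g).norm.integrable_sq.const_mul _) (fun n => ?_) ?_
    · exact (((Lp.aestronglyMeasurable _).sub (Lp.aestronglyMeasurable _)).pow 2).mul
        ((Lp.aestronglyMeasurable g).norm.pow 2)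
    · filter_upwards [hσ, hσk n] with x h1 h2
      rw [Real.norm_of_nonneg (by positivity)]
      have : |fn (σk n) x - fn σ x| ≤ 2 * c₁ := by
        rw [abs_le]; constructor <;> linarith [h1.1, h1.2, h2.1, h2.2]
      rw [← sq_abs]
      gcongr
    · filter_upwards [hlim] with x hx
      have : Tendsto (fun n => (fn (σk n) x - fn σ x) ^ 2 * ‖g x‖ ^ 2) atTop
          (𝓝 ((fn σ x - fn σ x) ^ 2 * ‖g x‖ ^ 2)) := ((hx.sub_const _).pow 2).mul_const _
      simpa using this
  have := hsq.sqrt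
  simpa [Real.sqrt_sq (norm_nonneg _)] using this

variable [IsFiniteMeasure (surf Ω)] {e : Fin L → Set (Sp d)} {z : Fin L → ℝ}

/-- The voltage drop `u - U_l` across the contact at the electrode `l`. -/
noncomputable def drop (e : Fin L → Set (Sp d)) (l : Fin L) (w : HH Ω L) :
    Lp ℝ 2 ((surf Ω).restrict (e l)) :=
  LpToLpRestrictCLM (Sp d) ℝ ℝ (surf Ω) 2 (e l) (trace w.fst) -
    Lp.constL 2 ((surf Ω).restrict (e l)) ℝ (volt w l)

theorem coeFn_drop (l : Fin L) (w : HH Ω L) :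
    drop e l w =ᵐ[(surf Ω).restrict (e l)] fun x => trace w.fst x - volt w l := by
  filter_upwards [Lp.coeFn_sub (LpToLpRestrictCLM (Sp d) ℝ ℝ (surf Ω) 2 (e l) (trace w.fst))
      (Lp.constL 2 ((surf Ω).restrict (e l)) ℝ (volt w l)),
    LpToLpRestrictCLM_coeFn ℝ (e l) (trace w.fst),
    Lp.coeFn_const 2 ((surf Ω).restrict (e l)) (volt w l)] with x h1 h2 h3
  rw [drop, h1, Pi.sub_apply, h2]
  congr 1

theorem drop_add {C : ℝ} (hC0 : 0 ≤ C) (hC : TraceBound Ω C) (l : Fin L) {w w' : HH Ω L}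
    (hw : w ∈ hasTraceHH Ω L) (hw' : w' ∈ hasTraceHH Ω L) :
    drop e l (w + w') = drop e l w + drop e l w' := by
  have h1 : trace (w + w').fst = trace w.fst + trace w'.fst := trace_add hC0 hC hw hw'
  have h2 : volt (w + w') l = volt w l + volt w' l := by rw [volt_add, PiLp.add_apply]
  rw [drop, drop, drop, h1, h2, map_add, map_add]
  abel

theorem drop_smul {C : ℝ} (hC0 : 0 ≤ C) (hC : TraceBound Ω C) (l : Fin L) (c : ℝ) {w : HH Ω L}
    (hw : w ∈ hasTraceHH Ω L) : drop e l (c • w) = c • drop e l w := by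
  have h1 : trace (c • w).fst = c • trace w.fst := trace_smul hC0 hC c hw
  have h2 : volt (c • w) l = c • volt w l := by rw [volt_smul, PiLp.smul_apply]
  rw [drop, drop, h1, h2, map_smul, map_smul, smul_sub]

theorem exists_norm_drop_le {C : ℝ} (hC0 : 0 ≤ C) (hC : TraceBound Ω C)
    (e : Fin L → Set (Sp d)) : ∃ M, 0 ≤ M ∧
      ∀ l, ∀ w ∈ hasTraceHH Ω L, ‖drop e l w‖ ≤ M * ‖w‖ := by
  refine ⟨∑ l, (‖LpToLpRestrictCLM (Sp d) ℝ ℝ (surf Ω) 2 (e l)‖ * C +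
    ‖Lp.constL 2 ((surf Ω).restrict (e l)) ℝ (E := ℝ)‖),
    Finset.sum_nonneg fun l _ => by positivity, fun l w hw => ?_⟩
  have h1 : ‖LpToLpRestrictCLM (Sp d) ℝ ℝ (surf Ω) 2 (e l) (trace w.fst)‖ ≤
      ‖LpToLpRestrictCLM (Sp d) ℝ ℝ (surf Ω) 2 (e l)‖ * (C * ‖w‖) := by
    refine (ContinuousLinearMap.le_opNorm _ _).trans ?_
    gcongr
    refine (norm_trace_le hC0 hC hw).trans ?_
    gcongr
    exact norm_fst_HH_le w
  have h2 : ‖Lp.constL 2 ((surf Ω).restrict (e l)) ℝ (volt w l)‖ ≤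
      ‖Lp.constL 2 ((surf Ω).restrict (e l)) ℝ (E := ℝ)‖ * ‖w‖ := by
    refine (ContinuousLinearMap.le_opNorm _ _).trans ?_
    gcongr
    exact (PiLp.norm_apply_le (volt w) l).trans (norm_volt_le w)
  have h3 := Finset.single_le_sum (s := Finset.univ)
    (f := fun l => ‖LpToLpRestrictCLM (Sp d) ℝ ℝ (surf Ω) 2 (e l)‖ * C +
      ‖Lp.constL 2 ((surf Ω).restrict (e l)) ℝ (E := ℝ)‖) (fun l _ => by positivity)
    (Finset.mem_univ l)
  calc ‖drop e l w‖ ≤ ‖LpToLpRestrictCLM (Sp d) ℝ ℝ (surf Ω) 2 (e l) (trace w.fst)‖ +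
        ‖Lp.constL 2 ((surf Ω).restrict (e l)) ℝ (volt w l)‖ := norm_sub_le _ _
    _ ≤ (‖LpToLpRestrictCLM (Sp d) ℝ ℝ (surf Ω) 2 (e l)‖ * C +
      ‖Lp.constL 2 ((surf Ω).restrict (e l)) ℝ (E := ℝ)‖) * ‖w‖ := by linarith
    _ ≤ _ := by gcongr

theorem aForm_eq (hc₀ : 0 < c₀) (hσ : σ ∈ admissible Ω c₀ c₁) (w w' : HH Ω L) :
    aForm e z σ w w' = inner ℝ (flux hc₀ hσ (grad w.fst)) (grad w'.fst) +
      ∑ l, (z l)⁻¹ * inner ℝ (drop e l w) (drop e l w') := by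
  rw [aForm, integral_inner_eq_flux hc₀ hσ]
  congr 1
  refine Finset.sum_congr rfl fun l _ => ?_
  congr 1
  rw [L2.inner_def]
  refine integral_congr_ae ?_
  filter_upwards [coeFn_drop (e := e) l w, coeFn_drop (e := e) l w'] with x h1 h2
  rw [h1, h2, RCLike.inner_apply, conj_trivial, mul_comm]

/-- The quadratic form obtained by replacing the conductivity by its lower bound `c₀`. -/
noncomputable def energy (e : Fin L → Set (Sp d)) (z : Fin L → ℝ) (c₀ : ℝ) (w : HH Ω L) : ℝ :=
  c₀ * ‖grad w.fst‖ ^ 2 + ∑ l, (z l)⁻¹ * ‖drop e l w‖ ^ 2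

theorem energy_le_aForm (hc₀ : 0 < c₀) (hσ : σ ∈ admissible Ω c₀ c₁)
    (w : HH Ω L) : energy e z c₀ w ≤ aForm e z σ w w := by
  rw [aForm_eq hc₀ hσ, energy]
  simp_rw [real_inner_self_eq_norm_sq]
  gcongr
  exact le_inner_flux hc₀ hσ _

theorem tendsto_of_tendsto_norm_sq {E : Type*} [NormedAddCommGroup E] {x : ℕ → E} {y : E}
    (h : Tendsto (fun n => ‖x n - y‖ ^ 2) atTop (𝓝 0)) : Tendsto x atTop (𝓝 y) := by
  rw [tendsto_iff_norm_sub_tendsto_zero]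
  have := h.sqrt
  simpa [Real.sqrt_sq (norm_nonneg _)] using this

/-- Sequences of unit vectors cannot have energy tending to zero: by compactness, the potentials
would converge to a constant, which the voltages on all electrodes approach; since the voltages sum
to zero, so is the constant. -/
theorem not_tendsto_energy_zero (hΩ : IsOpen Ω) (hb : Bornology.IsBounded Ω)
    (hconn : IsConnected Ω) (hreg : interior (closure Ω) = Ω) {𝒯 : Mesh d}
    (h𝒯 : IsTriangulation (closure Ω) 𝒯) {C : ℝ} (hC0 : 0 ≤ C) (hC : TraceBound Ω C)
    (hL : 1 ≤ L) (hepos : ∀ l, (surf Ω).restrict (e l) ≠ 0) (hz : ∀ l, 0 < z l) (hc₀ : 0 < c₀)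
    {x : ℕ → HH Ω L} (hx : ∀ n, x n ∈ hasTraceHH Ω L) (hx1 : ∀ n, ‖x n‖ = 1)
    (hE : Tendsto (fun n => energy e z c₀ (x n)) atTop (𝓝 0)) : False := by
  obtain ⟨φ, v, hφ, hv⟩ := exists_weak_subseq (fun n => (x n).fst) (M := 1)
    fun n => (norm_fst_HH_le (x n)).trans (hx1 n).le
  have hEφ := hE.comp hφ.tendsto_atTop
  have hfn := tendsto_fn_of_weak hΩ hb hreg h𝒯 (M := 1)
    (fun n => (norm_fst_HH_le (x (φ n))).trans (hx1 (φ n)).le) hv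
  have hEg : ∀ w : HH Ω L, ‖grad w.fst‖ ^ 2 ≤ energy e z c₀ w / c₀ := fun w => by
    rw [le_div_iff₀ hc₀, mul_comm, energy]
    have : 0 ≤ ∑ l, (z l)⁻¹ * ‖drop e l w‖ ^ 2 := Finset.sum_nonneg fun l _ => by
      have := hz l
      positivity
    linarith
  have hEd : ∀ (w : HH Ω L) l, ‖drop e l w‖ ^ 2 ≤ z l * energy e z c₀ w := fun w l => by
    have h1 := Finset.single_le_sum (s := Finset.univ)
      (f := fun l => (z l)⁻¹ * ‖drop e l w‖ ^ 2) (fun l _ => by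
        have := hz l
        positivity) (Finset.mem_univ l)
    have h2 : (z l)⁻¹ * ‖drop e l w‖ ^ 2 ≤ energy e z c₀ w := by
      rw [energy]
      nlinarith [sq_nonneg ‖grad w.fst‖]
    rwa [inv_mul_le_iff₀ (hz l)] at h2
  have hgrad : Tendsto (fun n => grad (x (φ n)).fst) atTop (𝓝 0) := by
    refine tendsto_of_tendsto_norm_sq (squeeze_zero (fun _ => sq_nonneg _) (fun n => ?_)
      (by simpa using hEφ.div_const c₀))
    rw [sub_zero]
    exact hEg _
  -- the gradients converge to zero strongly, and to the gradient of `v` weakly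
  have hgv : grad v = 0 := by
    have h1 := hv ((innerSL ℝ (grad v)).comp (gradL Ω))
    have h2 : Tendsto (fun n => inner ℝ (grad v) (grad (x (φ n)).fst)) atTop
        (𝓝 (inner ℝ (grad v) (0 : L2vec Ω))) := tendsto_const_nhds.inner hgrad
    have h3 := tendsto_nhds_unique h1 h2
    rw [inner_zero_right] at h3
    exact inner_self_eq_zero.1 h3
  have hu : Tendsto (fun n => (x (φ n)).fst) atTop (𝓝 v) := by
    refine tendsto_of_tendsto_norm_sq ?_
    simp_rw [norm_sq_H1, fn_sub, grad_sub, hgv, sub_zero]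
    have h1 := (tendsto_iff_norm_sub_tendsto_zero.1 hfn).pow 2
    have h2 := hgrad.norm.pow 2
    simpa using h1.add h2
  have hvT : v ∈ hasTrace Ω := (isClosed_hasTrace hC0 hC).mem_of_tendsto hu
    (Eventually.of_forall fun n => hx (φ n))
  obtain ⟨c, hc⟩ := ae_const_H1 hΩ hconn hgv
  have htr := trace_const hC0 hC hc
  have htlim : Tendsto (fun n => trace (x (φ n)).fst) atTop (𝓝 (trace v)) := by
    rw [tendsto_iff_norm_sub_tendsto_zero]
    have h1 := (tendsto_iff_norm_sub_tendsto_zero.1 hu).const_mul C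
    rw [mul_zero] at h1
    refine squeeze_zero (fun _ => norm_nonneg _) (fun n => ?_) h1
    have e1 : (x (φ n)).fst - v = (x (φ n)).fst + (-1 : ℝ) • v := by module
    have e2 : trace (x (φ n)).fst - trace v = trace ((x (φ n)).fst - v) := by
      rw [e1, trace_add hC0 hC (show (x (φ n)).fst ∈ hasTrace Ω from hx _)
        ((hasTrace Ω).smul_mem _ hvT), trace_smul hC0 hC _ hvT]
      module
    rw [e2]
    exact norm_trace_le hC0 hC ((hasTrace Ω).sub_mem (hx _) hvT)
  -- the potential converges to `c` on each electrode, and the voltage drops converge to zero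
  have hvolt : ∀ l, Tendsto (fun n => volt (x (φ n)) l) atTop (𝓝 c) := by
    intro l
    set μ := (surf Ω).restrict (e l) with hμ
    have hRc : LpToLpRestrictCLM (Sp d) ℝ ℝ (surf Ω) 2 (e l) (trace v) = Lp.constL 2 μ ℝ c := by
      refine Lp.ext ?_
      filter_upwards [LpToLpRestrictCLM_coeFn ℝ (e l) (trace v), ae_restrict_of_ae htr,
        Lp.coeFn_const 2 μ c] with x h1 h2 h3
      rw [h1, h2]
      exact h3.symm
    have hdrop : Tendsto (fun n => drop e l (x (φ n))) atTop (𝓝 0) := by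
      refine tendsto_of_tendsto_norm_sq (squeeze_zero (fun _ => sq_nonneg _) (fun n => ?_)
        (by simpa using hEφ.const_mul (z l)))
      rw [sub_zero]
      exact hEd _ l
    have hcl : Tendsto (fun n => Lp.constL 2 μ ℝ (volt (x (φ n)) l - c)) atTop (𝓝 0) := by
      have h1 := ((((LpToLpRestrictCLM (Sp d) ℝ ℝ (surf Ω) 2 (e l)).continuous.tendsto _).comp
        htlim).sub hdrop).sub_const (Lp.constL 2 μ ℝ c)
      rw [hRc, sub_zero, sub_self] at h1
      refine h1.congr fun n => ?_
      rw [map_sub, drop, Function.comp_apply, sub_sub_cancel]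
    have hne : NeZero μ := ⟨hepos l⟩
    have hpos : 0 < μ.real Set.univ ^ (1 / (2 : ℝ≥0∞).toReal) := by
      apply Real.rpow_pos_of_pos
      exact ENNReal.toReal_pos (Measure.measure_univ_ne_zero.2 (hepos l)) (measure_ne_top _ _)
    rw [tendsto_iff_norm_sub_tendsto_zero]
    have h2 := hcl.norm.div_const (μ.real Set.univ ^ (1 / (2 : ℝ≥0∞).toReal))
    rw [norm_zero, zero_div] at h2
    refine h2.congr fun n => ?_
    have h3 : ‖Lp.constL 2 μ ℝ (volt (x (φ n)) l - c)‖ =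
        ‖volt (x (φ n)) l - c‖ * μ.real Set.univ ^ (1 / (2 : ℝ≥0∞).toReal) :=
      Lp.norm_const 2 μ _ (by norm_num)
    rw [h3, mul_div_assoc, div_self hpos.ne', mul_one]
  have hc0 : c = 0 := by
    have h1 : Tendsto (fun n => ∑ l, volt (x (φ n)) l) atTop (𝓝 (∑ _l : Fin L, c)) :=
      tendsto_finsetSum _ fun l _ => hvolt l
    have h2 : ∀ n, ∑ l, volt (x (φ n)) l = 0 := fun n => (x (φ n)).snd.2
    simp_rw [h2] at h1
    have h3 := tendsto_nhds_unique h1 tendsto_const_nhds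
    simp only [Finset.sum_const, Finset.card_univ, Fintype.card_fin, nsmul_eq_mul,
      mul_eq_zero, Nat.cast_eq_zero] at h3
    rcases h3 with h3 | h3
    · omega
    · exact h3
  have hv0 : v = 0 := by
    refine H1_ext hΩ (Lp.ext ?_)
    filter_upwards [hc, Lp.coeFn_zero ℝ 2 (volume.restrict Ω)] with x h1 h2
    rw [h1, hc0]
    exact h2.symm
  have hone : Tendsto (fun n => ‖x (φ n)‖ ^ 2) atTop (𝓝 0) := by
    simp_rw [norm_sq_HH, EuclideanSpace.norm_sq_eq]
    have h1 := hu.norm.pow 2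
    have h2 : Tendsto (fun n => ∑ l, ‖volt (x (φ n)) l‖ ^ 2) atTop (𝓝 (∑ _l : Fin L, ‖c‖ ^ 2)) :=
      tendsto_finsetSum _ fun l _ => (hvolt l).norm.pow 2
    rw [hv0] at h1
    rw [hc0] at h2
    simpa using h1.add h2
  simp_rw [hx1] at hone
  have := tendsto_nhds_unique hone tendsto_const_nhds
  norm_num at this

theorem energy_smul {C : ℝ} (hC0 : 0 ≤ C) (hC : TraceBound Ω C) (c : ℝ) {w : HH Ω L}
    (hw : w ∈ hasTraceHH Ω L) : energy e z c₀ (c • w) = c ^ 2 * energy e z c₀ w := by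
  have h1 : grad (c • w).fst = c • grad w.fst := grad_smul c w.fst
  simp_rw [energy, h1, drop_smul hC0 hC _ c hw, norm_smul, mul_pow, Real.norm_eq_abs, sq_abs,
    mul_add, Finset.mul_sum]
  congr 1
  · ring
  · exact Finset.sum_congr rfl fun l _ => by ring

/-- The energy controls the norm, with a constant that does not depend on the conductivity. -/
theorem exists_coercivity (hΩ : IsOpen Ω) (hb : Bornology.IsBounded Ω)
    (hconn : IsConnected Ω) (hreg : interior (closure Ω) = Ω) {𝒯 : Mesh d}
    (h𝒯 : IsTriangulation (closure Ω) 𝒯) {C : ℝ} (hC0 : 0 ≤ C) (hC : TraceBound Ω C)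
    (hL : 1 ≤ L) (hepos : ∀ l, (surf Ω).restrict (e l) ≠ 0) (hz : ∀ l, 0 < z l) (hc₀ : 0 < c₀) :
    ∃ m, 0 < m ∧ ∀ w ∈ hasTraceHH Ω L, m * ‖w‖ ^ 2 ≤ energy e z c₀ w := by
  by_contra! hcon
  have hpos : ∀ n : ℕ, 0 < 1 / ((n : ℝ) + 1) := fun n => by positivity
  choose w hwY hw using fun n : ℕ => hcon (1 / ((n : ℝ) + 1)) (hpos n)
  have hE0 : ∀ v : HH Ω L, 0 ≤ energy e z c₀ v := fun v => by
    rw [energy]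
    have : 0 ≤ ∑ l, (z l)⁻¹ * ‖drop e l v‖ ^ 2 := Finset.sum_nonneg fun l _ => by
      have := hz l
      positivity
    positivity
  have hne : ∀ n, 0 < ‖w n‖ := fun n => by
    rcases (norm_nonneg (w n)).eq_or_lt with h | h
    · have := hw n
      rw [← h] at this
      have := hE0 (w n)
      norm_num at *
      linarith
    · exact h
  refine not_tendsto_energy_zero hΩ hb hconn hreg h𝒯 hC0 hC hL hepos hz hc₀ (e := e) (z := z)
    (c₀ := c₀) (x := fun n => ‖w n‖⁻¹ • w n) (fun n => (hasTraceHH Ω L).smul_mem _ (hwY n))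
    (fun n => ?_) ?_
  · rw [norm_smul, norm_inv, norm_norm, inv_mul_cancel₀ (hne n).ne']
  · refine squeeze_zero (fun n => hE0 _) (fun n => ?_)
      (tendsto_one_div_add_atTop_nhds_zero_nat (𝕜 := ℝ))
    rw [energy_smul hC0 hC _ (hwY n), inv_pow, inv_mul_le_iff₀ (pow_pos (hne n) 2), mul_comm]
    exact (hw n).le

/-- The forms belonging to admissible conductivities are bounded and coercive, uniformly with
respect to the conductivity. -/
theorem exists_isCoerciveForm (hΩ : IsOpen Ω) (hb : Bornology.IsBounded Ω)
    (hconn : IsConnected Ω) (hreg : interior (closure Ω) = Ω) {𝒯 : Mesh d}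
    (h𝒯 : IsTriangulation (closure Ω) 𝒯) {C : ℝ} (hC0 : 0 ≤ C) (hC : TraceBound Ω C)
    (hL : 1 ≤ L) (hepos : ∀ l, (surf Ω).restrict (e l) ≠ 0) (hz : ∀ l, 0 < z l) (hc₀ : 0 < c₀)
    (hc₁ : 0 ≤ c₁) :
    ∃ m M, 0 < m ∧ 0 ≤ M ∧ ∀ σ ∈ admissible Ω c₀ c₁,
      IsCoerciveForm (aForm e z σ) (hasTraceHH Ω L) m M := by
  obtain ⟨m, hm, hco⟩ := exists_coercivity hΩ hb hconn hreg h𝒯 hC0 hC hL hepos hz hc₀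
  obtain ⟨Md, hMd, hdrop⟩ := exists_norm_drop_le hC0 hC e
  have hz' : ∀ l, 0 < (z l)⁻¹ := fun l => inv_pos.2 (hz l)
  have hS : 0 ≤ ∑ l, (z l)⁻¹ * Md ^ 2 := Finset.sum_nonneg fun l _ => by
    have := hz' l
    positivity
  refine ⟨m, c₁ + ∑ l, (z l)⁻¹ * Md ^ 2, hm, by positivity, fun σ hσ => ?_⟩
  have hga : ∀ u v : HH Ω L, grad (u + v).fst = grad u.fst + grad v.fst :=
    fun u v => grad_add u.fst v.fst
  have hgs : ∀ (c : ℝ) (u : HH Ω L), grad (c • u).fst = c • grad u.fst :=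
    fun c u => grad_smul c u.fst
  constructor
  · intro u hu v hv w hw
    simp_rw [aForm_eq hc₀ hσ, hga, flux_add, drop_add hC0 hC _ hu hv, inner_add_left, mul_add,
      Finset.sum_add_distrib]
    ring
  · intro c u hu w hw
    simp_rw [aForm_eq hc₀ hσ, hgs, flux_smul, drop_smul hC0 hC _ c hu, real_inner_smul_left,
      mul_add, Finset.mul_sum]
    congr 1
    exact Finset.sum_congr rfl fun l _ => by ring
  · intro u hu v hv w hw
    simp_rw [aForm_eq hc₀ hσ, hga, drop_add hC0 hC _ hv hw, inner_add_right, mul_add,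
      Finset.sum_add_distrib]
    ring
  · intro c u hu w hw
    simp_rw [aForm_eq hc₀ hσ, hgs, drop_smul hC0 hC _ c hw, real_inner_smul_right,
      mul_add, Finset.mul_sum]
    congr 1
    exact Finset.sum_congr rfl fun l _ => by ring
  · intro u hu v hv
    rw [aForm_eq hc₀ hσ]
    have hg : ∀ w : HH Ω L, ‖grad w.fst‖ ≤ ‖w‖ := fun w =>
      (norm_grad_le _).trans (norm_fst_HH_le w)
    have h1 : |inner ℝ (flux hc₀ hσ (grad u.fst)) (grad v.fst)| ≤ c₁ * ‖u‖ * ‖v‖ := by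
      refine (abs_real_inner_le_norm _ _).trans ?_
      have := (norm_flux_le hc₀ hσ (grad u.fst)).trans (mul_le_mul_of_nonneg_left (hg u) hc₁)
      gcongr
      exact hg v
    have h2 : |∑ l, (z l)⁻¹ * inner ℝ (drop e l u) (drop e l v)| ≤
        (∑ l, (z l)⁻¹ * Md ^ 2) * ‖u‖ * ‖v‖ := by
      refine (Finset.abs_sum_le_sum_abs _ _).trans ?_
      rw [Finset.sum_mul, Finset.sum_mul]
      refine Finset.sum_le_sum fun l _ => ?_
      rw [abs_mul, abs_of_pos (hz' l)]
      have := hz' l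
      calc (z l)⁻¹ * |inner ℝ (drop e l u) (drop e l v)|
          ≤ (z l)⁻¹ * ((Md * ‖u‖) * (Md * ‖v‖)) := by
            gcongr
            refine (abs_real_inner_le_norm _ _).trans ?_
            exact mul_le_mul (hdrop l u hu) (hdrop l v hv) (norm_nonneg _) (by positivity)
        _ = _ := by ring
    calc _ ≤ _ := abs_add_le _ _
      _ ≤ _ := add_le_add h1 h2
      _ = _ := by ring
  · intro u hu
    exact (hco u hu).trans (energy_le_aForm hc₀ hσ u)

/-- Changing the conductivity changes the form by at most the change of the current density. -/
theorem abs_aForm_sub_le (hc₀ : 0 < c₀) {σ' : H1 Ω} (hσ : σ ∈ admissible Ω c₀ c₁)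
    (hσ' : σ' ∈ admissible Ω c₀ c₁) (w v : HH Ω L) :
    |aForm e z σ w v - aForm e z σ' w v| ≤
      ‖flux hc₀ hσ (grad w.fst) - flux hc₀ hσ' (grad w.fst)‖ * ‖v‖ := by
  rw [aForm_eq hc₀ hσ, aForm_eq hc₀ hσ', add_sub_add_right_eq_sub, ← inner_sub_left]
  refine (abs_real_inner_le_norm _ _).trans ?_
  gcongr
  exact (norm_grad_le _).trans (norm_fst_HH_le v)

end Form

/-! ### Finite element spaces and admissible sets -/

section Fem

variable {Ω : Set (Sp d)} {𝒯 𝒯' : Mesh d}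

/-- The finite element space `V_𝒯` as a subspace of `H¹(Ω)`. -/
def femSubmodule (Ω : Set (Sp d)) (𝒯 : Mesh d) : Submodule ℝ (H1 Ω) where
  carrier := femSpace Ω 𝒯
  zero_mem' := by
    refine ⟨0, continuousOn_const, fun T _ => ⟨0, fun x _ => rfl⟩, ?_⟩
    exact Lp.coeFn_zero ℝ 2 (volume.restrict Ω)
  add_mem' := by
    rintro u v ⟨f, hf, hfT, hfu⟩ ⟨g, hg, hgT, hgv⟩
    refine ⟨f + g, hf.add hg, fun T hT => ?_, ?_⟩
    · obtain ⟨p, hp⟩ := hfT T hT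
      obtain ⟨q, hq⟩ := hgT T hT
      exact ⟨p + q, fun x hx => by simp [hp x hx, hq x hx]⟩
    · rw [fn_add]
      exact (Lp.coeFn_add _ _).trans (hfu.add hgv)
  smul_mem' := by
    rintro c u ⟨f, hf, hfT, hfu⟩
    refine ⟨c • f, hf.const_smul c, fun T hT => ?_, ?_⟩
    · obtain ⟨p, hp⟩ := hfT T hT
      exact ⟨c • p, fun x hx => by simp [hp x hx]⟩
    · rw [fn_smul]
      exact (Lp.coeFn_smul _ _).trans (hfu.const_smul c)

/-- The relation between a finite element function and its values at the vertices of the simplices.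
It avoids choosing a continuous representative. -/
def nodalGraph (Ω : Set (Sp d)) (𝒯 : Mesh d) :
    Submodule ℝ (((T : 𝒯) → (T.1 → ℝ)) × H1 Ω) where
  carrier := {q | ∃ f : Sp d → ℝ, ContinuousOn f (closure Ω) ∧
    (∀ T ∈ 𝒯, ∃ p : Sp d →ᵃ[ℝ] ℝ, ∀ x ∈ convexHull ℝ (T : Set (Sp d)), f x = p x) ∧
    fn q.2 =ᵐ[volume.restrict Ω] f ∧ ∀ T x, q.1 T x = f x}
  zero_mem' := by
    refine ⟨0, continuousOn_const, fun T _ => ⟨0, fun x _ => rfl⟩, ?_, fun _ _ => rfl⟩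
    exact Lp.coeFn_zero ℝ 2 (volume.restrict Ω)
  add_mem' := by
    rintro u v ⟨f, hf, hfT, hfu, hu⟩ ⟨g, hg, hgT, hgv, hv⟩
    refine ⟨f + g, hf.add hg, fun T hT => ?_, ?_, fun T x => ?_⟩
    · obtain ⟨p, hp⟩ := hfT T hT
      obtain ⟨q, hq⟩ := hgT T hT
      exact ⟨p + q, fun x hx => by simp [hp x hx, hq x hx]⟩
    · rw [Prod.snd_add, fn_add]
      exact (Lp.coeFn_add _ _).trans (hfu.add hgv)
    · simp [hu, hv]
  smul_mem' := by
    rintro c u ⟨f, hf, hfT, hfu, hu⟩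
    refine ⟨c • f, hf.const_smul c, fun T hT => ?_, ?_, fun T x => ?_⟩
    · obtain ⟨p, hp⟩ := hfT T hT
      exact ⟨c • p, fun x hx => by simp [hp x hx]⟩
    · rw [Prod.smul_snd, fn_smul]
      exact (Lp.coeFn_smul _ _).trans (hfu.const_smul c)
    · simp [hu]

/-- An affine function is determined on a simplex by its values at the vertices, so the finite
element space has at most as many dimensions as there are vertices. -/
theorem finiteDimensional_femSubmodule (hΩ : IsOpen Ω) (h𝒯 : IsTriangulation (closure Ω) 𝒯) :
    FiniteDimensional ℝ (femSubmodule Ω 𝒯) := by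
  have hinj : Function.Injective
      ((LinearMap.fst ℝ ((T : 𝒯) → (T.1 → ℝ)) (H1 Ω)).comp
        (nodalGraph Ω 𝒯).subtype) := by
    rw [← LinearMap.ker_eq_bot, LinearMap.ker_eq_bot']
    rintro ⟨⟨c, u⟩, f, hf, hfT, hfu, hcu⟩ hc0
    have hc : c = 0 := hc0
    have hf0 : ∀ x ∈ closure Ω, f x = 0 := fun x hx => by
      rw [← h𝒯.2.2] at hx
      obtain ⟨T, hT, hxT⟩ := Set.mem_iUnion₂.1 hx
      obtain ⟨p, hp⟩ := hfT T hT
      have hsub : convexHull ℝ (T : Set (Sp d)) ⊆ p ⁻¹' {0} := by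
        refine convexHull_min (fun y hy => ?_) ((convex_singleton 0).affine_preimage p)
        have h1 := hcu ⟨T, hT⟩ ⟨y, hy⟩
        rw [Set.mem_preimage, ← hp y (subset_convexHull ℝ _ hy), Set.mem_singleton_iff, ← h1]
        simp [hc]
      rw [hp x hxT]
      exact hsub hxT
    have hu : u = 0 := by
      refine H1_ext hΩ (Lp.ext ?_)
      refine hfu.trans ?_
      filter_upwards [Lp.coeFn_zero ℝ 2 (volume.restrict Ω), ae_restrict_mem hΩ.measurableSet]
        with x h1 h2
      rw [hf0 x (subset_closure h2)]
      exact h1.symm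
    simp [hc, hu]
  have hfin : FiniteDimensional ℝ (nodalGraph Ω 𝒯) := FiniteDimensional.of_injective _ hinj
  have hmap : femSubmodule Ω 𝒯 = (nodalGraph Ω 𝒯).map (LinearMap.snd ℝ _ _) := by
    ext u
    constructor
    · rintro ⟨f, hf, hfT, hfu⟩
      exact ⟨(fun T x => f x, u), ⟨f, hf, hfT, hfu, fun _ _ => rfl⟩, rfl⟩
    · rintro ⟨⟨c, v⟩, ⟨f, hf, hfT, hfu, _⟩, rfl⟩
      exact ⟨f, hf, hfT, hfu⟩
  rw [hmap]
  infer_instance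

theorem isClosed_femSubmodule (hΩ : IsOpen Ω) (h𝒯 : IsTriangulation (closure Ω) 𝒯) :
    IsClosed (femSubmodule Ω 𝒯 : Set (H1 Ω)) :=
  have := finiteDimensional_femSubmodule hΩ h𝒯
  (femSubmodule Ω 𝒯).closed_of_finiteDimensional

theorem convexHull_bisect_subset {T : Finset (Sp d)} {a b : Sp d} (ha : a ∈ T) (hb : b ∈ T)
    {T' : Finset (Sp d)} (hT' : ∀ x ∈ T', x = midpoint ℝ a b ∨ x ∈ T) :
    convexHull ℝ (T' : Set (Sp d)) ⊆ convexHull ℝ (T : Set (Sp d)) := by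
  refine convexHull_min (fun x hx => ?_) (convex_convexHull ℝ _)
  rcases hT' x hx with rfl | h
  · exact (convex_convexHull ℝ _).midpoint_mem (subset_convexHull ℝ _ ha)
      (subset_convexHull ℝ _ hb)
  · exact subset_convexHull ℝ _ h

/-- Every simplex of a bisected mesh lies in a simplex of the original mesh. -/
theorem BisectStep.exists_subset (h : BisectStep 𝒯 𝒯') {T' : Finset (Sp d)} (hT' : T' ∈ 𝒯') :
    ∃ T ∈ 𝒯, convexHull ℝ (T' : Set (Sp d)) ⊆ convexHull ℝ (T : Set (Sp d)) := by
  classical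
  obtain ⟨T, hT, a, ha, b, hb, _, rfl⟩ := h
  simp only [Finset.mem_insert] at hT'
  rcases hT' with h | h | h
  · refine ⟨T, hT, convexHull_bisect_subset ha hb fun x hx => ?_⟩
    rw [h, Finset.mem_insert] at hx
    exact hx.imp id Finset.mem_of_mem_erase
  · refine ⟨T, hT, convexHull_bisect_subset ha hb fun x hx => ?_⟩
    rw [h, Finset.mem_insert] at hx
    exact hx.imp id Finset.mem_of_mem_erase
  · exact ⟨T', Finset.mem_of_mem_erase h, subset_rfl⟩

theorem femSubmodule_le_of_bisectStep (h : BisectStep 𝒯 𝒯') :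
    femSubmodule Ω 𝒯 ≤ femSubmodule Ω 𝒯' := by
  rintro u ⟨f, hf, hfT, hfu⟩
  refine ⟨f, hf, fun T' hT' => ?_, hfu⟩
  obtain ⟨T, hT, hsub⟩ := h.exists_subset hT'
  obtain ⟨p, hp⟩ := hfT T hT
  exact ⟨p, fun x hx => hp x (hsub hx)⟩

theorem femSubmodule_le_of_refinement (h : IsBisectionRefinement 𝒯 𝒯') :
    femSubmodule Ω 𝒯 ≤ femSubmodule Ω 𝒯' := by
  induction h with
  | refl => exact le_rfl
  | tail _ h ih => exact ih.trans (femSubmodule_le_of_bisectStep h)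

theorem femSubmodule_le_hasTrace {C : ℝ} (hC : TraceBound Ω C) :
    femSubmodule Ω 𝒯 ≤ hasTrace Ω := by
  rintro u ⟨f, hf, _, hfu⟩
  exact ⟨_, isTrace_of_continuousOn hC hf hfu⟩

/-- The space `ℍ_𝒯` as a subspace of `ℍ`. -/
noncomputable def femSubmoduleHH (Ω : Set (Sp d)) (L : ℕ) (𝒯 : Mesh d) : Submodule ℝ (HH Ω L) :=
  (femSubmodule Ω 𝒯).comap (potL Ω L : HH Ω L →ₗ[ℝ] H1 Ω)

theorem isClosed_femSubmoduleHH (hΩ : IsOpen Ω) (h𝒯 : IsTriangulation (closure Ω) 𝒯) :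
    IsClosed (femSubmoduleHH Ω L 𝒯 : Set (HH Ω L)) :=
  (isClosed_femSubmodule hΩ h𝒯).preimage (potL Ω L).continuous

theorem isClosed_hasTraceHH {C : ℝ} (hC0 : 0 ≤ C) (hC : TraceBound Ω C) :
    IsClosed (hasTraceHH Ω L : Set (HH Ω L)) :=
  (isClosed_hasTrace hC0 hC).preimage (potL Ω L).continuous

variable {c₀ c₁ : ℝ}

theorem convex_admissible (Ω : Set (Sp d)) (c₀ c₁ : ℝ) : Convex ℝ (admissible Ω c₀ c₁) := by
  intro u hu v hv a b ha hb hab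
  have h1 : fn (a • u + b • v) = a • fn u + b • fn v := by rw [fn_add, fn_smul, fn_smul]
  change ∀ᵐ x ∂(volume.restrict Ω), c₀ ≤ fn (a • u + b • v) x ∧ fn (a • u + b • v) x ≤ c₁
  rw [h1]
  filter_upwards [hu, hv, Lp.coeFn_add (a • fn u) (b • fn v), Lp.coeFn_smul a (fn u),
    Lp.coeFn_smul b (fn v)] with x h2 h3 h4 h5 h6
  rw [h4, Pi.add_apply, h5, h6]
  exact convex_Icc c₀ c₁ h2 h3 ha hb hab

theorem exists_subseq_ae_tendsto {u : ℕ → H1 Ω} {v : H1 Ω}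
    (h : Tendsto (fun n => fn (u n)) atTop (𝓝 (fn v))) :
    ∃ φ : ℕ → ℕ, StrictMono φ ∧
      ∀ᵐ x ∂(volume.restrict Ω), Tendsto (fun n => fn (u (φ n)) x) atTop (𝓝 (fn v x)) :=
  (tendstoInMeasure_of_tendsto_Lp h).exists_seq_tendsto_ae

theorem isClosed_admissible (Ω : Set (Sp d)) (c₀ c₁ : ℝ) : IsClosed (admissible Ω c₀ c₁) := by
  refine isSeqClosed_iff_isClosed.1 fun u v hu hlim => ?_
  obtain ⟨φ, -, hφ⟩ := exists_subseq_ae_tendsto (((fnL Ω).continuous.tendsto v).comp hlim)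
  have hall : ∀ᵐ x ∂(volume.restrict Ω), ∀ n, c₀ ≤ fn (u (φ n)) x ∧ fn (u (φ n)) x ≤ c₁ :=
    ae_all_iff.2 fun n => hu (φ n)
  change ∀ᵐ x ∂(volume.restrict Ω), c₀ ≤ fn v x ∧ fn v x ≤ c₁
  filter_upwards [hφ, hall] with x h1 h2
  exact ⟨ge_of_tendsto' h1 fun n => (h2 n).1, le_of_tendsto' h1 fun n => (h2 n).2⟩

theorem nonempty_admissibleFem (hb : Bornology.IsBounded Ω) (hc : c₀ ≤ c₁) :
    (admissibleFem Ω c₀ c₁ 𝒯).Nonempty := by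
  obtain ⟨u, hu, -⟩ := exists_const_H1 hb c₀
  refine ⟨u, ⟨fun _ => c₀, continuousOn_const, fun T _ => ⟨AffineMap.const ℝ _ c₀, fun x _ => rfl⟩,
    hu⟩, ?_⟩
  filter_upwards [hu] with x hx
  rw [hx]
  exact ⟨le_rfl, hc⟩

theorem convex_admissibleFem (Ω : Set (Sp d)) (c₀ c₁ : ℝ) (𝒯 : Mesh d) :
    Convex ℝ (admissibleFem Ω c₀ c₁ 𝒯) :=
  (femSubmodule Ω 𝒯).convex.inter (convex_admissible Ω c₀ c₁)

theorem isClosed_admissibleFem (hΩ : IsOpen Ω) (h𝒯 : IsTriangulation (closure Ω) 𝒯) :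
    IsClosed (admissibleFem Ω c₀ c₁ 𝒯) :=
  (isClosed_femSubmodule hΩ h𝒯).inter (isClosed_admissible Ω c₀ c₁)

end Fem

/-! ### Convergence of minimizers -/

section Minimizers

/-- Closed convex sets are weakly sequentially closed. -/
theorem mem_of_weak_tendsto {E : Type*} [NormedAddCommGroup E] [NormedSpace ℝ E] {K : Set E}
    (hK : Convex ℝ K) (hcl : IsClosed K) {u : ℕ → E} {v : E} (hu : ∀ n, u n ∈ K)
    (hw : ∀ φ : E →L[ℝ] ℝ, Tendsto (fun n => φ (u n)) atTop (𝓝 (φ v))) : v ∈ K := by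
  by_contra hv
  obtain ⟨f, r, h1, h2⟩ := geometric_hahn_banach_point_closed hK hcl hv
  exact absurd (ge_of_tendsto' (hw f) fun n => (h2 _ (hu n)).le) (not_le.2 h1)

theorem iUnion_comp_strictMono {X : Type*} {S : ℕ → Set X} (hS : Monotone S) {φ : ℕ → ℕ}
    (hφ : StrictMono φ) : ⋃ n, S (φ n) = ⋃ n, S n := by
  refine (Set.iUnion_subset fun n => Set.subset_iUnion S (φ n)).antisymm ?_
  exact Set.iUnion_subset fun n =>
    (hS hφ.le_apply).trans (Set.subset_iUnion (fun n => S (φ n)) n)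

theorem convex_iUnion_of_monotone {E : Type*} [NormedAddCommGroup E] [NormedSpace ℝ E]
    {A : ℕ → Set E} (hA : Monotone A) (hc : ∀ n, Convex ℝ (A n)) : Convex ℝ (⋃ n, A n) :=
  hA.directed_le.convex_iUnion fun {n} => hc n

variable {Ω : Set (Sp d)} {e : Fin L → Set (Sp d)} {z : Fin L → ℝ}
  {I Uδ : EuclideanSpace ℝ (Fin L)} {c₀ c₁ ε α m M : ℝ}

theorem existsUnique_isState
    (hco : ∀ σ ∈ admissible Ω c₀ c₁, IsCoerciveForm (aForm e z σ) (hasTraceHH Ω L) m M)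
    (hm : 0 < m) {S : Submodule ℝ (HH Ω L)} (hScl : IsClosed (S : Set (HH Ω L)))
    (hS : S ≤ hasTraceHH Ω L) {σ : H1 Ω} (hσ : σ ∈ admissible Ω c₀ c₁) :
    ∃! w, IsState e z I (S : Set (HH Ω L)) σ w := by
  have : CompleteSpace S := hScl.completeSpace_coe
  exact (hco σ hσ).existsUnique hm S hS ((innerSL ℝ I).comp (voltL Ω L))

theorem coe_topologicalClosure_iSup {S : ℕ → Submodule ℝ (HH Ω L)} (hS : Monotone S) :
    ((⨆ n, S n).topologicalClosure : Set (HH Ω L)) = closure (⋃ n, (S n : Set (HH Ω L))) := by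
  rw [Submodule.topologicalClosure_coe, Submodule.coe_iSup_of_directed _ hS.directed_le]

/-- Convergence of the states: the conductivities may vary with the subspace as long as they
converge almost everywhere. -/
theorem tendsto_state [IsFiniteMeasure (surf Ω)]
    (hco : ∀ σ ∈ admissible Ω c₀ c₁, IsCoerciveForm (aForm e z σ) (hasTraceHH Ω L) m M)
    (hm : 0 < m) (hM : 0 ≤ M) (hYc : IsClosed (hasTraceHH Ω L : Set (HH Ω L))) (hc₀ : 0 < c₀)
    {S : ℕ → Submodule ℝ (HH Ω L)} (hS : Monotone S) (hSY : ∀ n, S n ≤ hasTraceHH Ω L)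
    {σk : ℕ → H1 Ω} {σ : H1 Ω} (hσk : ∀ n, σk n ∈ admissible Ω c₀ c₁)
    (hσ : σ ∈ admissible Ω c₀ c₁)
    (hlim : ∀ᵐ x ∂(volume.restrict Ω), Tendsto (fun n => fn (σk n) x) atTop (𝓝 (fn σ x)))
    {wk : ℕ → HH Ω L} {w : HH Ω L} (hwk : ∀ n, IsState e z I (S n : Set (HH Ω L)) (σk n) (wk n))
    (hw : IsState e z I (closure (⋃ n, (S n : Set (HH Ω L)))) σ w) :
    Tendsto wk atTop (𝓝 w) := by
  have hflux := tendsto_iff_norm_sub_tendsto_zero.1 (tendsto_flux hc₀ hσk hσ hlim (grad w.fst))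
  refine tendsto_galerkin (a := fun n => aForm e z (σk n)) (b := aForm e z σ)
    (ℓ := fun v => inner ℝ I (volt v)) (fun n => hco _ (hσk n)) hm hM hS hSY hYc
    hwk hw.1 (fun n v hv => hw.2 v (subset_closure (Set.mem_iUnion_of_mem n hv)))
    (fun n => norm_nonneg _) hflux fun n v _ => ?_
  rw [norm_sub_rev]
  exact abs_aForm_sub_le hc₀ hσ (hσk n) w v

theorem cost_eq (σ : H1 Ω) (U : EuclideanSpace ℝ (Fin L)) :
    cost c₀ c₁ ε α Uδ σ U = α / 2 * ε * ‖grad σ‖ ^ 2 +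
      (1 / 2 * ‖U - Uδ‖ ^ 2 + α / 2 * (1 / ε * ∫ x in Ω, W c₀ c₁ (fn σ x))) := by
  rw [cost, modicaMortola]
  ring

theorem W_nonneg (c₀ c₁ s : ℝ) : 0 ≤ W c₀ c₁ s := by
  rw [W]
  positivity

theorem tendsto_integral_W (hb : Bornology.IsBounded Ω) {σk : ℕ → H1 Ω} {σ : H1 Ω}
    (hσk : ∀ n, σk n ∈ admissible Ω c₀ c₁)
    (hlim : ∀ᵐ x ∂(volume.restrict Ω), Tendsto (fun n => fn (σk n) x) atTop (𝓝 (fn σ x))) :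
    Tendsto (fun n => ∫ x in Ω, W c₀ c₁ (fn (σk n) x)) atTop (𝓝 (∫ x in Ω, W c₀ c₁ (fn σ x))) := by
  have : IsFiniteMeasure (volume.restrict Ω) := ⟨by simpa using hb.measure_lt_top⟩
  have hWc : Continuous (W c₀ c₁) := by
    unfold W
    fun_prop
  refine tendsto_integral_of_dominated_convergence (fun _ => (c₁ - c₀) ^ 2 * (c₁ - c₀) ^ 2)
    (fun n => hWc.comp_aestronglyMeasurable (Lp.aestronglyMeasurable _)) (integrable_const _)
    (fun n => ?_) ?_
  · filter_upwards [hσk n] with x hx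
    rw [Real.norm_of_nonneg (W_nonneg _ _ _), W]
    have h1 : (fn (σk n) x - c₀) ^ 2 ≤ (c₁ - c₀) ^ 2 :=
      pow_le_pow_left₀ (by linarith [hx.1]) (by linarith [hx.2]) 2
    have h2 : (fn (σk n) x - c₁) ^ 2 ≤ (c₁ - c₀) ^ 2 := by
      nlinarith [hx.1, hx.2]
    exact mul_le_mul h1 h2 (sq_nonneg _) (sq_nonneg _)
  · filter_upwards [hlim] with x hx
    exact (hWc.tendsto _).comp hx

/-- Admissible conductivities are bounded in `H¹` by the gradient part of the functional. -/
theorem norm_sq_le_of_admissible (hb : Bornology.IsBounded Ω) (hc₀ : 0 < c₀) {σ : H1 Ω}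
    (hσ : σ ∈ admissible Ω c₀ c₁) :
    ‖σ‖ ^ 2 ≤ c₁ ^ 2 * (volume.restrict Ω).real Set.univ + ‖grad σ‖ ^ 2 := by
  have : IsFiniteMeasure (volume.restrict Ω) := ⟨by simpa using hb.measure_lt_top⟩
  rw [norm_sq_H1, norm_sq_Lp_two]
  gcongr
  calc ∫ x in Ω, ‖fn σ x‖ ^ 2 ≤ ∫ _x in Ω, c₁ ^ 2 := by
        refine integral_mono_ae (Lp.memLp _).norm.integrable_sq (integrable_const _) ?_
        filter_upwards [norm_fn_le_of_admissible hc₀ hσ] with x hx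
        gcongr
    _ = _ := by simp [mul_comm]

/-- Almost-minimizers on an increasing sequence of closed subspaces and convex admissible sets,
with errors tending to zero, subconverge strongly to a minimizer of the limiting problem. -/
theorem exists_subseq_tendsto_minimizer [IsFiniteMeasure (surf Ω)] (hΩ : IsOpen Ω)
    (hb : Bornology.IsBounded Ω) (hreg : interior (closure Ω) = Ω) {𝒯 : Mesh d}
    (h𝒯 : IsTriangulation (closure Ω) 𝒯)
    (hco : ∀ σ ∈ admissible Ω c₀ c₁, IsCoerciveForm (aForm e z σ) (hasTraceHH Ω L) m M)
    (hm : 0 < m) (hM : 0 ≤ M) (hYc : IsClosed (hasTraceHH Ω L : Set (HH Ω L))) (hc₀ : 0 < c₀)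
    (hε : 0 < ε) (hα : 0 < α)
    {S : ℕ → Submodule ℝ (HH Ω L)} (hS : Monotone S) (hScl : ∀ n, IsClosed (S n : Set (HH Ω L)))
    (hSY : ∀ n, S n ≤ hasTraceHH Ω L)
    {A : ℕ → Set (H1 Ω)} (hA : Monotone A) (hAc : ∀ n, Convex ℝ (A n))
    (hAadm : ∀ n, A n ⊆ admissible Ω c₀ c₁) (hA0 : (A 0).Nonempty)
    {σk : ℕ → H1 Ω} {wk : ℕ → HH Ω L} (hσk : ∀ n, σk n ∈ A n)
    (hwk : ∀ n, IsState e z I (S n : Set (HH Ω L)) (σk n) (wk n))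
    {δ : ℕ → ℝ} (hδ : Tendsto δ atTop (𝓝 0))
    (hmin : ∀ n, ∀ σ' ∈ A n, ∀ w', IsState e z I (S n : Set (HH Ω L)) σ' w' →
      cost c₀ c₁ ε α Uδ (σk n) (volt (wk n)) ≤ cost c₀ c₁ ε α Uδ σ' (volt w') + δ n) :
    ∃ (φ : ℕ → ℕ) (σ : H1 Ω) (w : HH Ω L), StrictMono φ ∧
      IsMinimizer e z I Uδ c₀ c₁ ε α (closure (⋃ n, A n))
        (closure (⋃ n, (S n : Set (HH Ω L)))) σ w ∧
      Tendsto (fun j => σk (φ j)) atTop (𝓝 σ) ∧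
      (∀ᵐ x ∂(volume.restrict Ω), Tendsto (fun j => fn (σk (φ j)) x) atTop (𝓝 (fn σ x))) ∧
      Tendsto (fun j => wk (φ j)) atTop (𝓝 w) := by
  have hc : 0 < α / 2 * ε := by positivity
  have hadm : ∀ n, σk n ∈ admissible Ω c₀ c₁ := fun n => hAadm n (hσk n)
  have hSlim : ∀ σ ∈ admissible Ω c₀ c₁,
      ∃! w, IsState e z I (closure (⋃ n, (S n : Set (HH Ω L)))) σ w := fun σ hσ => by
    rw [← coe_topologicalClosure_iSup hS]
    exact existsUnique_isState hco hm (Submodule.isClosed_topologicalClosure _)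
      (Submodule.topologicalClosure_minimal _ (iSup_le hSY) hYc) hσ
  have hAlim : closure (⋃ n, A n) ⊆ admissible Ω c₀ c₁ :=
    closure_minimal (Set.iUnion_subset hAadm) (isClosed_admissible Ω c₀ c₁)
  -- the functional without its gradient part, which is continuous for the convergence at hand
  set R : H1 Ω → HH Ω L → ℝ := fun σ w =>
    1 / 2 * ‖volt w - Uδ‖ ^ 2 + α / 2 * (1 / ε * ∫ x in Ω, W c₀ c₁ (fn σ x)) with hR
  have hRlim : ∀ {σ' : ℕ → H1 Ω} {w' : ℕ → HH Ω L} {σ : H1 Ω} {w : HH Ω L},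
      (∀ n, σ' n ∈ admissible Ω c₀ c₁) →
      (∀ᵐ x ∂(volume.restrict Ω), Tendsto (fun n => fn (σ' n) x) atTop (𝓝 (fn σ x))) →
      Tendsto w' atTop (𝓝 w) → Tendsto (fun n => R (σ' n) (w' n)) atTop (𝓝 (R σ w)) := by
    intro σ' w' σ w h1 h2 h3
    refine Tendsto.add ?_ (((tendsto_integral_W hb h1 h2).const_mul _).const_mul _)
    exact (((((voltL Ω L).continuous.tendsto w).comp h3).sub_const Uδ).norm.pow 2).const_mul _
  -- the gradients are bounded, by comparison with a fixed conductivity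
  have hbound : ∃ K : ℝ, ∀ n, ‖σk n‖ ≤ K := by
    obtain ⟨σ₀, hσ₀⟩ := hA0
    have hσ₀n : ∀ n, σ₀ ∈ A n := fun n => hA (Nat.zero_le n) hσ₀
    choose w₀ hw₀ _ using fun n => existsUnique_isState (I := I) hco hm (hScl n) (hSY n)
      (hAadm n (hσ₀n n))
    obtain ⟨w', hw', -⟩ := hSlim σ₀ (hAadm 0 hσ₀)
    have h1 := tendsto_state hco hm hM hYc hc₀ hS hSY (fun n => hAadm n (hσ₀n n)) (hAadm 0 hσ₀)
      (Eventually.of_forall fun x => tendsto_const_nhds) hw₀ hw'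
    have h2 := (((hRlim (fun n => hAadm n (hσ₀n n))
      (Eventually.of_forall fun x => tendsto_const_nhds) h1).const_add
        (α / 2 * ε * ‖grad σ₀‖ ^ 2)).add hδ)
    obtain ⟨B, hB⟩ := h2.bddAbove_range
    refine ⟨√(c₁ ^ 2 * (volume.restrict Ω).real Set.univ + B / (α / 2 * ε)), fun n => ?_⟩
    refine Real.le_sqrt_of_sq_le ((norm_sq_le_of_admissible hb hc₀ (hadm n)).trans ?_)
    gcongr
    rw [le_div_iff₀ hc, mul_comm]
    have h3 := hmin n σ₀ (hσ₀n n) (w₀ n) (hw₀ n)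
    rw [cost_eq, cost_eq] at h3
    have h4 := hB (Set.mem_range_self n)
    have h5 : 0 ≤ R (σk n) (wk n) := by
      have : 0 ≤ ∫ x in Ω, W c₀ c₁ (fn (σk n) x) := integral_nonneg fun x => W_nonneg _ _ _
      rw [hR]
      positivity
    simp only [hR] at h4 h5
    linarith
  obtain ⟨K, hK⟩ := hbound
  obtain ⟨φ₁, σ, hφ₁, hweak₁⟩ := exists_weak_subseq σk hK
  obtain ⟨φ₂, hφ₂, hae⟩ := exists_subseq_ae_tendsto (u := fun n => σk (φ₁ n))
    (tendsto_fn_of_weak hΩ hb hreg h𝒯 (fun n => hK (φ₁ n)) hweak₁)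
  set φ : ℕ → ℕ := φ₁ ∘ φ₂ with hφdef
  have hφ : StrictMono φ := hφ₁.comp hφ₂
  have hweak : ∀ ℓ : H1 Ω →L[ℝ] ℝ, Tendsto (fun n => ℓ (σk (φ n))) atTop (𝓝 (ℓ σ)) :=
    fun ℓ => (hweak₁ ℓ).comp hφ₂.tendsto_atTop
  have hfn : Tendsto (fun n => fn (σk (φ n))) atTop (𝓝 (fn σ)) :=
    tendsto_fn_of_weak hΩ hb hreg h𝒯 (fun n => hK (φ n)) hweak
  have hσ : σ ∈ closure (⋃ n, A n) :=
    mem_of_weak_tendsto (convex_iUnion_of_monotone hA hAc).closure isClosed_closure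
      (fun n => subset_closure (Set.mem_iUnion_of_mem _ (hσk (φ n)))) hweak
  obtain ⟨w, hw, -⟩ := hSlim σ (hAlim hσ)
  have hSφ : ∀ {ψ : ℕ → ℕ}, StrictMono ψ →
      closure (⋃ n, (S (ψ n) : Set (HH Ω L))) = closure (⋃ n, (S n : Set (HH Ω L))) :=
    fun hψ => by
      rw [iUnion_comp_strictMono (S := fun n => (S n : Set (HH Ω L))) (fun a b h => hS h) hψ]
  have hwlim : Tendsto (fun n => wk (φ n)) atTop (𝓝 w) :=
    tendsto_state hco hm hM hYc hc₀ (hS.comp hφ.monotone) (fun n => hSY _) (fun n => hadm (φ n))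
      (hAlim hσ) hae (fun n => hwk (φ n)) (by rw [Function.comp_def, hSφ hφ]; exact hw)
  have hRσ := hRlim (fun n => hadm (φ n)) hae hwlim
  -- comparison with a recovery sequence for an arbitrary competitor, along a further subsequence on
  -- which it converges almost everywhere
  have hkey : ∀ σ' ∈ closure (⋃ n, A n), ∀ w',
      IsState e z I (closure (⋃ n, (S n : Set (HH Ω L)))) σ' w' →
      ∃ (ψ : ℕ → ℕ) (b : ℕ → ℝ), StrictMono ψ ∧
        Tendsto b atTop (𝓝 (cost c₀ c₁ ε α Uδ σ' (volt w') - R σ w)) ∧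
        ∀ n, α / 2 * ε * ‖grad (σk (φ (ψ n)))‖ ^ 2 ≤ b n := by
    intro σ' hσ' w' hw'
    rw [← iUnion_comp_strictMono hA hφ] at hσ'
    obtain ⟨v, hvA, hv⟩ := exists_seq_of_mem_closure_iUnion (S := fun n => A (φ n))
      (hA.comp hφ.monotone) (hA0.mono (hA (Nat.zero_le _))) hσ'
    rw [iUnion_comp_strictMono hA hφ] at hσ'
    obtain ⟨ψ, hψ, hvae⟩ := exists_subseq_ae_tendsto (((fnL Ω).continuous.tendsto σ').comp hv)
    have hφψ := hφ.comp hψ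
    have hvadm : ∀ n, v (ψ n) ∈ admissible Ω c₀ c₁ := fun n => hAadm _ (hvA (ψ n))
    choose w₁ hw₁ _ using fun n => existsUnique_isState (I := I) hco hm (hScl (φ (ψ n))) (hSY _)
      (hvadm n)
    have hw₁lim : Tendsto w₁ atTop (𝓝 w') :=
      tendsto_state hco hm hM hYc hc₀ (hS.comp hφψ.monotone) (fun n => hSY _) hvadm
        (hAlim hσ') hvae hw₁ (by
          have := hSφ hφψ
          simp only [Function.comp_def] at this ⊢
          rw [this]
          exact hw')
    have hgv : Tendsto (fun n => α / 2 * ε * ‖grad (v (ψ n))‖ ^ 2) atTop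
        (𝓝 (α / 2 * ε * ‖grad σ'‖ ^ 2)) :=
      (((((gradL Ω).continuous.tendsto σ').comp hv).comp hψ.tendsto_atTop).norm.pow 2).const_mul _
    refine ⟨ψ, fun n => α / 2 * ε * ‖grad (v (ψ n))‖ ^ 2 + R (v (ψ n)) (w₁ n) + δ (φ (ψ n)) -
      R (σk (φ (ψ n))) (wk (φ (ψ n))), hψ, ?_, fun n => ?_⟩
    · have h1 := ((hgv.add (hRlim hvadm hvae hw₁lim)).add
        (hδ.comp hφψ.tendsto_atTop)).sub (hRσ.comp hψ.tendsto_atTop)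
      rw [add_zero] at h1
      rw [cost_eq]
      exact h1
    · have h1 := hmin (φ (ψ n)) (v (ψ n)) (hvA (ψ n)) (w₁ n) (hw₁ n)
      rw [cost_eq, cost_eq] at h1
      simp only [hR]
      linarith
  -- weak lower semicontinuity of the gradient norm, made explicit by expanding a square
  have hinner : Tendsto (fun n => inner ℝ (grad σ) (grad (σk (φ n)))) atTop (𝓝 (‖grad σ‖ ^ 2)) := by
    rw [← real_inner_self_eq_norm_sq]
    exact hweak ((innerSL ℝ (grad σ)).comp (gradL Ω))
  have hnn : ∀ n, 2 * inner ℝ (grad σ) (grad (σk (φ n))) - ‖grad σ‖ ^ 2 ≤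
      ‖grad (σk (φ n))‖ ^ 2 := fun n => by
    have := norm_sub_sq_real (grad σ) (grad (σk (φ n)))
    nlinarith [sq_nonneg ‖grad σ - grad (σk (φ n))‖]
  have hmin' : IsMinimizer e z I Uδ c₀ c₁ ε α (closure (⋃ n, A n))
      (closure (⋃ n, (S n : Set (HH Ω L)))) σ w := by
    refine ⟨hσ, hw, fun σ' hσ' w' hw' => ?_⟩
    obtain ⟨ψ, b, hψ, hb', hle⟩ := hkey σ' hσ' w' hw'
    have h1 := (((hinner.comp hψ.tendsto_atTop).const_mul 2).sub_const (‖grad σ‖ ^ 2)).const_mul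
      (α / 2 * ε)
    have h2 := le_of_tendsto_of_tendsto' h1 hb' fun n =>
      (mul_le_mul_of_nonneg_left (hnn (ψ n)) hc.le).trans (hle n)
    rw [cost_eq]
    simp only [hR] at h2
    linarith
  -- the recovery sequence of the limit itself gives convergence of the gradient norms
  obtain ⟨ψ, b, hψ, hb', hle⟩ := hkey σ hσ w hw
  refine ⟨φ ∘ ψ, σ, w, hφ.comp hψ, hmin', ?_, ?_, hwlim.comp hψ.tendsto_atTop⟩
  · refine tendsto_of_tendsto_norm_sq ?_
    have h1 := ((tendsto_iff_norm_sub_tendsto_zero.1 hfn).comp hψ.tendsto_atTop).pow 2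
    have h2 := ((hb'.div_const (α / 2 * ε)).sub
      ((hinner.comp hψ.tendsto_atTop).const_mul 2)).add_const
      (‖grad σ‖ ^ 2)
    have h3 : (cost c₀ c₁ ε α Uδ σ (volt w) - R σ w) / (α / 2 * ε) - 2 * ‖grad σ‖ ^ 2 +
        ‖grad σ‖ ^ 2 = 0 := by
      rw [cost_eq]
      simp only [hR, add_sub_cancel_right]
      field_simp
      ring
    rw [h3] at h2
    have h4 := h1.add h2
    rw [zero_pow two_ne_zero, add_zero] at h4
    refine squeeze_zero (fun n => sq_nonneg _) (fun n => ?_) h4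
    rw [norm_sq_H1, fn_sub, grad_sub, norm_sub_sq_real (grad _) (grad σ), real_inner_comm]
    have h5 := (le_div_iff₀' hc).2 (hle n)
    simp only [Function.comp_apply]
    linarith
  · filter_upwards [hae] with x hx
    exact hx.comp hψ.tendsto_atTop

/-- The direct method: the minimization problem on a closed subspace and a nonempty closed convex
set of admissible conductivities has a solution. -/
theorem exists_isMinimizer [IsFiniteMeasure (surf Ω)] (hΩ : IsOpen Ω)
    (hb : Bornology.IsBounded Ω) (hreg : interior (closure Ω) = Ω) {𝒯 : Mesh d}
    (h𝒯 : IsTriangulation (closure Ω) 𝒯)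
    (hco : ∀ σ ∈ admissible Ω c₀ c₁, IsCoerciveForm (aForm e z σ) (hasTraceHH Ω L) m M)
    (hm : 0 < m) (hM : 0 ≤ M) (hYc : IsClosed (hasTraceHH Ω L : Set (HH Ω L))) (hc₀ : 0 < c₀)
    (hε : 0 < ε) (hα : 0 < α)
    {S : Submodule ℝ (HH Ω L)} (hScl : IsClosed (S : Set (HH Ω L))) (hSY : S ≤ hasTraceHH Ω L)
    {A : Set (H1 Ω)} (hAc : Convex ℝ A) (hAcl : IsClosed A) (hAadm : A ⊆ admissible Ω c₀ c₁)
    (hA0 : A.Nonempty) :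
    ∃ σ w, IsMinimizer e z I Uδ c₀ c₁ ε α A (S : Set (HH Ω L)) σ w := by
  set J : Set ℝ := {t | ∃ σ ∈ A, ∃ w, IsState e z I (S : Set (HH Ω L)) σ w ∧
    cost c₀ c₁ ε α Uδ σ (volt w) = t} with hJ
  have hne : J.Nonempty := by
    obtain ⟨σ, hσ⟩ := hA0
    obtain ⟨w, hw, -⟩ := existsUnique_isState (I := I) hco hm hScl hSY (hAadm hσ)
    exact ⟨_, σ, hσ, w, hw, rfl⟩
  have hbdd : BddBelow J := by
    refine ⟨0, ?_⟩
    rintro t ⟨σ, -, w, -, rfl⟩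
    have : 0 ≤ ∫ x in Ω, W c₀ c₁ (fn σ x) := integral_nonneg fun x => W_nonneg _ _ _
    rw [cost, modicaMortola]
    positivity
  have hex : ∀ n : ℕ, ∃ t ∈ J, t < sInf J + 1 / ((n : ℝ) + 1) := fun n =>
    exists_lt_of_csInf_lt hne (lt_add_of_pos_right _ (by positivity))
  choose t ht hlt using hex
  choose σk hσk wk hwk hcost using ht
  obtain ⟨-, σ, w, -, h, -⟩ := exists_subseq_tendsto_minimizer (I := I) (Uδ := Uδ) hΩ hb hreg h𝒯 hco
    hm hM hYc hc₀ hε hα (S := fun _ => S) monotone_const (fun _ => hScl) (fun _ => hSY)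
    (A := fun _ => A) monotone_const (fun _ => hAc) (fun _ => hAadm) hA0 hσk hwk
    (tendsto_one_div_add_atTop_nhds_zero_nat (𝕜 := ℝ)) (fun n σ' hσ' w' hw' => by
      have := csInf_le hbdd ⟨σ', hσ', w', hw', rfl⟩
      rw [hcost]
      linarith [hlt n])
  rw [Set.iUnion_const, Set.iUnion_const, hAcl.closure_eq, hScl.closure_eq] at h
  exact ⟨σ, w, h⟩

end Minimizers

end EIT

theorem mainTheorem5 {d L : ℕ} (hd : d = 2 ∨ d = 3) (hL : 1 ≤ L)
    -- the polyhedral domain `Ω`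
    (Ω : Set (EIT.Sp d)) (hΩ_open : IsOpen Ω) (hΩ_bdd : Bornology.IsBounded Ω)
    (hΩ_conn : IsConnected Ω) (hΩ_reg : interior (closure Ω) = Ω)
    -- electrodes, contact impedances, current and data
    (e : Fin L → Set (EIT.Sp d)) (he_meas : ∀ l, MeasurableSet (e l))
    (he_sub : ∀ l, e l ⊆ frontier Ω) (he_pos : ∀ l, EIT.surf Ω (e l) ≠ 0)
    (he_disj : ∀ i j, i ≠ j → Disjoint (closure (e i)) (closure (e j)))
    (z : Fin L → ℝ) (hz : ∀ l, 0 < z l)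
    (I Uδ : EuclideanSpace ℝ (Fin L)) (hI : I ∈ EIT.RDiamond L)
    (c₀ c₁ ε α : ℝ) (hc₀ : 0 < c₀) (hc : c₀ < c₁) (hε : 0 < ε) (hα : 0 < α)
    -- the meshes produced by the adaptive algorithm
    (𝒯 : ℕ → EIT.Mesh d) (h𝒯 : ∀ k, EIT.IsTriangulation (closure Ω) (𝒯 k))
    (h_ref : ∀ k, EIT.IsBisectionRefinement (𝒯 k) (𝒯 (k + 1))) :
    -- the limiting state problem is uniquely solvable
    (∀ σ ∈ EIT.admissibleLim Ω c₀ c₁ 𝒯, ∃! w, EIT.IsState e z I (EIT.HHlim Ω L 𝒯) σ w) ∧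
    -- the limiting minimization problem has a solution
    (∃ σ w, EIT.IsMinimizer e z I Uδ c₀ c₁ ε α
      (EIT.admissibleLim Ω c₀ c₁ 𝒯) (EIT.HHlim Ω L 𝒯) σ w) ∧
    -- the discrete problems have solutions
    (∀ k, ∃ σ w, EIT.IsMinimizer e z I Uδ c₀ c₁ ε α
      (EIT.admissibleFem Ω c₀ c₁ (𝒯 k)) (EIT.HHfem Ω L (𝒯 k)) σ w) ∧
    -- any sequence of discrete solutions subconverges to a solution of the limiting problem
    (∀ (σk : ℕ → EIT.H1 Ω) (wk : ℕ → EIT.HH Ω L),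
      (∀ k, EIT.IsMinimizer e z I Uδ c₀ c₁ ε α
        (EIT.admissibleFem Ω c₀ c₁ (𝒯 k)) (EIT.HHfem Ω L (𝒯 k)) (σk k) (wk k)) →
      ∃ (n : ℕ → ℕ) (σ : EIT.H1 Ω) (w : EIT.HH Ω L), StrictMono n ∧
        EIT.IsMinimizer e z I Uδ c₀ c₁ ε α
          (EIT.admissibleLim Ω c₀ c₁ 𝒯) (EIT.HHlim Ω L 𝒯) σ w ∧
        Tendsto (fun j => σk (n j)) atTop (𝓝 σ) ∧
        (∀ᵐ x ∂(volume.restrict Ω), Tendsto (fun j => EIT.fn (σk (n j)) x) atTop (𝓝 (EIT.fn σ x))) ∧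
        Tendsto (fun j => wk (n j)) atTop (𝓝 w)) := by
  -- only the positivity of the dimension matters: faces of simplices are parametrized by `ℝ^n`
  have : ∃ n, d = n + 1 := by
    rcases hd with rfl | rfl
    · exact ⟨1, rfl⟩
    · exact ⟨2, rfl⟩
  obtain ⟨n, rfl⟩ := this
  have := EIT.isFiniteMeasure_surf hΩ_open hΩ_reg (h𝒯 0)
  obtain ⟨C, hC0, hC⟩ := EIT.exists_traceBound hΩ_open hΩ_reg (h𝒯 0)
  have hepos : ∀ l, (EIT.surf Ω).restrict (e l) ≠ 0 := fun l h =>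
    he_pos l (Measure.restrict_eq_zero.1 h)
  obtain ⟨m, M, hm, hM, hco⟩ := EIT.exists_isCoerciveForm hΩ_open hΩ_bdd hΩ_conn hΩ_reg (h𝒯 0)
    hC0 hC hL hepos hz hc₀ (c₁ := c₁) (hc₀.trans hc).le
  have hYc := EIT.isClosed_hasTraceHH (L := L) hC0 hC
  have hmono : Monotone fun k => EIT.femSubmodule Ω (𝒯 k) :=
    monotone_nat_of_le_succ fun k => EIT.femSubmodule_le_of_refinement (h_ref k)
  have hS : Monotone fun k => EIT.femSubmoduleHH Ω L (𝒯 k) := fun i j hij w hw => hmono hij hw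
  have hSY : ∀ k, EIT.femSubmoduleHH Ω L (𝒯 k) ≤ EIT.hasTraceHH Ω L :=
    fun k w hw => EIT.femSubmodule_le_hasTrace hC hw
  have hScl : ∀ k, IsClosed (EIT.femSubmoduleHH Ω L (𝒯 k) : Set (EIT.HH Ω L)) :=
    fun k => EIT.isClosed_femSubmoduleHH hΩ_open (h𝒯 k)
  have hA : Monotone fun k => EIT.admissibleFem Ω c₀ c₁ (𝒯 k) :=
    fun i j hij σ hσ => ⟨hmono hij hσ.1, hσ.2⟩
  have hAc := fun k => EIT.convex_admissibleFem Ω c₀ c₁ (𝒯 k)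
  have hAadm : ∀ k, EIT.admissibleFem Ω c₀ c₁ (𝒯 k) ⊆ EIT.admissible Ω c₀ c₁ :=
    fun k => Set.inter_subset_right
  have hA0 := fun k => EIT.nonempty_admissibleFem (𝒯 := 𝒯 k) hΩ_bdd hc.le
  have hlimcl : EIT.HHlim Ω L 𝒯 = ((⨆ k, EIT.femSubmoduleHH Ω L (𝒯 k)).topologicalClosure :
      Set (EIT.HH Ω L)) := (EIT.coe_topologicalClosure_iSup hS).symm
  have hlimY : (⨆ k, EIT.femSubmoduleHH Ω L (𝒯 k)).topologicalClosure ≤ EIT.hasTraceHH Ω L :=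
    Submodule.topologicalClosure_minimal _ (iSup_le hSY) hYc
  have hlimA : EIT.admissibleLim Ω c₀ c₁ 𝒯 ⊆ EIT.admissible Ω c₀ c₁ :=
    closure_minimal (Set.iUnion_subset hAadm) (EIT.isClosed_admissible Ω c₀ c₁)
  refine ⟨fun σ hσ => ?_, ?_, fun k => ?_, fun σk wk hk => ?_⟩
  · rw [hlimcl]
    exact EIT.existsUnique_isState hco hm (Submodule.isClosed_topologicalClosure _) hlimY (hlimA hσ)
  · rw [hlimcl]
    exact EIT.exists_isMinimizer hΩ_open hΩ_bdd hΩ_reg (h𝒯 0) hco hm hM hYc hc₀ hε hα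
      (Submodule.isClosed_topologicalClosure _) hlimY
      (EIT.convex_iUnion_of_monotone hA hAc).closure isClosed_closure hlimA
      (((hA0 0).mono (Set.subset_iUnion (fun k => EIT.admissibleFem Ω c₀ c₁ (𝒯 k)) 0)).closure)
  · exact EIT.exists_isMinimizer hΩ_open hΩ_bdd hΩ_reg (h𝒯 0) hco hm hM hYc hc₀ hε hα
      (hScl k) (hSY k) (hAc k) (EIT.isClosed_admissibleFem hΩ_open (h𝒯 k)) (hAadm k) (hA0 k)
  · exact EIT.exists_subseq_tendsto_minimizer hΩ_open hΩ_bdd hΩ_reg (h𝒯 0) hco hm hM hYc hc₀ hε hα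
      hS hScl hSY hA hAc hAadm (hA0 0) (fun k => (hk k).1) (fun k => (hk k).2.1)
      (tendsto_const_nhds (x := (0 : ℝ))) (fun k σ' hσ' w' hw' => by
        rw [add_zero]
        exact (hk k).2.2 σ' hσ' w' hw')
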